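/- Let $n,k\ge 0$ be integers, let $M,N$ be smooth $n$-manifolds, let $g,h$ be smooth Riemannian metrics on $N$, and let $\varphi:M\to N$ be a smooth map such that $\bar g=\varphi^*g$ is a Riemannian metric on $M$ (equivalently, $\varphi$ is a local diffeomorphism). For a section $F$ of $(T^*M)^{\otimes p}\otimes\varphi^*TN$, the map covariant derivative $\nabla^{\bar g,h}F$ is given in local coordinates $x^i$ on $M$, $y^\alpha$ on $N$ by $$(\nabla^{\bar g,h}F)^{\alpha}_{i_1\cdots i_p m}=\partial_m F^{\alpha}_{i_1\cdots i_p}-\sum_{l=1}^p F^{\alpha}_{i_1\cdots j\cdots i_p}(\Gamma^{\bar g})^{j}_{m i_l}+F^{\gamma}_{i_1\cdots i_p}\,\partial_m\varphi^{\mu}\,\bigl((\Gamma^{h})^{\alpha}_{\gamma\mu}\circ\varphi\bigr),$$ where in the sum $j$ stands in the place of $i_l$. For a section $X$ of $\varphi^*TN$ put $\Delta^{\bar g,h}X=\operatorname{tr}^{\bar g}\nabla^{\bar g,h}\nabla^{\bar g,h}X$; for the map itself put $\nabla^{\bar g,h}\varphi=d\varphi$ and $\Delta^{\bar g,h}\varphi=\operatorname{tr}^{\bar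 g}\nabla^{\bar g,h}d\varphi$. The operators $\nabla^{g,h},\Delta^{g,h}$ are those of $\mathrm{id}:(N,g)\to(N,h)$. On $N$ let $A^{g,h}=\Gamma^g-\Gamma^h$ and $$(V^{g,h})^\gamma=g^{\alpha\beta}(A^{g,h})^\gamma_{\alpha\beta},\qquad (Z^{g,h})^\gamma=g^{\mu\alpha}g^{\nu\beta}\nabla^{g,h}_\mu\nabla^{g,h}_\nu(A^{g,h})^\gamma_{\alpha\beta}.$$ For a tensor $F$ on $N$ with $p$ lower indices and one upper index, $\varphi^*F$ is the section of $(T^*M)^{\otimes p}\otimes\varphi^*TN$ with components $(\varphi^*F)^\alpha_{i_1\cdots i_p}=(F^\alpha_{\beta_1\cdots\beta_p}\circ\varphi)\,\partial_{i_1}\varphi^{\beta_1}\cdots\partial_{i_p}\varphi^{\beta_p}$. Then \begin{align*} \varphi^*(A^{g,h})&=-\nabla^{\bar g,h}d\varphi,\\ \varphi^*\bigl[(\Delta^{g,h})^kV^{g,h}\bigr]&=-(\Delta^{\bar g,h})^{k+1}\varphi, \end{align*} and, if $k\ge1$, $$\varphi^*\bigl[(\Delta^{g,h})^{k-1}Z^{g,h}\bigr]=-(\Delta^{\bar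 g,h})^{k+1}\varphi+\mathcal P\bigl(\partial^{2k+1}\bar g,(\partial^{2k+1}h)\circ\varphi,\partial^{2k}\varphi\bigr).$$ Here $\mathcal P$ is an expression depending only on $n$ and $k$ (not on the manifolds, metrics, map or charts) such that the third identity holds in every pair of smooth charts of $M$ and $N$, on the part of the domain of the first that $\varphi$ maps into the domain of the second: a finite real linear combination of index contractions, with one free upper index on $N$, of products of coordinate derivatives of $\bar g_{ij}$ of order at most $2k+1$, coordinate derivatives of $h_{\alpha\beta}$ of order at most $2k+1$ composed with $\varphi$, coordinate derivatives of $\varphi^\alpha$ of order between $1$ and $2k$, and the inverse metrics $\bar g^{ij}$ and $h^{\alpha\beta}\circ\varphi$. -/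

import Mathlib

open scoped Manifold ContDiff

noncomputable section

namespace MapCov

/-! ### Coordinates, metrics and Christoffel symbols -/

/-- The model space `ℝⁿ`. -/
abbrev Model (n : ℕ) : Type := EuclideanSpace ℝ (Fin n)

/-- Smooth Riemannian metrics on the `n`-manifold `M`. -/
abbrev Metric (n : ℕ) (M : Type*) [TopologicalSpace M] [ChartedSpace (Model n) M]
    [IsManifold (𝓡 n) ∞ M] : Type _ :=
  Bundle.ContMDiffRiemannianMetric (𝓡 n) ∞ (Model n) (fun x : M => TangentSpace (𝓡 n) x)

/-- The partial derivative `∂f/∂xⁱ` of a function on `ℝⁿ`. -/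
def pd {n : ℕ} (i : Fin n) (f : Model n → ℝ) (u : Model n) : ℝ :=
  fderiv ℝ f u (EuclideanSpace.single i 1)

/-- Iterated partial derivatives `∂_{i₁} ⋯ ∂_{i_m} f` for the list `[i₁, …, i_m]`. -/
def pdList {n : ℕ} : List (Fin n) → (Model n → ℝ) → Model n → ℝ
  | [], f => f
  | i :: D, f => pd i (pdList D f)

section Charts

variable {n : ℕ} {M : Type*} [TopologicalSpace M] [ChartedSpace (Model n) M]

/-- The coordinate `dxⁱ(v)` of a tangent vector `v` at `x` in the chart `e`. -/
def coord (e : OpenPartialHomeomorph M (Model n)) (x : M) (i : Fin n) :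
    TangentSpace (𝓡 n) x →ₗ[ℝ] ℝ where
  toFun v := (show Model n from mfderiv (𝓡 n) (𝓡 n) e x v) i
  map_add' v w := by rw [map_add]; rfl
  map_smul' c v := by rw [map_smul]; rfl

/-- The coordinate vector `∂/∂xⁱ` at `x` in the chart `e`. -/
def frame (e : OpenPartialHomeomorph M (Model n)) (x : M) (i : Fin n) :
    TangentSpace (𝓡 n) x :=
  (mfderiv (𝓡 n) (𝓡 n) e x).inverse (show Model n from EuclideanSpace.single i 1)

variable [IsManifold (𝓡 n) ∞ M]

/-- The matrix `g_{ij}` of the metric at `x` in the chart `e`. -/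
def gram (g : Metric n M) (e : OpenPartialHomeomorph M (Model n)) (x : M) :
    Matrix (Fin n) (Fin n) ℝ :=
  Matrix.of fun i j => g.inner x (frame e x i) (frame e x j)

/-- The component `g_{ij}` as a function of the coordinates given by the chart `e`. -/
def metricComp (g : Metric n M) (e : OpenPartialHomeomorph M (Model n)) (i j : Fin n)
    (u : Model n) : ℝ :=
  gram g e (e.symm u) i j

/-- The Christoffel symbol `Γ^k_{ij}` of the Levi-Civita connection of `g` in the chart `e`,
as a function of the coordinates. -/
def christoffel (g : Metric n M) (e : OpenPartialHomeomorph M (Model n)) (k i j : Fin n)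
    (u : Model n) : ℝ :=
  (1 / 2) * ∑ l, (gram g e (e.symm u))⁻¹ k l *
    (pd i (metricComp g e j l) u + pd j (metricComp g e i l) u - pd l (metricComp g e i j) u)

end Charts

/-! ### Tensors along a map and the map covariant derivative -/

section Maps

variable {n : ℕ} {M N : Type*} [TopologicalSpace M] [ChartedSpace (Model n) M]
  [TopologicalSpace N] [ChartedSpace (Model n) N]

/-- Fields along `φ : M → N` with `p` covariant indices on `M` and one contravariant index on `N`,
i.e. sections of `(T*M)^{⊗ p} ⊗ φ*TN`. -/
abbrev TensorAlong (φ : M → N) (p : ℕ) : Type _ :=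
  ∀ x : M, MultilinearMap ℝ (fun _ : Fin p => TangentSpace (𝓡 n) x) (TangentSpace (𝓡 n) (φ x))

/-- The component `F^α_{i₁ ⋯ i_p}` in the charts `e` of `M` and `e'` of `N`, as a function of the
coordinates given by `e`. -/
def comp {φ : M → N} {p : ℕ} (F : TensorAlong (n := n) φ p)
    (e : OpenPartialHomeomorph M (Model n)) (e' : OpenPartialHomeomorph N (Model n))
    (i : Fin p → Fin n) (α : Fin n) (u : Model n) : ℝ :=
  coord e' (φ (e.symm u)) α (F (e.symm u) fun l => frame e (e.symm u) (i l))

/-- The coordinate expression `φ^α` of `φ` in the charts `e` and `e'`. -/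
def mapComp (φ : M → N) (e : OpenPartialHomeomorph M (Model n))
    (e' : OpenPartialHomeomorph N (Model n)) (α : Fin n) (u : Model n) : ℝ :=
  e' (φ (e.symm u)) α

/-- The tensor `∑ c^α_{i₁ ⋯ i_p} dx^{i₁} ⊗ ⋯ ⊗ dx^{i_p} ⊗ ∂/∂y^α` at `x`, in the charts
`e` of `M` and `e'` of `N`. -/
def ofComp (φ : M → N) {p : ℕ} (x : M) (e : OpenPartialHomeomorph M (Model n))
    (e' : OpenPartialHomeomorph N (Model n)) (c : (Fin p → Fin n) → Fin n → ℝ) :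
    MultilinearMap ℝ (fun _ : Fin p => TangentSpace (𝓡 n) x) (TangentSpace (𝓡 n) (φ x)) :=
  ∑ i : Fin p → Fin n, ∑ α : Fin n,
    c i α • ((MultilinearMap.mkPiAlgebra ℝ (Fin p) ℝ).compLinearMap
      (fun l => coord e x (i l))).smulRight (frame e' (φ x) α)

/-- The differential `dφ`. -/
def differential (φ : M → N) : TensorAlong (n := n) φ 1 := fun x =>
  MultilinearMap.ofSubsingleton ℝ (TangentSpace (𝓡 n) x) (TangentSpace (𝓡 n) (φ x)) (0 : Fin 1)
    (mfderiv (𝓡 n) (𝓡 n) φ x).toLinearMap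

/-- The pullback `φ*F` of a tensor `F` on `N` with `p` covariant indices and one contravariant
index: the covariant part is pulled back by `dφ`, the contravariant part is composed with `φ`. -/
def pullback (φ : M → N) {p : ℕ} (F : TensorAlong (n := n) (id : N → N) p) :
    TensorAlong (n := n) φ p := fun x =>
  (F (φ x)).compLinearMap fun _ => (mfderiv (𝓡 n) (𝓡 n) φ x).toLinearMap

variable [IsManifold (𝓡 n) ∞ M] [IsManifold (𝓡 n) ∞ N]

/-- The components of the map covariant derivative in charts `e` of `M` and `e'` of `N`:
`(∇F)^α_{i₁ ⋯ i_p m} = ∂_m F^α_{i₁ ⋯ i_p} - ∑_l F^α_{i₁ ⋯ k ⋯ i_p} (Γ^a)^k_{m i_l}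
  + F^γ_{i₁ ⋯ i_p} ∂_m φ^μ (Γ^b)^α_{γ μ} ∘ φ`.
The index of differentiation is the last one. -/
def covComp (a : Metric n M) (b : Metric n N) {φ : M → N} {p : ℕ} (F : TensorAlong (n := n) φ p)
    (e : OpenPartialHomeomorph M (Model n)) (e' : OpenPartialHomeomorph N (Model n))
    (I : Fin (p + 1) → Fin n) (α : Fin n) (u : Model n) : ℝ :=
  let i : Fin p → Fin n := Fin.init I
  let m : Fin n := I (Fin.last p)
  pd m (comp F e e' i α) u
    - ∑ l : Fin p, ∑ k : Fin n,
        comp F e e' (Function.update i l k) α u * christoffel a e k m (i l) u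
    + ∑ γ : Fin n, ∑ μ : Fin n,
        comp F e e' i γ u * pd m (mapComp φ e e' μ) u *
          christoffel b e' α γ μ (e' (φ (e.symm u)))

/-- The map covariant derivative `∇^{a,b} F` of a tensor `F` along `φ : (M, a) → (N, b)`. -/
def mapCov (a : Metric n M) (b : Metric n N) {φ : M → N} {p : ℕ}
    (F : TensorAlong (n := n) φ p) : TensorAlong (n := n) φ (p + 1) := fun x =>
  let e := chartAt (Model n) x
  let e' := chartAt (Model n) (φ x)
  ofComp φ x e e' fun I α => covComp a b F e e' I α (e x)

/-- The trace `a^{ij} F_{ij}` with respect to the metric `a` on `M`. -/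
def trace (a : Metric n M) {φ : M → N} (F : TensorAlong (n := n) φ 2) :
    TensorAlong (n := n) φ 0 := fun x =>
  let e := chartAt (Model n) x
  MultilinearMap.constOfIsEmpty ℝ _
    (∑ i, ∑ j, (gram a e x)⁻¹ i j • F x ![frame e x i, frame e x j])

/-- The map Laplacian `Δ^{a,b} = tr^a ∇^{a,b} ∇^{a,b}` on sections of `φ*TN`. -/
def mapLaplacian (a : Metric n M) (b : Metric n N) {φ : M → N}
    (X : TensorAlong (n := n) φ 0) : TensorAlong (n := n) φ 0 :=
  trace a (mapCov a b (mapCov a b X))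

/-- The power `(Δ^{a,b})^{k+1} φ` for the map `φ` itself: `∇^{a,b} φ = dφ`, so
`Δ^{a,b} φ = tr^a ∇^{a,b} dφ`, and the remaining powers act on sections of `φ*TN`. -/
def mapLaplacianPowSucc (a : Metric n M) (b : Metric n N) (φ : M → N) (k : ℕ) :
    TensorAlong (n := n) φ 0 :=
  (mapLaplacian a b)^[k] (trace a (mapCov a b (differential φ)))

end Maps

/-! ### The difference tensor and the vector fields `V` and `Z` -/

section TwoMetrics

variable {n : ℕ} {N : Type*} [TopologicalSpace N] [ChartedSpace (Model n) N]
  [IsManifold (𝓡 n) ∞ N]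

/-- The difference tensor `A^{g,h} = Γ^g - Γ^h`. -/
def differenceTensor (g h : Metric n N) : TensorAlong (n := n) (id : N → N) 2 := fun y =>
  let e := chartAt (Model n) y
  ofComp id y e e fun I γ =>
    christoffel g e γ (I 0) (I 1) (e y) - christoffel h e γ (I 0) (I 1) (e y)

/-- `V^γ = g^{αβ} A_{αβ}^γ`. -/
def fieldV (g h : Metric n N) : TensorAlong (n := n) (id : N → N) 0 :=
  trace g (differenceTensor g h)

/-- `Z^γ = g^{μα} g^{νβ} ∇_μ ∇_ν A_{αβ}^γ`, with `∇ = ∇^{g,h}` the mixed covariant derivative, that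
is, the map covariant derivative along the identity `(N, g) → (N, h)`. The slots of `∇∇A` are
`α, β, ν, μ` in this order. -/
def fieldZ (g h : Metric n N) : TensorAlong (n := n) (id : N → N) 0 := fun y =>
  let e := chartAt (Model n) y
  let G := (gram g e y)⁻¹
  MultilinearMap.constOfIsEmpty ℝ _
    (∑ μ, ∑ α, ∑ ν, ∑ β, (G μ α * G ν β) •
      mapCov g h (mapCov g h (differenceTensor g h)) y
        ![frame e y α, frame e y β, frame e y ν, frame e y μ])

end TwoMetrics

/-! ### Polynomials made of contractions -/

/-- One factor of a contraction, written with abstract indices: Latin labels in `Fin L` (for `M`)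
and Greek labels in `Fin (G + 1)` (for `N`). -/
inductive Factor (L G : ℕ) : Type
  /-- `∂_D ḡ_{ij}` -/
  | metricM (D : List (Fin L)) (i j : Fin L)
  /-- `ḡ^{ij}` -/
  | invMetricM (i j : Fin L)
  /-- `(∂_D h_{αβ}) ∘ φ` -/
  | metricN (D : List (Fin (G + 1))) (α β : Fin (G + 1))
  /-- `h^{αβ} ∘ φ` -/
  | invMetricN (α β : Fin (G + 1))
  /-- `∂_D φ^α` -/
  | map (D : List (Fin L)) (α : Fin (G + 1))

namespace Factor

variable {L G : ℕ}

/-- The lower Latin labels. -/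
def lowerM : Factor L G → List (Fin L)
  | metricM D i j => i :: j :: D
  | map D _ => D
  | _ => []

/-- The upper Latin labels. -/
def upperM : Factor L G → List (Fin L)
  | invMetricM i j => [i, j]
  | _ => []

/-- The lower Greek labels. -/
def lowerN : Factor L G → List (Fin (G + 1))
  | metricN D α β => α :: β :: D
  | _ => []

/-- The upper Greek labels. -/
def upperN : Factor L G → List (Fin (G + 1))
  | invMetricN α β => [α, β]
  | map _ α => [α]
  | _ => []

/-- The metrics `ḡ` and `h` are differentiated at most `p` and `q` times, and `φ` at least once and
at most `r` times. -/
def OrderLE (p q r : ℕ) : Factor L G → Prop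
  | metricM D _ _ => D.length ≤ p
  | invMetricM _ _ => True
  | metricN D _ _ => D.length ≤ q
  | invMetricN _ _ => True
  | map D _ => 1 ≤ D.length ∧ D.length ≤ r

/-- The value at `x`, in the charts `e` of `M` and `e'` of `N`, for the values `ρ` and `σ` of the
Latin and the Greek labels. -/
def eval {n : ℕ} {M N : Type*} [TopologicalSpace M] [ChartedSpace (Model n) M]
    [IsManifold (𝓡 n) ∞ M] [TopologicalSpace N] [ChartedSpace (Model n) N] [IsManifold (𝓡 n) ∞ N]
    (a : Metric n M) (b : Metric n N) (φ : M → N) (e : OpenPartialHomeomorph M (Model n))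
    (e' : OpenPartialHomeomorph N (Model n)) (x : M) (ρ : Fin L → Fin n)
    (σ : Fin (G + 1) → Fin n) : Factor L G → ℝ
  | metricM D i j => pdList (D.map ρ) (metricComp a e (ρ i) (ρ j)) (e x)
  | invMetricM i j => (gram a e x)⁻¹ (ρ i) (ρ j)
  | metricN D α β => pdList (D.map σ) (metricComp b e' (σ α) (σ β)) (e' (φ x))
  | invMetricN α β => (gram b e' (φ x))⁻¹ (σ α) (σ β)
  | map D α => pdList (D.map ρ) (mapComp φ e e' (σ α)) (e x)

end Factor

/-- A monomial with one free Greek index, the label `0`: a real coefficient times a product of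
factors, to be summed over all values of the other labels. -/
structure Monomial where
  coeff : ℝ
  numM : ℕ
  numN : ℕ
  factors : List (Factor numM numN)

namespace Monomial

/-- The monomial is a contraction: every Latin label and every Greek label other than `0` occurs
exactly once as a lower and exactly once as an upper index, the free label `0` occurs exactly once,
as an upper index. -/
def IsContraction (m : Monomial) : Prop :=
  (∀ i, (m.factors.flatMap Factor.lowerM).count i = 1) ∧
  (∀ i, (m.factors.flatMap Factor.upperM).count i = 1) ∧
  (∀ α, (m.factors.flatMap Factor.lowerN).count α = if α = 0 then 0 else 1) ∧
  (∀ α, (m.factors.flatMap Factor.upperN).count α = 1)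

variable {n : ℕ} {M N : Type*} [TopologicalSpace M] [ChartedSpace (Model n) M]
    [IsManifold (𝓡 n) ∞ M] [TopologicalSpace N] [ChartedSpace (Model n) N] [IsManifold (𝓡 n) ∞ N]

/-- The component `γ` of the contraction at `x`, in the charts `e` of `M` and `e'` of `N`. -/
def eval (m : Monomial) (a : Metric n M) (b : Metric n N) (φ : M → N)
    (e : OpenPartialHomeomorph M (Model n)) (e' : OpenPartialHomeomorph N (Model n))
    (γ : Fin n) (x : M) : ℝ :=
  m.coeff * ∑ ρ : Fin m.numM → Fin n, ∑ σ : Fin m.numN → Fin n,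
    (m.factors.map (Factor.eval a b φ e e' x ρ (Fin.cons γ σ))).prod

end Monomial

/-- Expressions `𝒫(∂^p ḡ, (∂^q h) ∘ φ, ∂^r φ)`: linear combinations of contractions of coordinate
derivatives of `ḡ` of order at most `p`, of `h` (composed with `φ`) of order at most `q` and of `φ`
of orders from `1` to `r`, and of the inverse metrics, with one free index `γ` on `N`. -/
def LowerOrder (p q r : ℕ) : Type :=
  {P : List Monomial // ∀ m ∈ P, m.IsContraction ∧ ∀ f ∈ m.factors, f.OrderLE p q r}

/-- The component `γ` of the expression at `x`, in the charts `e` of `M` and `e'` of `N`. -/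
def LowerOrder.eval {p q r n : ℕ} {M N : Type*} [TopologicalSpace M] [ChartedSpace (Model n) M]
    [IsManifold (𝓡 n) ∞ M] [TopologicalSpace N] [ChartedSpace (Model n) N] [IsManifold (𝓡 n) ∞ N]
    (P : LowerOrder p q r) (a : Metric n M) (b : Metric n N) (φ : M → N)
    (e : OpenPartialHomeomorph M (Model n)) (e' : OpenPartialHomeomorph N (Model n))
    (γ : Fin n) (x : M) : ℝ :=
  (P.1.map fun m => m.eval a b φ e e' γ x).sum

end MapCov

end

open scoped Manifold ContDiff

set_option linter.unusedSectionVars false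
set_option linter.unusedSimpArgs false

noncomputable section

namespace MapCov

open scoped Topology

section LocalFormulas

variable {n : ℕ}

/-! ### Calculus of partial derivatives -/

section Calculus

variable {f g : Model n → ℝ} {u : Model n}

/-! Since `φ` is a local isometry `(M, ḡ) → (N, g)`, pullback along `φ` intertwines the mixed
covariant derivatives, traces and Laplacians of `(g, h)` with those of `(ḡ, h)` (`pullback_mapCov`,
`pullback_trace`). On `N` the differential of the identity has constant components in a chart, so
its covariant derivative is `-Γ^g + Γ^h`; that is, `A = -∇ d(id)` (`differenceTensor_eq`). Pulling
this back gives `φ*A = -∇dφ`, and tracing and applying Laplacians gives the second identity.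

For the third identity, `φ*Z` is minus a trace of `∇∇∇dφ` which pairs the first slot with the fourth
and the second with the third, whereas `Δ²φ` pairs the first with the second and the third with the
fourth. Traces commute with `∇` (`localCov_localTrace`), so the two contractions differ only by
exchanging slots one and three of `∇∇dφ` under one more derivative. The Hessian `∇dφ` is symmetric,
hence this exchange is a commutator of covariant derivatives on `dφ`. By the Ricci identity
(`localCov_localCov_sub`) it involves two derivatives of the metrics and only one of `φ`. The
remaining derivative raises the orders `(2, 2, 1)` to `(3, 3, 2)`, and each of the `k - 1`
Laplacians adds two, which ends at `(2k+1, 2k+1, 2k)`.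

To obtain one universal expression `P`, the computation is done for abstract coordinate data
(`LocalData`). The predicate `IsExpr` records how often each label occurs below and above and is
closed under sums, products, renaming, contraction and differentiation. Christoffel symbols satisfy
it, and so does everything built from them (`IsTensorExpr.localCov`, `IsTensorExpr.crossTrace`).

The global operators are defined pointwise in preferred charts. The transformation law of
Christoffel symbols (`localChristoffel_pullback`) serves twice: applied to transition maps it gives
the component formulas in all charts (`comp_mapCov`, `comp_trace`), and applied to `φ` it gives
naturality. -/

theorem pd_congr (i : Fin n) (h : f =ᶠ[𝓝 u] g) : pd i f u = pd i g u := by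
  unfold pd; rw [h.fderiv_eq]

theorem contDiffAt_pd (i : Fin n) (h : ContDiffAt ℝ ∞ f u) : ContDiffAt ℝ ∞ (pd i f) u := by
  unfold pd
  exact (h.fderiv_right (m := ∞) (by simp)).clm_apply contDiffAt_const

theorem _root_.ContDiffAt.diffAt {F : Type*} [NormedAddCommGroup F] [NormedSpace ℝ F]
    {f : Model n → F} (h : ContDiffAt ℝ ∞ f u) : DifferentiableAt ℝ f u :=
  h.differentiableAt (by simp)

theorem pd_const (i : Fin n) (c : ℝ) : pd i (fun _ => c) u = 0 := by
  simp [pd]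

theorem pd_add (i : Fin n) (hf : ContDiffAt ℝ ∞ f u) (hg : ContDiffAt ℝ ∞ g u) :
    pd i (fun v => f v + g v) u = pd i f u + pd i g u := by
  unfold pd; rw [fderiv_fun_add hf.diffAt hg.diffAt]; rfl

theorem pd_sub (i : Fin n) (hf : ContDiffAt ℝ ∞ f u) (hg : ContDiffAt ℝ ∞ g u) :
    pd i (fun v => f v - g v) u = pd i f u - pd i g u := by
  unfold pd; rw [fderiv_fun_sub hf.diffAt hg.diffAt]; rfl

theorem pd_neg (i : Fin n) : pd i (fun v => - f v) u = - pd i f u := by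
  unfold pd; rw [fderiv_fun_neg]; rfl

theorem pd_mul (i : Fin n) (hf : ContDiffAt ℝ ∞ f u) (hg : ContDiffAt ℝ ∞ g u) :
    pd i (fun v => f v * g v) u = pd i f u * g u + f u * pd i g u := by
  unfold pd; rw [fderiv_fun_mul hf.diffAt hg.diffAt]; simp; ring

theorem pd_const_mul (i : Fin n) (c : ℝ) (hf : ContDiffAt ℝ ∞ f u) :
    pd i (fun v => c * f v) u = c * pd i f u := by
  rw [pd_mul i contDiffAt_const hf, pd_const]; simp

theorem pd_sum {ι : Type*} (s : Finset ι) (i : Fin n) {F : ι → Model n → ℝ}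
    (h : ∀ j ∈ s, ContDiffAt ℝ ∞ (F j) u) :
    pd i (fun v => ∑ j ∈ s, F j v) u = ∑ j ∈ s, pd i (F j) u := by
  unfold pd; rw [fderiv_fun_sum fun j hj => (h j hj).diffAt]; simp

theorem pd_prod {ι : Type*} [DecidableEq ι] (s : Finset ι) (i : Fin n) {F : ι → Model n → ℝ}
    (h : ∀ j ∈ s, ContDiffAt ℝ ∞ (F j) u) :
    pd i (fun v => ∏ j ∈ s, F j v) u = ∑ j ∈ s, pd i (F j) u * ∏ k ∈ s.erase j, F k u := by
  unfold pd
  rw [(HasFDerivAt.finsetProd fun j hj => (h j hj).diffAt.hasFDerivAt).fderiv]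
  simp [mul_comm]

theorem pd_comm (i j : Fin n) (hf : ContDiffAt ℝ ∞ f u) :
    pd i (pd j f) u = pd j (pd i f) u := by
  have hd : DifferentiableAt ℝ (fderiv ℝ f) u :=
    (hf.fderiv_right (m := ∞) (by simp)).diffAt
  have key : ∀ k l : Fin n, pd k (pd l f) u = fderiv ℝ (fderiv ℝ f) u (EuclideanSpace.single k 1)
      (EuclideanSpace.single l 1) := by
    intro k l
    unfold pd
    rw [fderiv_clm_apply hd (differentiableAt_const _)]
    simp
  rw [key, key]
  exact (hf.isSymmSndFDerivAt (by simpa using ENat.LEInfty.out)) _ _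

theorem pd_coord (i k : Fin n) : pd i (fun v : Model n => v k) u = if k = i then 1 else 0 := by
  have : (fun v : Model n => v k) = EuclideanSpace.proj (𝕜 := ℝ) k := rfl
  unfold pd
  rw [this, ContinuousLinearMap.fderiv]
  simp

theorem pd_comp (i : Fin n) {Φ : Model n → Model n} (hf : ContDiffAt ℝ ∞ f (Φ u))
    (hΦ : ContDiffAt ℝ ∞ Φ u) :
    pd i (fun v => f (Φ v)) u = ∑ k, pd k f (Φ u) * pd i (fun v => Φ v k) u := by
  unfold pd
  have h1 : fderiv ℝ (fun v => f (Φ v)) u = (fderiv ℝ f (Φ u)).comp (fderiv ℝ Φ u) :=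
    fderiv_comp u hf.diffAt hΦ.diffAt
  have h2 : ∀ k, fderiv ℝ (fun v => Φ v k) u (EuclideanSpace.single i 1) =
      fderiv ℝ Φ u (EuclideanSpace.single i 1) k := by
    intro k
    have := (EuclideanSpace.proj (𝕜 := ℝ) k).hasFDerivAt.comp u hΦ.diffAt.hasFDerivAt
    rw [show (fun v => Φ v k) = (EuclideanSpace.proj (𝕜 := ℝ) k) ∘ Φ from rfl, this.fderiv]
    rfl
  simp only [h1, h2, ContinuousLinearMap.comp_apply]
  set w := fderiv ℝ Φ u (EuclideanSpace.single i 1)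
  have hw : w = ∑ k, w k • EuclideanSpace.single k (1 : ℝ) := by
    ext j; simp [Pi.single_apply]
  conv_lhs => rw [hw]
  simp [mul_comm]

theorem contDiffAt_apply {Φ : Model n → Model n} (hΦ : ContDiffAt ℝ ∞ Φ u) (k : Fin n) :
    ContDiffAt ℝ ∞ (fun v => Φ v k) u :=
  (EuclideanSpace.proj (𝕜 := ℝ) k).contDiff.contDiffAt.comp u hΦ

theorem contDiffAt_sum {ι : Type*} [Fintype ι] {F : ι → Model n → ℝ}
    (h : ∀ j, ContDiffAt ℝ ∞ (F j) u) : ContDiffAt ℝ ∞ (fun v => ∑ j, F j v) u :=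
  ContDiffAt.sum fun j _ => h j

end Calculus

/-! ### Christoffel symbols and covariant derivatives on `ℝⁿ` -/

/-- The Christoffel symbols of the metric `a` on an open subset of `ℝⁿ`. -/
def localChristoffel (a : Fin n → Fin n → Model n → ℝ) (k i j : Fin n) (u : Model n) : ℝ :=
  (1 / 2) * ∑ l, (Matrix.of fun i j => a i j u)⁻¹ k l *
    (pd i (a j l) u + pd j (a i l) u - pd l (a i j) u)

/-- The map covariant derivative of the components `c` along the map `Φ` between open subsets
of `ℝⁿ` with metrics `a` and `b`. -/
def localCov (a b : Fin n → Fin n → Model n → ℝ) (Φ : Model n → Model n) {p : ℕ}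
    (c : (Fin p → Fin n) → Fin n → Model n → ℝ) (I : Fin (p + 1) → Fin n) (α : Fin n)
    (u : Model n) : ℝ :=
  pd (I (Fin.last p)) (c (Fin.init I) α) u
    - ∑ l : Fin p, ∑ k : Fin n, c (Function.update (Fin.init I) l k) α u *
        localChristoffel a k (I (Fin.last p)) (Fin.init I l) u
    + ∑ γ : Fin n, ∑ μ : Fin n, c (Fin.init I) γ u * pd (I (Fin.last p)) (fun v => Φ v μ) u *
        localChristoffel b α γ μ (Φ u)

/-- Smoothness at `u` of a metric with invertible symmetric component matrix. -/
structure IsMetricAt (a : Fin n → Fin n → Model n → ℝ) (u : Model n) : Prop where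
  contDiffAt : ∀ i j, ContDiffAt ℝ ∞ (a i j) u
  symm : ∀ i j, a i j = a j i
  isUnit_det : IsUnit (Matrix.of fun i j => a i j u).det

section Christoffel

variable {a b : Fin n → Fin n → Model n → ℝ} {u : Model n}

theorem localChristoffel_symm (hs : ∀ i j, a i j = a j i) (k i j : Fin n) :
    localChristoffel a k i j u = localChristoffel a k j i u := by
  unfold localChristoffel
  congr 1
  refine Finset.sum_congr rfl fun l _ => ?_
  rw [hs i j, add_comm (pd i _ u)]

/-- Lowering the upper index cancels the inverse metric and leaves the symbols of the first kind,
which are linear in the derivatives of the metric. Later identities are checked in this form. -/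
theorem sum_metric_localChristoffel (ha : IsMetricAt a u) (l i j : Fin n) :
    ∑ k, a l k u * localChristoffel a k i j u =
      (1 / 2) * (pd i (a j l) u + pd j (a i l) u - pd l (a i j) u) := by
  have hmul := Matrix.mul_nonsing_inv _ ha.isUnit_det
  have h1 : ∀ m, ∑ k, a l k u * (Matrix.of fun i j => a i j u)⁻¹ k m = if l = m then 1 else 0 := by
    intro m
    have := congrFun (congrFun hmul l) m
    rw [Matrix.mul_apply, Matrix.one_apply] at this
    exact this
  unfold localChristoffel
  calc _ = ∑ m, (∑ k, a l k u * (Matrix.of fun i j => a i j u)⁻¹ k m) *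
        ((1 / 2) * (pd i (a j m) u + pd j (a i m) u - pd m (a i j) u)) := by
        simp only [Finset.mul_sum, Finset.sum_mul]
        rw [Finset.sum_comm]
        refine Finset.sum_congr rfl fun _ _ => Finset.sum_congr rfl fun _ _ => ?_
        ring
    _ = _ := by simp [h1]

/-- By Cramer's rule an entry of the inverse is a quotient of determinants, which are polynomials in
smooth functions, with nonvanishing denominator. -/
theorem contDiffAt_inv (ha : IsMetricAt a u) (i j : Fin n) :
    ContDiffAt ℝ ∞ (fun v => (Matrix.of fun i j => a i j v)⁻¹ i j) u := by
  have hdet : ∀ m : Fin n → Fin n → Model n → ℝ, (∀ i j, ContDiffAt ℝ ∞ (m i j) u) →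
      ContDiffAt ℝ ∞ (fun v => (Matrix.of fun i j => m i j v).det) u := by
    intro m hm
    simp only [Matrix.det_apply', Matrix.of_apply]
    refine ContDiffAt.sum fun σ _ => contDiffAt_const.mul (contDiffAt_prod fun k _ => hm _ _)
  simp only [Matrix.inv_def, Matrix.smul_apply, Ring.inverse_eq_inv', smul_eq_mul,
    Matrix.adjugate_apply]
  refine ContDiffAt.mul ((hdet a ha.contDiffAt).inv ha.isUnit_det.ne_zero) ?_
  -- The matrix with one row replaced by a constant basis vector is again a matrix of smooth
  -- functions, so `hdet` covers the cofactors too.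
  have h : (fun v => ((Matrix.of fun i j => a i j v).updateRow j (Pi.single i 1)).det) =
      fun v => (Matrix.of fun k l =>
        (if k = j then fun _ => (Pi.single i 1 : Fin n → ℝ) l else a k l) v).det := by
    funext v
    congr 1
    ext k l
    simp only [Matrix.updateRow_apply, Matrix.of_apply]
    split_ifs <;> rfl
  rw [h]
  refine hdet _ fun k l => ?_
  split_ifs
  exacts [contDiffAt_const, ha.contDiffAt k l]

theorem contDiffAt_localChristoffel (ha : IsMetricAt a u) (k i j : Fin n) :
    ContDiffAt ℝ ∞ (localChristoffel a k i j) u := by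
  unfold localChristoffel
  refine contDiffAt_const.mul (contDiffAt_sum fun l => (contDiffAt_inv ha _ _).mul ?_)
  exact ((contDiffAt_pd _ (ha.contDiffAt _ _)).add (contDiffAt_pd _ (ha.contDiffAt _ _))).sub
    (contDiffAt_pd _ (ha.contDiffAt _ _))

/-- Metric compatibility of the Christoffel symbols. -/
theorem pd_metric (ha : IsMetricAt a u) (m i j : Fin n) :
    pd m (a i j) u = ∑ k, a k j u * localChristoffel a k m i u +
      ∑ k, a i k u * localChristoffel a k m j u := by
  have h1 := sum_metric_localChristoffel ha j m i
  have h2 := sum_metric_localChristoffel ha i m j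
  simp only [ha.symm j] at h1
  rw [h1, h2, ha.symm j i, ha.symm m j, ha.symm m i]
  ring

/-- By continuity the determinant stays nonzero near `u`. The relation is needed on a neighbourhood
because it will be differentiated. -/
theorem eventually_mul_inv (ha : IsMetricAt a u) (i j : Fin n) :
    (fun v => ∑ k, a i k v * (Matrix.of fun i j => a i j v)⁻¹ k j) =ᶠ[𝓝 u]
      fun _ => if i = j then 1 else 0 := by
  have hc : ContinuousAt (fun v => (Matrix.of fun i j => a i j v).det) u := by
    simp only [Matrix.det_apply', Matrix.of_apply]
    exact (ContDiffAt.sum fun σ _ => contDiffAt_const.mul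
      (contDiffAt_prod fun k _ => ha.contDiffAt _ _) : ContDiffAt ℝ ∞ _ u).continuousAt
  filter_upwards [hc.eventually_ne ha.isUnit_det.ne_zero] with v hv
  have := congrFun (congrFun (Matrix.mul_nonsing_inv _ (isUnit_iff_ne_zero.2 hv)) i) j
  rw [Matrix.mul_apply, Matrix.one_apply] at this
  exact this

theorem sum_inv_mul (ha : IsMetricAt a u) (i j : Fin n) :
    ∑ k, (Matrix.of fun i j => a i j u)⁻¹ i k * a k j u = if i = j then 1 else 0 := by
  have := congrFun (congrFun (Matrix.nonsing_inv_mul _ ha.isUnit_det) i) j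
  rw [Matrix.mul_apply, Matrix.one_apply] at this
  exact this

theorem inv_symm (hs : ∀ i j, a i j = a j i) (i j : Fin n) :
    (Matrix.of fun i j => a i j u)⁻¹ i j = (Matrix.of fun i j => a i j u)⁻¹ j i := by
  have h : (Matrix.of fun i j => a i j u).transpose = Matrix.of fun i j => a i j u := by
    ext i j; simp [hs i j]
  conv_lhs => rw [← h, ← Matrix.transpose_nonsing_inv]
  rfl

/-- Differentiate `a a⁻¹ = 1` and multiply by `a⁻¹` from the left. -/
theorem pd_inv (ha : IsMetricAt a u) (m i j : Fin n) :
    pd m (fun v => (Matrix.of fun i j => a i j v)⁻¹ i j) u =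
      -∑ k, ∑ l, (Matrix.of fun i j => a i j u)⁻¹ i k * pd m (a k l) u *
        (Matrix.of fun i j => a i j u)⁻¹ l j := by
  have h0 : ∀ k, ∑ l, (pd m (a k l) u * (Matrix.of fun i j => a i j u)⁻¹ l j +
      a k l u * pd m (fun v => (Matrix.of fun i j => a i j v)⁻¹ l j) u) = 0 := by
    intro k
    have h1 := pd_congr m (eventually_mul_inv ha k j)
    rw [pd_const, pd_sum _ _ fun l _ => (ha.contDiffAt _ _).mul (contDiffAt_inv ha _ _)] at h1
    rw [← h1]
    exact Finset.sum_congr rfl fun l _ =>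
      (pd_mul _ (ha.contDiffAt _ _) (contDiffAt_inv ha _ _)).symm
  have h2 : ∀ k, ∑ l, a k l u * pd m (fun v => (Matrix.of fun i j => a i j v)⁻¹ l j) u =
      -∑ l, pd m (a k l) u * (Matrix.of fun i j => a i j u)⁻¹ l j := by
    intro k
    have := h0 k
    rw [Finset.sum_add_distrib] at this
    linarith
  calc _ = ∑ l, (∑ k, (Matrix.of fun i j => a i j u)⁻¹ i k * a k l u) *
        pd m (fun v => (Matrix.of fun i j => a i j v)⁻¹ l j) u := by
        simp [sum_inv_mul ha]
    _ = ∑ k, (Matrix.of fun i j => a i j u)⁻¹ i k *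
        ∑ l, a k l u * pd m (fun v => (Matrix.of fun i j => a i j v)⁻¹ l j) u := by
        simp only [Finset.mul_sum, Finset.sum_mul]
        rw [Finset.sum_comm]
        simp only [mul_assoc]
    _ = _ := by
        simp only [h2, Finset.mul_sum, Finset.sum_neg_distrib, mul_neg, mul_assoc]

/-- Metric compatibility for the inverse metric. -/
theorem pd_inv_eq (ha : IsMetricAt a u) (m i j : Fin n) :
    pd m (fun v => (Matrix.of fun i j => a i j v)⁻¹ i j) u =
      -∑ k, (Matrix.of fun i j => a i j u)⁻¹ k j * localChristoffel a i m k u -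
        ∑ k, (Matrix.of fun i j => a i j u)⁻¹ i k * localChristoffel a j m k u := by
  have hinv : ∀ k l, ∑ x, (Matrix.of fun i j => a i j u)⁻¹ k x * a x l u =
    if k = l then 1 else 0 := sum_inv_mul ha
  have hinv' : ∀ k l, ∑ x, a k x u * (Matrix.of fun i j => a i j u)⁻¹ x l =
    if k = l then 1 else 0 := fun k l => (eventually_mul_inv ha k l).self_of_nhds
  rw [pd_inv ha]
  set A := (Matrix.of fun i j => a i j u)⁻¹
  -- Metric compatibility splits the derivative of `a` into two terms; in each of them one of the
  -- two inverse matrices cancels against `a`.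
  simp only [pd_metric ha]
  have e1 : ∑ k, ∑ l, A i k * (∑ x, a x l u * localChristoffel a x m k u) * A l j =
      ∑ k, A i k * localChristoffel a j m k u := by
    refine Finset.sum_congr rfl fun k _ => ?_
    calc _ = A i k * ∑ x, (∑ l, a x l u * A l j) * localChristoffel a x m k u := by
          simp only [Finset.mul_sum, Finset.sum_mul]
          rw [Finset.sum_comm]
          refine Finset.sum_congr rfl fun _ _ => Finset.sum_congr rfl fun _ _ => ?_
          ring
      _ = _ := by simp [hinv']
  have e2 : ∑ k, ∑ l, A i k * (∑ x, a k x u * localChristoffel a x m l u) * A l j =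
      ∑ l, A l j * localChristoffel a i m l u := by
    rw [Finset.sum_comm]
    refine Finset.sum_congr rfl fun l _ => ?_
    calc _ = A l j * ∑ x, (∑ k, A i k * a k x u) * localChristoffel a x m l u := by
          simp only [Finset.mul_sum, Finset.sum_mul]
          rw [Finset.sum_comm]
          refine Finset.sum_congr rfl fun _ _ => Finset.sum_congr rfl fun _ _ => ?_
          ring
      _ = _ := by simp [hinv]
  simp only [mul_add, add_mul, Finset.sum_add_distrib]
  rw [e1, e2]
  ring

end Christoffel

/-! ### Transformation laws -/

section Transformation

variable {a a' b b' : Fin n → Fin n → Model n → ℝ} {u : Model n}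

/-- The components `a` are those of the pullback of `b` by `τ`, near `u`. -/
def IsPullbackAt (a b : Fin n → Fin n → Model n → ℝ) (τ : Model n → Model n) (u : Model n) : Prop :=
  ∀ i j, a i j =ᶠ[𝓝 u] fun v => ∑ α, ∑ β, b α β (τ v) * pd i (fun w => τ w α) v *
    pd j (fun w => τ w β) v

/-- Differentiating `a = τ*b` and forming the Koszul combination gives the law with its free index
lowered by `a`. Lowering amounts to multiplication by the Jacobian times `b`, an invertible matrix,
so the index can be raised again. -/
theorem localChristoffel_pullback {τ : Model n → Model n} (ha : IsMetricAt a u)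
    (hb : IsMetricAt b (τ u)) (hτ : ContDiffAt ℝ ∞ τ u) (hab : IsPullbackAt a b τ u)
    (i j α : Fin n) :
    ∑ k, localChristoffel a k i j u * pd k (fun v => τ v α) u =
      pd i (pd j fun v => τ v α) u + ∑ β, ∑ γ, localChristoffel b α β γ (τ u) *
        pd i (fun v => τ v β) u * pd j (fun v => τ v γ) u := by
  have hτc : ∀ α, ContDiffAt ℝ ∞ (fun v => τ v α) u := contDiffAt_apply hτ
  have hτ1 : ∀ i α, ContDiffAt ℝ ∞ (pd i fun v => τ v α) u := fun i α => contDiffAt_pd i (hτc α)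
  have hbτ : ∀ α β, ContDiffAt ℝ ∞ (fun v => b α β (τ v)) u :=
    fun α β => (hb.contDiffAt α β).comp u hτ
  have hab0 : ∀ i j, a i j u = ∑ α, ∑ β, b α β (τ u) * pd i (fun w => τ w α) u *
    pd j (fun w => τ w β) u := fun i j => (hab i j).self_of_nhds
  -- `S` is the bilinear form `b` at `τ u`, and `T x y z` is the derivative of `b` in the direction
  -- `x`, evaluated on `y` and `z`.
  set S : (Fin n → ℝ) → (Fin n → ℝ) → ℝ := fun x y => ∑ α, ∑ β, b α β (τ u) * x α * y β with hS
  set T : (Fin n → ℝ) → (Fin n → ℝ) → (Fin n → ℝ) → ℝ := fun x y z =>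
    ∑ α, ∑ β, ∑ γ, pd γ (b α β) (τ u) * x γ * y α * z β with hT
  have Ssymm : ∀ x y, S x y = S y x := by
    intro x y
    simp only [hS]
    rw [Finset.sum_comm]
    refine Finset.sum_congr rfl fun _ _ => Finset.sum_congr rfl fun _ _ => ?_
    rw [hb.symm]; ring
  have Tsymm : ∀ x y z, T x y z = T x z y := by
    intro x y z
    simp only [hT]
    rw [Finset.sum_comm]
    refine Finset.sum_congr rfl fun _ _ => Finset.sum_congr rfl fun _ _ =>
      Finset.sum_congr rfl fun _ _ => ?_
    rw [hb.symm]; ring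
  set t : Fin n → Fin n → ℝ := fun i α => pd i (fun v => τ v α) u with ht
  set tt : Fin n → Fin n → Fin n → ℝ := fun i j α => pd i (pd j fun v => τ v α) u with htt
  have ttsymm : ∀ i j, tt i j = tt j i := fun i j => funext fun α => pd_comm i j (hτc α)
  have hpd : ∀ l i j, pd l (a i j) u = T (t l) (t i) (t j) + S (tt l i) (t j) +
      S (t i) (tt l j) := by
    intro l i j
    rw [pd_congr l (hab i j), pd_sum _ _ fun α _ => contDiffAt_sum fun β =>
      ((hbτ α β).mul (hτ1 i α)).mul (hτ1 j β)]
    simp only [hT, hS, ← Finset.sum_add_distrib]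
    refine Finset.sum_congr rfl fun α _ => ?_
    rw [pd_sum _ _ fun β _ => ((hbτ α β).mul (hτ1 i α)).mul (hτ1 j β)]
    refine Finset.sum_congr rfl fun β _ => ?_
    rw [pd_mul _ ((hbτ α β).mul (hτ1 i α)) (hτ1 j β), pd_mul _ (hbτ α β) (hτ1 i α),
      pd_comp _ (hb.contDiffAt α β) hτ]
    simp only [← Finset.sum_mul]
    simp only [ht, htt]
    ring
  -- Of the six terms with second derivatives of `τ` in the Koszul combination, four cancel by
  -- symmetry and the other two coincide.
  have hlow : ∀ l, ∑ k, a l k u * localChristoffel a k i j u = S (t l) (tt i j) +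
      (1 / 2) * (T (t i) (t j) (t l) + T (t j) (t i) (t l) - T (t l) (t i) (t j)) := by
    intro l
    rw [sum_metric_localChristoffel ha, hpd, hpd, hpd, ttsymm j i, Ssymm (tt l i),
      Ssymm (tt i j) (t l), Ssymm (t j), ttsymm i l, Ssymm (tt l i), ttsymm j l]
    ring
  have hlowb : ∀ l, ∑ β, t l β * ∑ α, b β α (τ u) * ∑ γ, ∑ δ, localChristoffel b α γ δ (τ u) *
      t i γ * t j δ = (1 / 2) * (T (t i) (t j) (t l) + T (t j) (t i) (t l) -
        T (t l) (t i) (t j)) := by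
    intro l
    have h1 : ∀ β, ∑ α, b β α (τ u) * ∑ γ, ∑ δ, localChristoffel b α γ δ (τ u) *
        t i γ * t j δ = ∑ γ, ∑ δ, (1 / 2) * (pd γ (b δ β) (τ u) + pd δ (b γ β) (τ u) -
          pd β (b γ δ) (τ u)) * t i γ * t j δ := by
      intro β
      simp only [← sum_metric_localChristoffel hb, Finset.mul_sum, Finset.sum_mul]
      rw [Finset.sum_comm]
      refine Finset.sum_congr rfl fun _ _ => ?_
      rw [Finset.sum_comm]
      refine Finset.sum_congr rfl fun _ _ => Finset.sum_congr rfl fun _ _ => ?_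
      ring
    have e1 : T (t i) (t j) (t l) = ∑ β, ∑ γ, ∑ δ, pd γ (b δ β) (τ u) * t i γ * t j δ * t l β := by
      simp only [hT]
      rw [Finset.sum_comm]
      exact Finset.sum_congr rfl fun _ _ => Finset.sum_comm
    have e2 : T (t j) (t i) (t l) = ∑ β, ∑ γ, ∑ δ, pd δ (b γ β) (τ u) * t j δ * t i γ * t l β := by
      simp only [hT]
      rw [Finset.sum_comm]
    have e3 : T (t l) (t i) (t j) = ∑ β, ∑ γ, ∑ δ, pd β (b γ δ) (τ u) * t l β * t i γ * t j δ := by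
      simp only [hT]
      conv_rhs => rw [Finset.sum_comm]
      exact Finset.sum_congr rfl fun _ _ => Finset.sum_comm
    rw [e1, e2, e3]
    simp only [h1]
    simp only [Finset.mul_sum, ← Finset.sum_add_distrib, ← Finset.sum_sub_distrib]
    refine Finset.sum_congr rfl fun _ _ => Finset.sum_congr rfl fun _ _ =>
      Finset.sum_congr rfl fun _ _ => ?_
    ring
  set J : Matrix (Fin n) (Fin n) ℝ := Matrix.of t
  set B : Matrix (Fin n) (Fin n) ℝ := Matrix.of fun α β => b α β (τ u)
  have hJ : (Matrix.of fun i j => a i j u) = J * B * J.transpose := by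
    ext i j
    simp only [Matrix.of_apply, hab0, Matrix.mul_apply, Matrix.transpose_apply, Finset.sum_mul, J, B]
    rw [Finset.sum_comm]
    refine Finset.sum_congr rfl fun _ _ => Finset.sum_congr rfl fun _ _ => ?_
    simp only [ht]; ring
  -- Invertibility of the Jacobian is not assumed; it is forced by nondegeneracy of the pulled back
  -- metric.
  have hdet : (J * B).det ≠ 0 := by
    have := ha.isUnit_det.ne_zero
    rw [hJ, Matrix.det_mul] at this
    exact left_ne_zero_of_mul this
  set L : Fin n → ℝ := fun α => ∑ k, localChristoffel a k i j u * t k α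
  set R : Fin n → ℝ := fun α => tt i j α + ∑ β, ∑ γ, localChristoffel b α β γ (τ u) *
        t i β * t j γ
  have key : L - R = 0 := by
    refine Matrix.eq_zero_of_mulVec_eq_zero hdet ?_
    rw [Matrix.mulVec_sub, sub_eq_zero]
    ext l
    have hl : ∀ w : Fin n → ℝ, ((J * B).mulVec w) l = ∑ β, t l β * ∑ α, b β α (τ u) * w α := by
      intro w
      rw [← Matrix.mulVec_mulVec]
      simp [Matrix.mulVec, dotProduct, J, B]
    rw [hl, hl]
    have hR : ∑ β, t l β * ∑ α, b β α (τ u) * R α = S (t l) (tt i j) +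
        ∑ β, t l β * ∑ α, b β α (τ u) * ∑ γ, ∑ δ, localChristoffel b α γ δ (τ u) *
          t i γ * t j δ := by
      simp only [R, mul_add, Finset.sum_add_distrib, hS]
      congr 1
      refine Finset.sum_congr rfl fun _ _ => ?_
      rw [Finset.mul_sum]
      refine Finset.sum_congr rfl fun _ _ => ?_
      ring
    rw [hR, hlowb, ← hlow]
    simp only [L, hab0, Finset.mul_sum, Finset.sum_mul]
    have : ∀ k, (∑ α, ∑ β, b α β (τ u) * pd l (fun w => τ w α) u * pd k (fun w => τ w β) u *
        localChristoffel a k i j u) = ∑ α, ∑ β, t l α * (b α β (τ u) *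
          (localChristoffel a k i j u * t k β)) := fun k =>
      Finset.sum_congr rfl fun _ _ => Finset.sum_congr rfl fun _ _ => by simp only [ht]; ring
    simp only [this]
    conv_rhs => rw [Finset.sum_comm]
    exact Finset.sum_congr rfl fun _ _ => Finset.sum_comm
  exact sub_eq_zero.1 (congrFun key α)

/-- Exchanging the `l`-th entry of `J` with `k` is an involution of the set of pairs `(J, k)`. It
renames dummy indices in the Christoffel corrections. -/
theorem sum_sum_update {p : ℕ} (l : Fin p) (G : (Fin p → Fin n) → Fin n → ℝ) :
    ∑ J, ∑ k, G J k = ∑ J, ∑ k, G (Function.update J l k) (J l) := by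
  rw [← Fintype.sum_prod_type', ← Fintype.sum_prod_type']
  let e : (Fin p → Fin n) × Fin n → (Fin p → Fin n) × Fin n :=
    fun x => (Function.update x.1 l x.2, x.1 l)
  have he : Function.Involutive e := fun x => by simp [e]
  exact (Equiv.sum_comp he.toPerm fun x => G x.1 x.2).symm

theorem sum_snoc {p : ℕ} {β : Type*} [AddCommMonoid β] (F : (Fin (p + 1) → Fin n) → β) :
    ∑ J, F J = ∑ J : Fin p → Fin n, ∑ k, F (Fin.snoc J k) := by
  rw [Finset.sum_comm, ← Fintype.sum_prod_type']
  exact (Equiv.sum_comp (Fin.snocEquiv fun _ => Fin n) F).symm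

/-- The only non-tensorial terms come from derivatives falling on the Jacobians of `τ`. The law `hΓ`
replaces these second derivatives by Christoffel terms upstairs, which cancel the corrections of
`c'`, and downstairs, which become the corrections of `c`. As `hΓ` is a hypothesis, both transition
maps and local isometries can serve as `τ`. -/
theorem localCov_pullback {p : ℕ} {c c' : (Fin p → Fin n) → Fin n → Model n → ℝ}
    {τ Φ Φ' : Model n → Model n}
    (hc : ∀ I α, c' I α =ᶠ[𝓝 u] fun v => ∑ J, c J α (τ v) * ∏ l, pd (I l) (fun w => τ w (J l)) v)
    (hcs : ∀ I α, ContDiffAt ℝ ∞ (c I α) (τ u)) (hτ : ContDiffAt ℝ ∞ τ u)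
    (hΦ : ContDiffAt ℝ ∞ Φ (τ u)) (hΦ' : Φ' =ᶠ[𝓝 u] fun v => Φ (τ v))
    (hΓ : ∀ i j k, ∑ m, localChristoffel a' m i j u * pd m (fun v => τ v k) u =
      pd i (pd j fun v => τ v k) u + ∑ β, ∑ γ, localChristoffel a k β γ (τ u) *
        pd i (fun v => τ v β) u * pd j (fun v => τ v γ) u)
    (I : Fin (p + 1) → Fin n) (α : Fin n) :
    localCov a' b Φ' c' I α u = ∑ J, localCov a b Φ c J α (τ u) *
      ∏ l, pd (I l) (fun w => τ w (J l)) u := by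
  have hτc : ∀ α, ContDiffAt ℝ ∞ (fun v => τ v α) u := contDiffAt_apply hτ
  have hτ1 : ∀ i α, ContDiffAt ℝ ∞ (pd i fun v => τ v α) u := fun i α => contDiffAt_pd i (hτc α)
  have hc0 : ∀ I α, c' I α u = ∑ J, c J α (τ u) * ∏ l, pd (I l) (fun w => τ w (J l)) u :=
    fun I α => (hc I α).self_of_nhds
  have hcτ : ∀ I α, ContDiffAt ℝ ∞ (fun v => c I α (τ v)) u := fun I α => (hcs I α).comp u hτ
  have hΦc : ∀ μ m, pd m (fun v => Φ' v μ) u =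
      ∑ q, pd q (fun v => Φ v μ) (τ u) * pd m (fun v => τ v q) u := by
    intro μ m
    refine (pd_congr m (hΦ'.fun_comp fun w : Model n => w μ)).trans ?_
    exact pd_comp m (contDiffAt_apply hΦ μ) hτ
  unfold localCov
  rw [sum_snoc]
  simp only [Fin.init_snoc, Fin.snoc_last, Fin.prod_univ_castSucc, Fin.snoc_castSucc]
  obtain ⟨I0, m, rfl⟩ : ∃ I0 m, I = Fin.snoc I0 m := ⟨Fin.init I, I (Fin.last p), by simp⟩
  simp only [Fin.init_snoc, Fin.snoc_last, Fin.snoc_castSucc]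
  set A : Fin n → Fin n → ℝ := fun i k => pd i (fun v => τ v k) u with hA
  rw [pd_congr m (hc I0 α)]
  rw [pd_sum _ _ fun J _ => (hcτ J α).mul (contDiffAt_prod fun l _ => hτ1 _ _)]
  -- Product rule, with each second derivative of `τ` eliminated by `hΓ`: the erased product lists
  -- the Jacobians that are not differentiated.
  have h1 : ∀ J : Fin p → Fin n, pd m (fun v => c J α (τ v) *
      ∏ l, pd (I0 l) (fun w => τ w (J l)) v) u =
      ∑ q, pd q (c J α) (τ u) * ((∏ l, A (I0 l) (J l)) * A m q) +
      ∑ l, c J α (τ u) * (∑ k, localChristoffel a' k m (I0 l) u * A k (J l)) *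
        ∏ l' ∈ Finset.univ.erase l, A (I0 l') (J l') -
      ∑ l, c J α (τ u) * (∑ β, ∑ γ, localChristoffel a (J l) β γ (τ u) * A m β * A (I0 l) γ) *
        ∏ l' ∈ Finset.univ.erase l, A (I0 l') (J l') := by
    intro J
    rw [pd_mul _ (hcτ J α) (contDiffAt_prod fun l _ => hτ1 _ _), pd_comp _ (hcs J α) hτ,
      pd_prod _ _ fun l _ => hτ1 _ _, add_sub_assoc, ← Finset.sum_sub_distrib]
    congr 1
    · rw [Finset.sum_mul]
      exact Finset.sum_congr rfl fun _ _ => by simp only [hA]; ring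
    · rw [Finset.mul_sum]
      refine Finset.sum_congr rfl fun l _ => ?_
      rw [hΓ m (I0 l) (J l)]
      simp only [hA]
      ring
  have hX : ∀ l, ∑ J : Fin p → Fin n, c J α (τ u) *
      (∑ k, localChristoffel a' k m (I0 l) u * A k (J l)) *
        ∏ l' ∈ Finset.univ.erase l, A (I0 l') (J l') =
      ∑ k, c' (Function.update I0 l k) α u * localChristoffel a' k m (I0 l) u := by
    intro l
    simp only [hc0, Finset.mul_sum, Finset.sum_mul]
    rw [Finset.sum_comm]
    refine Finset.sum_congr rfl fun k _ => Finset.sum_congr rfl fun J _ => ?_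
    rw [← Finset.mul_prod_erase _ _ (Finset.mem_univ l)]
    have : ∏ x ∈ Finset.univ.erase l, pd (Function.update I0 l k x) (fun w => τ w (J x)) u =
        ∏ l' ∈ Finset.univ.erase l, A (I0 l') (J l') :=
      Finset.prod_congr rfl fun x hx => by
        rw [Function.update_of_ne (Finset.ne_of_mem_erase hx)]
    rw [this]
    simp only [Function.update_self, hA]
    ring
  -- Here the dummy index of the Christoffel symbol has to change places with the `l`-th entry of
  -- `J`; this is the use of `sum_sum_update`.
  have hY : ∀ l, ∑ J : Fin p → Fin n, c J α (τ u) *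
      (∑ β, ∑ γ, localChristoffel a (J l) β γ (τ u) * A m β * A (I0 l) γ) *
        ∏ l' ∈ Finset.univ.erase l, A (I0 l') (J l') =
      ∑ J : Fin p → Fin n, ∑ q, (∑ k, c (Function.update J l k) α (τ u) *
        localChristoffel a k q (J l) (τ u)) * ((∏ l, A (I0 l) (J l)) * A m q) := by
    intro l
    have e1 : ∀ J : Fin p → Fin n, ∑ q, (∑ k, c (Function.update J l k) α (τ u) *
        localChristoffel a k q (J l) (τ u)) * ((∏ l, A (I0 l) (J l)) * A m q) =
        ∑ k, ∑ q, c (Function.update J l k) α (τ u) * localChristoffel a k q (J l) (τ u) *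
          (A (I0 l) (J l) * (∏ l' ∈ Finset.univ.erase l, A (I0 l') (J l')) * A m q) := by
      intro J
      rw [Finset.sum_comm]
      simp only [Finset.sum_mul, Finset.mul_prod_erase _ (fun x => A (I0 x) (J x))
        (Finset.mem_univ l)]
    simp only [e1]
    rw [sum_sum_update l]
    refine Finset.sum_congr rfl fun J _ => ?_
    simp only [Function.update_idem, Function.update_eq_self, Function.update_self]
    rw [mul_assoc, Finset.sum_mul, Finset.mul_sum, Finset.sum_comm]
    simp only [Finset.sum_mul, Finset.mul_sum]
    refine Finset.sum_congr rfl fun k _ => Finset.sum_congr rfl fun q _ => ?_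
    have : ∏ l' ∈ Finset.univ.erase l, A (I0 l') (Function.update J l q l') =
        ∏ l' ∈ Finset.univ.erase l, A (I0 l') (J l') :=
      Finset.prod_congr rfl fun x hx => by
        rw [Function.update_of_ne (Finset.ne_of_mem_erase hx)]
    rw [this]
    ring
  -- The connection term of the target is tensorial in the source index, by the chain rule for `Φ ∘
  -- τ`.
  have hZ : ∑ γ, ∑ μ, c' I0 γ u * pd m (fun v => Φ' v μ) u * localChristoffel b α γ μ (Φ' u) =
      ∑ J : Fin p → Fin n, ∑ q, (∑ γ, ∑ μ, c J γ (τ u) * pd q (fun v => Φ v μ) (τ u) *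
        localChristoffel b α γ μ (Φ (τ u))) * ((∏ l, A (I0 l) (J l)) * A m q) := by
    rw [hΦ'.self_of_nhds]
    simp only [hc0, hΦc, Finset.mul_sum, Finset.sum_mul]
    have e1 : ∀ F : (Fin n) → (Fin n) → (Fin n) → (Fin p → Fin n) → ℝ,
        ∑ γ, ∑ μ, ∑ q, ∑ J, F γ μ q J = ∑ J, ∑ q, ∑ γ, ∑ μ, F γ μ q J := by
      intro F
      have : ∀ γ, ∑ μ, ∑ q, ∑ J, F γ μ q J = ∑ J, ∑ q, ∑ μ, F γ μ q J := by
        intro γ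
        rw [Finset.sum_comm]
        conv_rhs => rw [Finset.sum_comm]
        exact Finset.sum_congr rfl fun _ _ => Finset.sum_comm
      simp only [this]
      rw [Finset.sum_comm]
      exact Finset.sum_congr rfl fun _ _ => Finset.sum_comm
    rw [e1]
    refine Finset.sum_congr rfl fun J _ => Finset.sum_congr rfl fun q _ =>
      Finset.sum_congr rfl fun γ _ => Finset.sum_congr rfl fun μ _ => ?_
    simp only [hA]
    ring
  rw [hZ]
  simp only [h1, Finset.sum_add_distrib, Finset.sum_sub_distrib, add_mul, sub_mul]
  rw [Finset.sum_comm (s := Finset.univ (α := Fin p → Fin n)) (t := Finset.univ (α := Fin p)),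
    Finset.sum_comm (s := Finset.univ (α := Fin p → Fin n)) (t := Finset.univ (α := Fin p))]
  simp only [hX, hY]
  have e2 : ∑ J : Fin p → Fin n, ∑ q, (∑ l, ∑ k, c (Function.update J l k) α (τ u) *
        localChristoffel a k q (J l) (τ u)) * ((∏ l, A (I0 l) (J l)) * A m q) =
      ∑ l, ∑ J : Fin p → Fin n, ∑ q, (∑ k, c (Function.update J l k) α (τ u) *
        localChristoffel a k q (J l) (τ u)) * ((∏ l, A (I0 l) (J l)) * A m q) := by
    simp only [Finset.sum_mul]
    conv_rhs => rw [Finset.sum_comm]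
    refine Finset.sum_congr rfl fun _ _ => ?_
    rw [Finset.sum_comm]
  rw [e2]
  ring

/-- The counterpart for a change of coordinates `θ` in the target. Only the upper index is affected,
and the second derivatives of `θ` are absorbed by the inhomogeneous term of the law for `b`. -/
theorem localCov_target {p : ℕ} {c c' : (Fin p → Fin n) → Fin n → Model n → ℝ}
    {θ Φ Φ' : Model n → Model n}
    (hc : ∀ I α, c' I α =ᶠ[𝓝 u] fun v => ∑ β, c I β v * pd β (fun w => θ w α) (Φ v))
    (hcs : ∀ I α, ContDiffAt ℝ ∞ (c I α) u) (hθ : ContDiffAt ℝ ∞ θ (Φ u))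
    (hΦ : ContDiffAt ℝ ∞ Φ u) (hΦ' : Φ' =ᶠ[𝓝 u] fun v => θ (Φ v))
    (hΓ : ∀ i j k, ∑ m, localChristoffel b m i j (Φ u) * pd m (fun v => θ v k) (Φ u) =
      pd i (pd j fun v => θ v k) (Φ u) + ∑ β, ∑ γ, localChristoffel b' k β γ (θ (Φ u)) *
        pd i (fun v => θ v β) (Φ u) * pd j (fun v => θ v γ) (Φ u))
    (I : Fin (p + 1) → Fin n) (α : Fin n) :
    localCov a b' Φ' c' I α u = ∑ β, localCov a b Φ c I β u * pd β (fun w => θ w α) (Φ u) := by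
  have hθc : ∀ α, ContDiffAt ℝ ∞ (fun v => θ v α) (Φ u) := contDiffAt_apply hθ
  have hθ1 : ∀ i α, ContDiffAt ℝ ∞ (pd i fun v => θ v α) (Φ u) :=
    fun i α => contDiffAt_pd i (hθc α)
  have hθΦ : ∀ i α, ContDiffAt ℝ ∞ (fun v => pd i (fun w => θ w α) (Φ v)) u :=
    fun i α => (hθ1 i α).comp u hΦ
  have hc0 : ∀ I α, c' I α u = ∑ β, c I β u * pd β (fun w => θ w α) (Φ u) :=
    fun I α => (hc I α).self_of_nhds
  have hΦc : ∀ μ m, pd m (fun v => Φ' v μ) u =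
      ∑ q, pd q (fun v => θ v μ) (Φ u) * pd m (fun v => Φ v q) u := by
    intro μ m
    refine (pd_congr m (hΦ'.fun_comp fun w : Model n => w μ)).trans ?_
    exact pd_comp m (hθc μ) hΦ
  obtain ⟨I0, m, rfl⟩ : ∃ I0 m, I = Fin.snoc I0 m := ⟨Fin.init I, I (Fin.last p), by simp⟩
  unfold localCov
  simp only [Fin.init_snoc, Fin.snoc_last]
  rw [pd_congr m (hc I0 α), pd_sum _ _ fun β _ => (hcs I0 β).mul (hθΦ β α), hΦ'.self_of_nhds]
  have h1 : ∀ β, pd m (fun v => c I0 β v * pd β (fun w => θ w α) (Φ v)) u =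
      pd m (c I0 β) u * pd β (fun w => θ w α) (Φ u) + c I0 β u *
        ∑ q, pd q (pd β fun w => θ w α) (Φ u) * pd m (fun v => Φ v q) u := by
    intro β
    rw [pd_mul _ (hcs I0 β) (hθΦ β α), pd_comp _ (hθ1 β α) hΦ]
  -- The derivatives of the Jacobian of `θ` together with the new connection term give the old
  -- connection term.
  have h2 : ∑ β, c I0 β u * ∑ q, pd q (pd β fun w => θ w α) (Φ u) * pd m (fun v => Φ v q) u +
      ∑ γ, ∑ μ, c' I0 γ u * pd m (fun v => Φ' v μ) u * localChristoffel b' α γ μ (θ (Φ u)) =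
      ∑ β, (∑ γ, ∑ μ, c I0 γ u * pd m (fun v => Φ v μ) u * localChristoffel b β γ μ (Φ u)) *
        pd β (fun w => θ w α) (Φ u) := by
    have e1 : ∑ β, (∑ γ, ∑ μ, c I0 γ u * pd m (fun v => Φ v μ) u *
        localChristoffel b β γ μ (Φ u)) * pd β (fun w => θ w α) (Φ u) =
        ∑ γ, ∑ μ, c I0 γ u * pd m (fun v => Φ v μ) u *
          ∑ β, localChristoffel b β γ μ (Φ u) * pd β (fun w => θ w α) (Φ u) := by
      simp only [Finset.sum_mul, Finset.mul_sum]
      rw [Finset.sum_comm]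
      refine Finset.sum_congr rfl fun _ _ => ?_
      rw [Finset.sum_comm]
      refine Finset.sum_congr rfl fun _ _ => Finset.sum_congr rfl fun _ _ => by ring
    rw [e1]
    simp only [hΓ, mul_add, Finset.sum_add_distrib, hc0, hΦc]
    congr 1
    · refine Finset.sum_congr rfl fun β _ => ?_
      rw [Finset.mul_sum]
      refine Finset.sum_congr rfl fun q _ => ?_
      rw [pd_comm q β (hθc α)]
      ring
    · simp only [Finset.sum_mul, Finset.mul_sum]
      have e2 : ∀ F : Fin n → Fin n → Fin n → Fin n → ℝ,
          ∑ γ, ∑ μ, ∑ q, ∑ β, F γ μ q β = ∑ β, ∑ q, ∑ γ, ∑ μ, F γ μ q β := by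
        intro F
        have : ∀ γ, ∑ μ, ∑ q, ∑ J, F γ μ q J = ∑ J, ∑ q, ∑ μ, F γ μ q J := by
          intro γ
          rw [Finset.sum_comm]
          conv_rhs => rw [Finset.sum_comm]
          exact Finset.sum_congr rfl fun _ _ => Finset.sum_comm
        simp only [this]
        rw [Finset.sum_comm]
        exact Finset.sum_congr rfl fun _ _ => Finset.sum_comm
      rw [e2]
      refine Finset.sum_congr rfl fun _ _ => Finset.sum_congr rfl fun _ _ =>
        Finset.sum_congr rfl fun _ _ => Finset.sum_congr rfl fun _ _ => by ring
  have h3 : ∑ l, ∑ k, c' (Function.update I0 l k) α u * localChristoffel a k m (I0 l) u =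
      ∑ β, (∑ l, ∑ k, c (Function.update I0 l k) β u * localChristoffel a k m (I0 l) u) *
        pd β (fun w => θ w α) (Φ u) := by
    simp only [hc0, Finset.sum_mul]
    conv_rhs => rw [Finset.sum_comm]
    refine Finset.sum_congr rfl fun _ _ => ?_
    conv_rhs => rw [Finset.sum_comm]
    refine Finset.sum_congr rfl fun _ _ => Finset.sum_congr rfl fun _ _ => by ring
  simp only [h1, add_mul, sub_mul, Finset.sum_add_distrib, Finset.sum_sub_distrib]
  rw [h3, ← h2]
  ring

end Transformation

/-! ### Properties of the covariant derivative on `ℝⁿ` -/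

section LocalCov

variable {a b : Fin n → Fin n → Model n → ℝ} {Φ : Model n → Model n} {u : Model n} {p : ℕ}

theorem localCov_congr {c c' : (Fin p → Fin n) → Fin n → Model n → ℝ}
    (h : ∀ I α, c I α =ᶠ[𝓝 u] c' I α) (I : Fin (p + 1) → Fin n) (α : Fin n) :
    localCov a b Φ c I α u = localCov a b Φ c' I α u := by
  unfold localCov
  simp only [fun I α => (h I α).self_of_nhds, pd_congr _ (h _ _)]

theorem eventually_localCov_congr {c c' : (Fin p → Fin n) → Fin n → Model n → ℝ}
    (h : ∀ I α, c I α =ᶠ[𝓝 u] c' I α) (I : Fin (p + 1) → Fin n) (α : Fin n) :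
    localCov a b Φ c I α =ᶠ[𝓝 u] localCov a b Φ c' I α := by
  have := (Filter.eventually_all.2 fun I => Filter.eventually_all.2 fun α =>
    eventually_eventually_nhds.2 (h I α))
  filter_upwards [this] with v hv using localCov_congr hv I α

theorem localCov_sub {c c' : (Fin p → Fin n) → Fin n → Model n → ℝ}
    (h : ∀ I α, ContDiffAt ℝ ∞ (c I α) u) (h' : ∀ I α, ContDiffAt ℝ ∞ (c' I α) u)
    (I : Fin (p + 1) → Fin n) (α : Fin n) :
    localCov a b Φ (fun I α v => c I α v - c' I α v) I α u =
      localCov a b Φ c I α u - localCov a b Φ c' I α u := by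
  unfold localCov
  rw [pd_sub _ (h _ _) (h' _ _)]
  simp only [sub_mul, Finset.sum_sub_distrib]
  ring

theorem localCov_neg (c : (Fin p → Fin n) → Fin n → Model n → ℝ)
    (I : Fin (p + 1) → Fin n) (α : Fin n) :
    localCov a b Φ (fun I α v => -c I α v) I α u = -localCov a b Φ c I α u := by
  unfold localCov
  rw [pd_neg]
  simp only [neg_mul, Finset.sum_neg_distrib]
  ring

theorem contDiffAt_localCov {c : (Fin p → Fin n) → Fin n → Model n → ℝ} (ha : IsMetricAt a u)
    (hb : IsMetricAt b (Φ u)) (hΦ : ContDiffAt ℝ ∞ Φ u) (hc : ∀ I α, ContDiffAt ℝ ∞ (c I α) u)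
    (I : Fin (p + 1) → Fin n) (α : Fin n) : ContDiffAt ℝ ∞ (localCov a b Φ c I α) u := by
  unfold localCov
  refine ((contDiffAt_pd _ (hc _ _)).sub (contDiffAt_sum fun l => contDiffAt_sum fun k =>
    (hc _ _).mul (contDiffAt_localChristoffel ha _ _ _))).add (contDiffAt_sum fun γ =>
    contDiffAt_sum fun μ => ((hc _ _).mul (contDiffAt_pd _ (contDiffAt_apply hΦ _))).mul ?_)
  exact (contDiffAt_localChristoffel hb _ _ _).comp u hΦ

/-- The Christoffel corrections form a sum over the slots, one for each, so permuting the old slots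
only reorders this sum. -/
theorem localCov_perm (π : Equiv.Perm (Fin p)) (c : (Fin p → Fin n) → Fin n → Model n → ℝ)
    (I : Fin p → Fin n) (m α : Fin n) :
    localCov a b Φ (fun I => c (I ∘ π)) (Fin.snoc I m) α u =
      localCov a b Φ c (Fin.snoc (I ∘ π) m) α u := by
  unfold localCov
  simp only [Fin.init_snoc, Fin.snoc_last]
  congr 2
  rw [← Equiv.sum_comp π]
  refine Finset.sum_congr rfl fun l _ => Finset.sum_congr rfl fun k _ => ?_
  rw [Function.update_comp_eq_of_injective _ π.injective]
  rfl

/-- The trace of the first two indices. -/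
def localTrace (a : Fin n → Fin n → Model n → ℝ) (c : (Fin (p + 2) → Fin n) → Fin n → Model n → ℝ)
    (I : Fin p → Fin n) (α : Fin n) (u : Model n) : ℝ :=
  ∑ i, ∑ j, (Matrix.of fun i j => a i j u)⁻¹ i j * c (Fin.cons i (Fin.cons j I)) α u

theorem contDiffAt_localTrace {c : (Fin (p + 2) → Fin n) → Fin n → Model n → ℝ}
    (ha : IsMetricAt a u) (hc : ∀ I α, ContDiffAt ℝ ∞ (c I α) u) (I : Fin p → Fin n) (α : Fin n) :
    ContDiffAt ℝ ∞ (localTrace a c I α) u :=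
  contDiffAt_sum fun _ => contDiffAt_sum fun _ => (contDiffAt_inv ha _ _).mul (hc _ _)

theorem localTrace_congr {c c' : (Fin (p + 2) → Fin n) → Fin n → Model n → ℝ}
    (h : ∀ I α, c I α =ᶠ[𝓝 u] c' I α) (I : Fin p → Fin n) (α : Fin n) :
    localTrace a c I α =ᶠ[𝓝 u] localTrace a c' I α := by
  have := (Filter.eventually_all.2 fun I => Filter.eventually_all.2 fun α => h I α)
  filter_upwards [this] with v hv
  simp only [localTrace, hv]

/-- The inverse metric is parallel: by `pd_inv_eq` its derivative supplies the Christoffel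
corrections of the two traced slots. The new derivative slot is the last one, so the traced slots
remain the first two. -/
theorem localCov_localTrace {c : (Fin (p + 2) → Fin n) → Fin n → Model n → ℝ}
    (ha : IsMetricAt a u) (hc : ∀ I α, ContDiffAt ℝ ∞ (c I α) u) (I : Fin (p + 1) → Fin n)
    (α : Fin n) :
    localCov a b Φ (localTrace a c) I α u = localTrace a (localCov a b Φ c) I α u := by
  obtain ⟨I, m, rfl⟩ : ∃ I0 m, I = Fin.snoc I0 m := ⟨Fin.init I, I (Fin.last p), by simp⟩
  unfold localCov localTrace
  have hinit : ∀ i j, Fin.init (Fin.cons i (Fin.cons j (Fin.snoc I m : Fin (p + 1) → Fin n) :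
      Fin (p + 2) → Fin n) : Fin (p + 3) → Fin n) = Fin.cons i (Fin.cons j I) := by
    intro i j
    rw [Fin.cons_snoc_eq_snoc_cons, Fin.cons_snoc_eq_snoc_cons, Fin.init_snoc]
  have hlast : ∀ i j, (Fin.cons i (Fin.cons j (Fin.snoc I m : Fin (p + 1) → Fin n) :
      Fin (p + 2) → Fin n) : Fin (p + 3) → Fin n) (Fin.last (p + 2)) = m := by
    intro i j
    rw [Fin.cons_snoc_eq_snoc_cons, Fin.cons_snoc_eq_snoc_cons, Fin.snoc_last]
  simp only [Fin.init_snoc, Fin.snoc_last, hinit, hlast]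
  rw [pd_sum _ _ fun i _ => contDiffAt_sum fun j => (contDiffAt_inv ha i j).mul (hc _ _)]
  have h1 : ∀ i, pd m (fun v => ∑ j, (Matrix.of fun i j => a i j v)⁻¹ i j *
      c (Fin.cons i (Fin.cons j I)) α v) u =
      ∑ j, (pd m (fun v => (Matrix.of fun i j => a i j v)⁻¹ i j) u *
        c (Fin.cons i (Fin.cons j I)) α u + (Matrix.of fun i j => a i j u)⁻¹ i j *
          pd m (c (Fin.cons i (Fin.cons j I)) α) u) := by
    intro i
    rw [pd_sum _ _ fun j _ => (contDiffAt_inv ha i j).mul (hc _ _)]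
    exact Finset.sum_congr rfl fun j _ => pd_mul _ (contDiffAt_inv ha i j) (hc _ _)
  simp only [h1, pd_inv_eq ha]
  set A := (Matrix.of fun i j => a i j u)⁻¹
  simp only [Fin.sum_univ_succ (n := p + 1), Fin.sum_univ_succ (n := p), Fin.cons_zero,
    Fin.cons_succ, Fin.update_cons_zero, ← Fin.cons_update]
  -- `e1` and `e2` match the two halves of the derivative of the inverse metric with the corrections
  -- in the first and in the second slot, by renaming dummy indices.
  have e1 : ∑ i, ∑ j, (∑ k, A k j * localChristoffel a i m k u) * c (Fin.cons i (Fin.cons j I)) α u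
      = ∑ i, ∑ j, A i j * ∑ k, c (Fin.cons k (Fin.cons j I)) α u *
        localChristoffel a k m i u := by
    rw [Finset.sum_comm]
    conv_rhs => rw [Finset.sum_comm]
    refine Finset.sum_congr rfl fun j _ => ?_
    simp only [Finset.sum_mul, Finset.mul_sum]
    rw [Finset.sum_comm]
    exact Finset.sum_congr rfl fun _ _ => Finset.sum_congr rfl fun _ _ => by ring
  have e2 : ∑ i, ∑ j, (∑ k, A i k * localChristoffel a j m k u) * c (Fin.cons i (Fin.cons j I)) α u
      = ∑ i, ∑ j, A i j * ∑ k, c (Fin.cons i (Fin.cons k I)) α u *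
        localChristoffel a k m j u := by
    refine Finset.sum_congr rfl fun j _ => ?_
    simp only [Finset.sum_mul, Finset.mul_sum]
    rw [Finset.sum_comm]
    exact Finset.sum_congr rfl fun _ _ => Finset.sum_congr rfl fun _ _ => by ring
  have e3 : ∑ l, ∑ k, (∑ i, ∑ j, A i j * c (Fin.cons i (Fin.cons j (Function.update I l k))) α u) *
      localChristoffel a k m (I l) u = ∑ i, ∑ j, A i j * ∑ l, ∑ k,
        c (Fin.cons i (Fin.cons j (Function.update I l k))) α u *
      localChristoffel a k m (I l) u := by
    simp only [Finset.sum_mul, Finset.mul_sum, ← mul_assoc]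
    have : ∀ F : Fin p → Fin n → Fin n → Fin n → ℝ,
        ∑ l, ∑ k, ∑ i, ∑ j, F l k i j = ∑ i, ∑ j, ∑ l, ∑ k, F l k i j := by
      intro F
      have : ∀ l, ∑ k, ∑ i, ∑ j, F l k i j = ∑ i, ∑ j, ∑ k, F l k i j := by
        intro l
        rw [Finset.sum_comm]
        exact Finset.sum_congr rfl fun _ _ => Finset.sum_comm
      simp only [this]
      rw [Finset.sum_comm]
      exact Finset.sum_congr rfl fun _ _ => Finset.sum_comm
    rw [this]
  have e4 : ∑ γ, ∑ μ, (∑ i, ∑ j, A i j * c (Fin.cons i (Fin.cons j I)) γ u) *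
      pd m (fun v => Φ v μ) u * localChristoffel b α γ μ (Φ u) = ∑ i, ∑ j, A i j * ∑ γ, ∑ μ,
        c (Fin.cons i (Fin.cons j I)) γ u * pd m (fun v => Φ v μ) u *
          localChristoffel b α γ μ (Φ u) := by
    simp only [Finset.sum_mul, Finset.mul_sum, ← mul_assoc]
    have : ∀ F : Fin n → Fin n → Fin n → Fin n → ℝ,
        ∑ l, ∑ k, ∑ i, ∑ j, F l k i j = ∑ i, ∑ j, ∑ l, ∑ k, F l k i j := by
      intro F
      have : ∀ l, ∑ k, ∑ i, ∑ j, F l k i j = ∑ i, ∑ j, ∑ k, F l k i j := by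
        intro l
        rw [Finset.sum_comm]
        exact Finset.sum_congr rfl fun _ _ => Finset.sum_comm
      simp only [this]
      rw [Finset.sum_comm]
      exact Finset.sum_congr rfl fun _ _ => Finset.sum_comm
    rw [this]
  rw [e3, e4]
  simp only [mul_add, mul_sub, sub_mul, neg_mul, Finset.sum_add_distrib,
    Finset.sum_sub_distrib, Finset.sum_neg_distrib]
  rw [e1, e2]
  ring

end LocalCov

/-! ### The Ricci identity for the differential of a map -/

section Ricci

variable {a b : Fin n → Fin n → Model n → ℝ} {Φ : Model n → Model n} {u : Model n}

theorem localCov_one_apply (c : (Fin 1 → Fin n) → Fin n → Model n → ℝ) (i j α : Fin n) :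
    localCov a b Φ c ![i, j] α u = pd j (c ![i] α) u -
      ∑ k, c ![k] α u * localChristoffel a k j i u +
      ∑ γ, ∑ μ, c ![i] γ u * pd j (fun v => Φ v μ) u * localChristoffel b α γ μ (Φ u) := by
  have h : Fin.init ![i, j] = ![i] := by ext l; fin_cases l; rfl
  have h1 : ∀ k, Function.update ![i] 0 k = ![k] := by intro k; ext l; fin_cases l; rfl
  simp [localCov, h, h1, show Fin.last 1 = 1 from rfl]

theorem localCov_two_apply (c : (Fin 2 → Fin n) → Fin n → Model n → ℝ) (i j m α : Fin n) :
    localCov a b Φ c ![i, j, m] α u = pd m (c ![i, j] α) u -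
      ∑ k, c ![k, j] α u * localChristoffel a k m i u -
      ∑ k, c ![i, k] α u * localChristoffel a k m j u +
      ∑ γ, ∑ μ, c ![i, j] γ u * pd m (fun v => Φ v μ) u * localChristoffel b α γ μ (Φ u) := by
  have h : Fin.init ![i, j, m] = ![i, j] := by ext l; fin_cases l <;> rfl
  have h1 : ∀ k, Function.update ![i, j] 0 k = ![k, j] := by intro k; ext l; fin_cases l <;> rfl
  have h2 : ∀ k, Function.update ![i, j] 1 k = ![i, k] := by intro k; ext l; fin_cases l <;> rfl
  simp [localCov, h, h1, h2, show Fin.last 2 = 2 from rfl, sub_sub]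

/-- The components of the differential of `Φ`. -/
def localDifferential (Φ : Model n → Model n) (I : Fin 1 → Fin n) (α : Fin n) : Model n → ℝ :=
  pd (I 0) fun v => Φ v α

/-- The connection form of the pullback of the tangent bundle by `Φ`. -/
def connectionForm (b : Fin n → Fin n → Model n → ℝ) (Φ : Model n → Model n) (m α γ : Fin n)
    (u : Model n) : ℝ :=
  ∑ μ, pd m (fun v => Φ v μ) u * localChristoffel b α γ μ (Φ u)

/-- One half of the curvature term in the Ricci identity for the differential of `Φ`. -/
def curvatureTerm (a b : Fin n → Fin n → Model n → ℝ) (Φ : Model n → Model n)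
    (i j m α : Fin n) (u : Model n) : ℝ :=
  -(∑ k, pd m (localChristoffel a k j i) u * pd k (fun v => Φ v α) u) +
    (∑ γ, ∑ μ, pd i (fun v => Φ v γ) u * pd j (fun v => Φ v μ) u *
      pd m (fun v => localChristoffel b α γ μ (Φ v)) u) +
    (∑ k, ∑ l, localChristoffel a k m i u * localChristoffel a l j k u * pd l (fun v => Φ v α) u) +
    ∑ γ, ∑ δ, connectionForm b Φ m α δ u * connectionForm b Φ j δ γ u * pd i (fun v => Φ v γ) u

theorem contDiffAt_localDifferential (hΦ : ContDiffAt ℝ ∞ Φ u) (I : Fin 1 → Fin n) (α : Fin n) :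
    ContDiffAt ℝ ∞ (localDifferential Φ I α) u :=
  contDiffAt_pd _ (contDiffAt_apply hΦ α)

/-- Second partial derivatives commute and both connections are torsion free. -/
theorem localCov_localDifferential_symm (ha : ∀ i j, a i j = a j i) (hb : ∀ i j, b i j = b j i)
    (hΦ : ContDiffAt ℝ ∞ Φ u) (i j α : Fin n) :
    localCov a b Φ (localDifferential Φ) ![i, j] α u =
      localCov a b Φ (localDifferential Φ) ![j, i] α u := by
  simp only [localCov_one_apply, localDifferential, Matrix.cons_val_zero]
  rw [pd_comm j i (contDiffAt_apply hΦ α), Finset.sum_comm (s := Finset.univ (α := Fin n))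
    (f := fun γ μ => pd i (fun v => Φ v γ) u * pd j (fun v => Φ v μ) u * _)]
  congr 1
  · congr 1
    exact Finset.sum_congr rfl fun k _ => by rw [localChristoffel_symm ha]
  · exact Finset.sum_congr rfl fun γ _ => Finset.sum_congr rfl fun μ _ => by
      rw [localChristoffel_symm hb]; ring

/-- The Ricci identity. Every term containing a second or third derivative of `Φ` is symmetric in
`j, m`, possibly together with a partner term, and drops out on antisymmetrization. What remains is
of first order in `Φ`. -/
theorem localCov_localCov_sub (ha : IsMetricAt a u) (hb : IsMetricAt b (Φ u))
    (hΦ : ContDiffAt ℝ ∞ Φ u) (i j m α : Fin n) :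
    localCov a b Φ (localCov a b Φ (localDifferential Φ)) ![i, j, m] α u -
      localCov a b Φ (localCov a b Φ (localDifferential Φ)) ![i, m, j] α u =
    curvatureTerm a b Φ i j m α u - curvatureTerm a b Φ i m j α u := by
  have hΦc : ∀ α, ContDiffAt ℝ ∞ (fun v => Φ v α) u := contDiffAt_apply hΦ
  set x : Fin n → Fin n → Model n → ℝ := fun i α => pd i fun v => Φ v α with hx
  have hxs : ∀ i α, ContDiffAt ℝ ∞ (x i α) u := fun i α => contDiffAt_pd i (hΦc α)
  set W := connectionForm b Φ with hW
  set G := localChristoffel a with hG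
  have hGs : ∀ k i j, ContDiffAt ℝ ∞ (G k i j) u := contDiffAt_localChristoffel ha
  have hBs : ∀ k i j, ContDiffAt ℝ ∞ (fun v => localChristoffel b k i j (Φ v)) u :=
    fun k i j => (contDiffAt_localChristoffel hb k i j).comp u hΦ
  have hWs : ∀ m α γ, ContDiffAt ℝ ∞ (W m α γ) u := fun m α γ =>
    contDiffAt_sum fun μ => (hxs m μ).mul (hBs _ _ _)
  have hcov : ∀ i j α v, localCov a b Φ (localDifferential Φ) ![i, j] α v =
      pd j (x i α) v - ∑ k, x k α v * G k j i v + ∑ γ, x i γ v * W j α γ v := by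
    intro i j α v
    rw [localCov_one_apply]
    simp only [hW, connectionForm, Finset.mul_sum, mul_assoc]
    rfl
  have hcovW : ∀ i j m, ∑ γ, ∑ μ, localCov a b Φ (localDifferential Φ) ![i, j] γ u *
      pd m (fun v => Φ v μ) u * localChristoffel b α γ μ (Φ u) =
      ∑ γ, localCov a b Φ (localDifferential Φ) ![i, j] γ u * W m α γ u := by
    intro i j m
    simp only [hW, connectionForm, Finset.mul_sum, mul_assoc]
  have hpd : ∀ i j m, pd m (localCov a b Φ (localDifferential Φ) ![i, j] α) u =
      pd m (pd j (x i α)) u - (∑ k, pd m (x k α) u * G k j i u + ∑ k, x k α u * pd m (G k j i) u) +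
        (∑ γ, pd m (x i γ) u * W j α γ u + ∑ γ, x i γ u * pd m (W j α γ) u) := by
    intro i j m
    rw [show localCov a b Φ (localDifferential Φ) ![i, j] α = _ from funext (hcov i j α)]
    have s1 : ContDiffAt ℝ ∞ (fun v => ∑ k, x k α v * G k j i v) u :=
      contDiffAt_sum fun k => (hxs _ _).mul (hGs _ _ _)
    have s2 : ContDiffAt ℝ ∞ (fun v => ∑ γ, x i γ v * W j α γ v) u :=
      contDiffAt_sum fun k => (hxs _ _).mul (hWs _ _ _)
    rw [pd_add _ ((contDiffAt_pd _ (hxs _ _)).sub s1) s2, pd_sub _ (contDiffAt_pd _ (hxs _ _)) s1,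
      pd_sum _ _ fun k _ => (hxs _ _).mul (hGs _ _ _),
      pd_sum _ _ fun k _ => (hxs _ _).mul (hWs _ _ _), ← Finset.sum_add_distrib,
      ← Finset.sum_add_distrib]
    simp only [pd_mul _ (hxs _ _) (hGs _ _ _), pd_mul _ (hxs _ _) (hWs _ _ _)]
  have hpdW : ∀ j m γ, pd m (W j α γ) u = ∑ μ, pd m (x j μ) u * localChristoffel b α γ μ (Φ u) +
      ∑ μ, x j μ u * pd m (fun v => localChristoffel b α γ μ (Φ v)) u := by
    intro j m γ
    rw [show W j α γ = fun u => ∑ μ, x j μ u * localChristoffel b α γ μ (Φ u) from rfl,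
      pd_sum _ _ fun μ _ => (hxs _ _).mul (hBs _ _ _), ← Finset.sum_add_distrib]
    exact Finset.sum_congr rfl fun μ _ => pd_mul _ (hxs _ _) (hBs _ _ _)
  have hGsymm : ∀ k i j, G k i j u = G k j i u := localChristoffel_symm ha.symm
  simp only [localCov_two_apply, hcovW, hpd]
  simp only [hcov, hpdW]
  -- The symmetries behind the cancellation: commuting partial derivatives of `Φ` here and in
  -- `hxxx`, and the symmetry of the Christoffel symbols of `a` in `c8`.
  have hxx : ∀ γ, pd m (x j γ) u = pd j (x m γ) u := fun γ => pd_comm _ _ (hΦc γ)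
  have hxxx : pd m (pd j (x i α)) u = pd j (pd m (x i α)) u := pd_comm _ _ (hxs i α)
  have c3 : ∀ i j m, ∑ γ, ∑ μ, pd i (fun v => Φ v γ) u * pd j (fun v => Φ v μ) u *
      pd m (fun v => localChristoffel b α γ μ (Φ v)) u =
      ∑ γ, x i γ u * ∑ μ, x j μ u * pd m (fun v => localChristoffel b α γ μ (Φ v)) u := by
    intro i j m
    simp only [Finset.mul_sum, hx, mul_assoc]
  have c4 : ∀ i j m, ∑ k, (∑ l, x l α u * G l j k u) * G k m i u =
      ∑ k, ∑ l, G k m i u * G l j k u * pd l (fun v => Φ v α) u := by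
    intro i j m
    simp only [Finset.sum_mul]
    exact Finset.sum_congr rfl fun _ _ => Finset.sum_congr rfl fun _ _ => by simp only [hx]; ring
  have c5 : ∀ i j m, ∑ δ, (∑ γ, x i γ u * W j δ γ u) * W m α δ u =
      ∑ γ, ∑ δ, W m α δ u * W j δ γ u * pd i (fun v => Φ v γ) u := by
    intro i j m
    simp only [Finset.sum_mul]
    rw [Finset.sum_comm]
    exact Finset.sum_congr rfl fun _ _ => Finset.sum_congr rfl fun _ _ => by simp only [hx]; ring
  have c6 : ∀ i j m, ∑ k, (∑ γ, x k γ u * W j α γ u) * G k m i u =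
      ∑ γ, (∑ k, x k γ u * G k m i u) * W j α γ u := by
    intro i j m
    simp only [Finset.sum_mul]
    rw [Finset.sum_comm]
    exact Finset.sum_congr rfl fun _ _ => Finset.sum_congr rfl fun _ _ => by ring
  have c7 : ∀ i j m, ∑ k, pd m (G k j i) u * pd k (fun v => Φ v α) u =
      ∑ k, x k α u * pd m (G k j i) u := by
    intro i j m
    exact Finset.sum_congr rfl fun _ _ => by simp only [hx]; ring
  unfold curvatureTerm
  simp only [c3, ← hW, ← hG, c7, ← c4, ← c5]
  simp only [add_mul, sub_mul, mul_add, Finset.sum_add_distrib, Finset.sum_sub_distrib, c6, hxx]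
  rw [hxxx]
  have c8 : ∀ k, G k m j u = G k j m u := fun k => hGsymm k m j
  simp only [c8]
  ring

end Ricci

end LocalFormulas

/-! ### Contractions with several free indices -/

/-- The coordinate expressions of two metrics and a map between open subsets of `ℝⁿ`. -/
structure LocalData (n : ℕ) where
  a : Fin n → Fin n → Model n → ℝ
  b : Fin n → Fin n → Model n → ℝ
  Φ : Model n → Model n
  U : Set (Model n)
  isOpen : IsOpen U
  metric_a : ∀ u ∈ U, IsMetricAt a u
  metric_b : ∀ u ∈ U, IsMetricAt b (Φ u)
  contDiffAt : ∀ u ∈ U, ContDiffAt ℝ ∞ Φ u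

/-- The numbers of occurrences of Latin labels in `κ` and Greek labels in `ν` as lower and upper
indices. -/
@[ext] structure Occurrences (κ ν : Type) where
  lowM : κ → ℕ
  upM : κ → ℕ
  lowN : ν → ℕ
  upN : ν → ℕ

namespace Occurrences

variable {κ ν K N : Type}

instance : Add (Occurrences κ ν) :=
  ⟨fun s t => ⟨s.lowM + t.lowM, s.upM + t.upM, s.lowN + t.lowN, s.upN + t.upN⟩⟩

@[simp] theorem add_lowM (s t : Occurrences κ ν) : (s + t).lowM = s.lowM + t.lowM := rfl
@[simp] theorem add_upM (s t : Occurrences κ ν) : (s + t).upM = s.upM + t.upM := rfl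
@[simp] theorem add_lowN (s t : Occurrences κ ν) : (s + t).lowN = s.lowN + t.lowN := rfl
@[simp] theorem add_upN (s t : Occurrences κ ν) : (s + t).upN = s.upN + t.upN := rfl

/-- Adjoin labels `K` and `N` that occur once as a lower and once as an upper index. -/
@[simps] def adjoin (s : Occurrences κ ν) (K N : Type) : Occurrences (κ ⊕ K) (ν ⊕ N) where
  lowM := Sum.elim s.lowM 1
  upM := Sum.elim s.upM 1
  lowN := Sum.elim s.lowN 1
  upN := Sum.elim s.upN 1

end Occurrences

/-- One factor of a contraction with Latin labels in `κ` and Greek labels in `ν`. -/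
inductive LFactor (κ ν : Type) : Type
  | metricM (D : List κ) (i j : κ)
  | invMetricM (i j : κ)
  | metricN (D : List ν) (α β : ν)
  | invMetricN (α β : ν)
  | map (D : List κ) (α : ν)

namespace LFactor

variable {κ' ν' κ ν : Type}

/-- The lower Latin labels. -/
def lowerM : LFactor κ ν → List κ
  | metricM D i j => i :: j :: D
  | map D _ => D
  | _ => []

/-- The upper Latin labels. -/
def upperM : LFactor κ ν → List κ
  | invMetricM i j => [i, j]
  | _ => []

/-- The lower Greek labels. -/
def lowerN : LFactor κ ν → List ν
  | metricN D α β => α :: β :: D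
  | _ => []

/-- The upper Greek labels. -/
def upperN : LFactor κ ν → List ν
  | invMetricN α β => [α, β]
  | map _ α => [α]
  | _ => []

/-- Bounds for the numbers of derivatives. -/
def OrderLE (p q r : ℕ) : LFactor κ ν → Prop
  | metricM D _ _ => D.length ≤ p
  | invMetricM _ _ => True
  | metricN D _ _ => D.length ≤ q
  | invMetricN _ _ => True
  | map D _ => 1 ≤ D.length ∧ D.length ≤ r

theorem OrderLE.mono {p q r p' q' r' : ℕ} (hp : p ≤ p') (hq : q ≤ q') (hr : r ≤ r')
    {f : LFactor κ ν} (h : f.OrderLE p q r) : f.OrderLE p' q' r' := by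
  cases f <;> simp only [OrderLE] at h ⊢ <;> omega

/-- Change of labels. -/
def rename (r : κ → κ') (t : ν → ν') : LFactor κ ν → LFactor κ' ν'
  | metricM D i j => metricM (D.map r) (r i) (r j)
  | invMetricM i j => invMetricM (r i) (r j)
  | metricN D α β => metricN (D.map t) (t α) (t β)
  | invMetricN α β => invMetricN (t α) (t β)
  | map D α => map (D.map r) (t α)

/-- The value of a factor for given values of the labels. -/
def eval {n : ℕ} (X : LocalData n) (u : Model n) (ρ : κ → Fin n) (σ : ν → Fin n) :
    LFactor κ ν → ℝ
  | metricM D i j => pdList (D.map ρ) (X.a (ρ i) (ρ j)) u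
  | invMetricM i j => (Matrix.of fun i j => X.a i j u)⁻¹ (ρ i) (ρ j)
  | metricN D α β => pdList (D.map σ) (X.b (σ α) (σ β)) (X.Φ u)
  | invMetricN α β => (Matrix.of fun i j => X.b i j (X.Φ u))⁻¹ (σ α) (σ β)
  | map D α => pdList (D.map ρ) (fun v => X.Φ v (σ α)) u

theorem eval_rename {n : ℕ} (X : LocalData n) (u : Model n) (r : κ → κ') (t : ν → ν')
    (ρ : κ' → Fin n) (σ : ν' → Fin n) (f : LFactor κ ν) :
    (f.rename r t).eval X u ρ σ = f.eval X u (ρ ∘ r) (σ ∘ t) := by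
  cases f <;> simp [rename, eval]

theorem orderLE_rename {p q m : ℕ} (r : κ → κ') (t : ν → ν') (f : LFactor κ ν) :
    (f.rename r t).OrderLE p q m ↔ f.OrderLE p q m := by
  cases f <;> simp [rename, OrderLE]

theorem flatMap_rename (r : κ → κ') (t : ν → ν') (fs : List (LFactor κ ν)) :
    (fs.map (rename r t)).flatMap lowerM = (fs.flatMap lowerM).map r ∧
    (fs.map (rename r t)).flatMap upperM = (fs.flatMap upperM).map r ∧
    (fs.map (rename r t)).flatMap lowerN = (fs.flatMap lowerN).map t ∧
    (fs.map (rename r t)).flatMap upperN = (fs.flatMap upperN).map t := by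
  induction fs with
  | nil => simp
  | cons f fs ih =>
    obtain ⟨h1, h2, h3, h4⟩ := ih
    simp only [List.map_cons, List.flatMap_cons, List.map_append, h1, h2, h3, h4]
    cases f <;> simp [rename, lowerM, upperM, lowerN, upperN]

variable [DecidableEq κ'] [DecidableEq ν'] [DecidableEq κ] [DecidableEq ν]

/-- The numbers of occurrences of the labels in a list of factors. -/
@[simps] def occ (fs : List (LFactor κ ν)) : Occurrences κ ν where
  lowM k := (fs.flatMap lowerM).count k
  upM k := (fs.flatMap upperM).count k
  lowN α := (fs.flatMap lowerN).count α
  upN α := (fs.flatMap upperN).count α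

theorem occ_append (fs gs : List (LFactor κ ν)) : occ (fs ++ gs) = occ fs + occ gs := by
  ext <;> simp

theorem occ_cons (f : LFactor κ ν) (gs : List (LFactor κ ν)) : occ (f :: gs) = occ [f] + occ gs :=
  occ_append [f] gs

theorem count_map_extend {r : κ → κ'} (hr : Function.Injective r) (L : List κ) :
    (fun k => (L.map r).count k) = Function.extend r (fun k => L.count k) 0 := by
  funext k
  by_cases h : ∃ x, r x = k
  · obtain ⟨x, rfl⟩ := h
    rw [hr.extend_apply, List.count_map_of_injective _ _ hr]
  · rw [Function.extend_apply' _ _ _ h, Pi.zero_apply, List.count_eq_zero]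
    rw [List.mem_map]
    exact fun ⟨x, _, hx⟩ => h ⟨x, hx⟩

/-- For injective renamings no two labels merge, so the counts are carried over and labels outside
the range count zero. -/
theorem occ_rename {r : κ → κ'} {t : ν → ν'} (hr : Function.Injective r)
    (ht : Function.Injective t) (fs : List (LFactor κ ν)) :
    occ (fs.map (rename r t)) = ⟨Function.extend r (occ fs).lowM 0,
      Function.extend r (occ fs).upM 0, Function.extend t (occ fs).lowN 0,
      Function.extend t (occ fs).upN 0⟩ := by
  obtain ⟨h1, h2, h3, h4⟩ := flatMap_rename r t fs
  unfold occ
  rw [h1, h2, h3, h4, count_map_extend hr, count_map_extend hr, count_map_extend ht,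
    count_map_extend ht]

end LFactor

/-- A monomial with free labels `κ` and `ν`, and bound labels `K` and `N`. -/
structure LMonomial (κ ν : Type) where
  coeff : ℝ
  K : Type
  N : Type
  [fintypeK : Fintype K]
  [fintypeN : Fintype N]
  [decidableEqK : DecidableEq K]
  [decidableEqN : DecidableEq N]
  factors : List (LFactor (κ ⊕ K) (ν ⊕ N))

attribute [instance] LMonomial.fintypeK LMonomial.fintypeN LMonomial.decidableEqK
  LMonomial.decidableEqN

/-- Families of functions indexed by the values of free labels. -/
abbrev Family (n : ℕ) (κ ν : Type) : Type :=
  LocalData n → Model n → (κ → Fin n) → (ν → Fin n) → ℝ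

/-- The value of a monomial. -/
def LMonomial.eval {n : ℕ} {κ ν : Type} (m : LMonomial κ ν) : Family n κ ν := fun X u ρ σ =>
  m.coeff * ∑ κ : m.K → Fin n, ∑ ν : m.N → Fin n,
    (m.factors.map (LFactor.eval X u (Sum.elim ρ κ) (Sum.elim σ ν))).prod

/-- Families that are finite sums of contractions in which the free labels occur as prescribed
by `s`, with bounds for the numbers of derivatives. -/
inductive IsExpr {n : ℕ} (p q r : ℕ) {κ ν : Type} [DecidableEq κ] [DecidableEq ν]
    (s : Occurrences κ ν) : Family n κ ν → Prop
  | monomial (m : LMonomial κ ν) (hs : LFactor.occ m.factors = s.adjoin m.K m.N)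
      (ho : ∀ f ∈ m.factors, f.OrderLE p q r) : IsExpr p q r s m.eval
  | zero : IsExpr p q r s fun _ _ _ _ => 0
  | add {S T : Family n κ ν} : IsExpr p q r s S → IsExpr p q r s T →
      IsExpr p q r s fun X u ρ σ => S X u ρ σ + T X u ρ σ
  -- Agreement is required only on the domain `X.U`, since formulas such as the derivative of the
  -- inverse metric hold only where the metrics are nondegenerate.
  | congr {S T : Family n κ ν} : IsExpr p q r s S →
      (∀ X, ∀ u ∈ X.U, ∀ ρ σ, S X u ρ σ = T X u ρ σ) → IsExpr p q r s T

theorem sum_sum_arrow {A B X : Type*} [Fintype A] [Fintype B] [DecidableEq A] [DecidableEq B]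
    [Fintype X] (F : (A → X) → (B → X) → ℝ) :
    ∑ ρ : A ⊕ B → X, F (ρ ∘ Sum.inl) (ρ ∘ Sum.inr) = ∑ x, ∑ y, F x y := by
  rw [← Fintype.sum_prod_type']
  exact Equiv.sum_comp (Equiv.sumArrowEquivProdArrow A B X) fun z => F z.1 z.2

theorem contDiffAt_pdList {n : ℕ} {f : Model n → ℝ} {u : Model n} (h : ContDiffAt ℝ ∞ f u) :
    ∀ D : List (Fin n), ContDiffAt ℝ ∞ (pdList D f) u
  | [] => h
  | i :: D => contDiffAt_pd i (contDiffAt_pdList h D)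

theorem LFactor.contDiffAt_eval {n : ℕ} {κ ν : Type} (X : LocalData n) {u : Model n} (hu : u ∈ X.U)
    (ρ : κ → Fin n) (σ : ν → Fin n) (f : LFactor κ ν) :
    ContDiffAt ℝ ∞ (fun v => f.eval X v ρ σ) u := by
  have hΦ := X.contDiffAt u hu
  cases f with
  | metricM D i j => exact contDiffAt_pdList ((X.metric_a u hu).contDiffAt _ _) _
  | invMetricM i j => exact contDiffAt_inv (X.metric_a u hu) _ _
  | metricN D α β => exact (contDiffAt_pdList ((X.metric_b u hu).contDiffAt _ _) _).comp u hΦ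
  | invMetricN α β => exact (contDiffAt_inv (X.metric_b u hu) (σ α) (σ β)).comp u hΦ
  | map D α => exact contDiffAt_pdList (contDiffAt_apply hΦ _) _

theorem LFactor.contDiffAt_prod {n : ℕ} {κ ν : Type} (X : LocalData n) {u : Model n} (hu : u ∈ X.U)
    (ρ : κ → Fin n) (σ : ν → Fin n) (fs : List (LFactor κ ν)) :
    ContDiffAt ℝ ∞ (fun v => (fs.map (LFactor.eval X v ρ σ)).prod) u := by
  induction fs with
  | nil => simpa using contDiffAt_const
  | cons f fs ih => simpa using (f.contDiffAt_eval X hu ρ σ).mul ih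

/-! ### Algebra of contractions: sums, products, renaming and contraction of labels -/

namespace IsExpr

variable {n p q r : ℕ} {κ ν κ' ν' : Type} [DecidableEq κ] [DecidableEq ν] [DecidableEq κ']
  [DecidableEq ν'] {s s' : Occurrences κ ν} {S T : Family n κ ν}

/-- Openness of `X.U` lets smoothness pass through the constructor `congr`. -/
theorem contDiffAt (h : IsExpr p q r s T) (X : LocalData n) {u : Model n} (hu : u ∈ X.U)
    (ρ : κ → Fin n) (σ : ν → Fin n) : ContDiffAt ℝ ∞ (fun v => T X v ρ σ) u := by
  induction h generalizing u with
  | monomial m =>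
    exact contDiffAt_const.mul (contDiffAt_sum fun _ => contDiffAt_sum fun _ =>
      LFactor.contDiffAt_prod X hu _ _ _)
  | zero => exact contDiffAt_const
  | add _ _ h1 h2 => exact (h1 hu).add (h2 hu)
  | congr _ h ih =>
    refine (ih hu).congr_of_eventuallyEq ?_
    filter_upwards [X.isOpen.mem_nhds hu] with v hv using (h X v hv ρ σ).symm

theorem mono {p' q' r' : ℕ} (hp : p ≤ p') (hq : q ≤ q') (hr : r ≤ r') (h : IsExpr p q r s T) :
    IsExpr p' q' r' s T := by
  induction h with
  | monomial m hs ho => exact .monomial m hs fun f hf => (ho f hf).mono hp hq hr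
  | zero => exact .zero
  | add _ _ h1 h2 => exact .add h1 h2
  | congr _ h ih => exact .congr ih h

theorem of_eq (h : IsExpr p q r s T) (hs : s = s') : IsExpr p q r s' T := hs ▸ h

theorem smul (c : ℝ) (h : IsExpr p q r s T) : IsExpr p q r s fun X u ρ σ => c * T X u ρ σ := by
  induction h with
  | monomial m hs ho =>
    refine (IsExpr.monomial { m with coeff := c * m.coeff } hs ho).congr fun X u _ ρ σ => ?_
    simp only [LMonomial.eval, mul_assoc]
  | zero => exact IsExpr.zero.congr fun _ _ _ _ _ => by simp
  | add _ _ h1 h2 => exact (h1.add h2).congr fun _ _ _ _ _ => by ring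
  | congr _ h ih => exact ih.congr fun X u hu ρ σ => by rw [h X u hu]

theorem neg (h : IsExpr p q r s T) : IsExpr p q r s fun X u ρ σ => -T X u ρ σ :=
  (h.smul (-1)).congr fun _ _ _ _ _ => by ring

theorem sub (hS : IsExpr p q r s S) (hT : IsExpr p q r s T) :
    IsExpr p q r s fun X u ρ σ => S X u ρ σ - T X u ρ σ :=
  (hS.add hT.neg).congr fun _ _ _ _ _ => by ring

theorem sum {ι : Type*} (A : Finset ι) {F : ι → Family n κ ν} (h : ∀ i, IsExpr p q r s (F i)) :
    IsExpr p q r s fun X u ρ σ => ∑ i ∈ A, F i X u ρ σ := by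
  classical
  induction A using Finset.induction_on with
  | empty => exact IsExpr.zero.congr fun _ _ _ _ _ => by simp
  | insert i A hi ih =>
    exact ((h i).add ih).congr fun _ _ _ _ _ => by rw [Finset.sum_insert hi]

theorem prod_factors (fs : List (LFactor κ ν)) (ho : ∀ f ∈ fs, f.OrderLE p q r) :
    IsExpr (n := n) p q r (LFactor.occ fs) fun X u ρ σ => (fs.map (LFactor.eval X u ρ σ)).prod := by
  -- A bare product has no bound labels, so both bound label types are empty.
  let m : LMonomial κ ν :=
    { coeff := 1, K := Empty, N := Empty, factors := fs.map (LFactor.rename Sum.inl Sum.inl) }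
  refine (IsExpr.monomial (n := n) (p := p) (q := q) (r := r) (s := LFactor.occ fs) m ?_ ?_).congr
    fun X u _ ρ σ => ?_
  · simp only [m]
    rw [LFactor.occ_rename Sum.inl_injective Sum.inl_injective]
    ext (k | k) <;> first | exact k.elim | simp [Sum.inl_injective.extend_apply]
  · intro f hf
    obtain ⟨g, hg, rfl⟩ := List.mem_map.1 hf
    exact (LFactor.orderLE_rename _ _ _).2 (ho g hg)
  · simp only [LMonomial.eval, m]
    rw [Fintype.sum_unique, Fintype.sum_unique, one_mul, List.map_map]
    congr 2
    funext f
    simp [LFactor.eval_rename]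

theorem factor (f : LFactor κ ν) (ho : f.OrderLE p q r) :
    IsExpr (n := n) p q r (LFactor.occ [f]) fun X u ρ σ => f.eval X u ρ σ :=
  (prod_factors [f] (by simpa using ho)).congr fun _ _ _ _ _ => by simp

/-- Product of two sums over bound labels as one sum over the disjoint union. The counts of free
labels add, and every bound label still occurs once below and once above. -/
theorem mul {t : Occurrences κ ν} (hS : IsExpr p q r s S) (hT : IsExpr p q r t T) :
    IsExpr p q r (s + t) fun X u ρ σ => S X u ρ σ * T X u ρ σ := by
  induction hS with
  | zero => exact IsExpr.zero.congr fun _ _ _ _ _ => by simp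
  | add _ _ h1 h2 => exact (h1.add h2).congr fun _ _ _ _ _ => by ring
  | congr _ h ih => exact ih.congr fun X u hu ρ σ => by rw [h X u hu]
  | monomial m hs ho =>
  induction hT with
  | zero => exact IsExpr.zero.congr fun _ _ _ _ _ => by simp
  | add _ _ h1 h2 => exact (h1.add h2).congr fun _ _ _ _ _ => by ring
  | congr _ h ih => exact ih.congr fun X u hu ρ σ => by rw [h X u hu]
  | monomial m' hs' ho' =>
  let M : LMonomial κ ν :=
    { coeff := m.coeff * m'.coeff
      K := m.K ⊕ m'.K
      N := m.N ⊕ m'.N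
      factors := m.factors.map (LFactor.rename (Sum.map id Sum.inl) (Sum.map id Sum.inl)) ++
        m'.factors.map (LFactor.rename (Sum.map id Sum.inr) (Sum.map id Sum.inr)) }
  have il : ∀ {A B C : Type}, Function.Injective (Sum.map id Sum.inl : A ⊕ B → A ⊕ (B ⊕ C)) :=
    fun {A B C} => Function.injective_id.sumMap Sum.inl_injective
  have ir : ∀ {A B C : Type}, Function.Injective (Sum.map id Sum.inr : A ⊕ B → A ⊕ (C ⊕ B)) :=
    fun {A B C} => Function.injective_id.sumMap Sum.inr_injective
  -- A free label lies in the range of both embeddings and receives both counts; a bound label lies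
  -- in the range of exactly one.
  have key : ∀ {A B C : Type} (f g : A → ℕ),
      Function.extend (Sum.map id Sum.inl : A ⊕ B → A ⊕ (B ⊕ C)) (Sum.elim f 1) 0 +
      Function.extend (Sum.map id Sum.inr : A ⊕ C → A ⊕ (B ⊕ C)) (Sum.elim g 1) 0 =
      Sum.elim (f + g) 1 := by
    intro A B C f g
    funext k
    rw [Pi.add_apply]
    rcases k with k | k | k
    · rw [show (Sum.inl k : A ⊕ (B ⊕ C)) = Sum.map id Sum.inl (Sum.inl k) from rfl,
        il.extend_apply,
        show (Sum.map id Sum.inl (Sum.inl k : A ⊕ B) : A ⊕ (B ⊕ C)) =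
          Sum.map id Sum.inr (Sum.inl k) from rfl, ir.extend_apply]
      rfl
    · rw [show (Sum.inr (Sum.inl k) : A ⊕ (B ⊕ C)) = Sum.map id Sum.inl (Sum.inr k) from rfl,
        il.extend_apply, Function.extend_apply' _ _ _ (by rintro ⟨x | x, hx⟩ <;> simp at hx)]
      rfl
    · rw [Function.extend_apply' _ _ _ (by rintro ⟨x | x, hx⟩ <;> simp at hx),
        show (Sum.inr (Sum.inr k) : A ⊕ (B ⊕ C)) = Sum.map id Sum.inr (Sum.inr k) from rfl,
        ir.extend_apply]
      rfl
  refine (IsExpr.monomial (n := n) (p := p) (q := q) (r := r) (s := s + t) M ?_ ?_).congr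
    fun X u _ ρ σ => ?_
  · simp only [M]
    rw [LFactor.occ_append, LFactor.occ_rename il il, LFactor.occ_rename ir ir, hs, hs']
    ext1 <;> exact key _ _
  · intro f hf
    rcases List.mem_append.1 hf with hf | hf
    · obtain ⟨g, hg, rfl⟩ := List.mem_map.1 hf
      exact (LFactor.orderLE_rename _ _ _).2 (ho g hg)
    · obtain ⟨g, hg, rfl⟩ := List.mem_map.1 hf
      exact (LFactor.orderLE_rename _ _ _).2 (ho' g hg)
  · simp only [LMonomial.eval, M, List.map_append, List.map_map, List.prod_append]
    set P : (m.K → Fin n) → (m.N → Fin n) → ℝ := fun ρ' σ' =>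
      (m.factors.map (LFactor.eval X u (Sum.elim ρ ρ') (Sum.elim σ σ'))).prod with hP
    set Q : (m'.K → Fin n) → (m'.N → Fin n) → ℝ := fun ρ' σ' =>
      (m'.factors.map (LFactor.eval X u (Sum.elim ρ ρ') (Sum.elim σ σ'))).prod with hQ
    have e1 : ∀ (ρ' : m.K ⊕ m'.K → Fin n) (σ' : m.N ⊕ m'.N → Fin n),
        (m.factors.map (LFactor.eval X u (Sum.elim ρ ρ') (Sum.elim σ σ') ∘
          LFactor.rename (Sum.map id Sum.inl) (Sum.map id Sum.inl))).prod *
        (m'.factors.map (LFactor.eval X u (Sum.elim ρ ρ') (Sum.elim σ σ') ∘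
          LFactor.rename (Sum.map id Sum.inr) (Sum.map id Sum.inr))).prod =
        P (ρ' ∘ Sum.inl) (σ' ∘ Sum.inl) * Q (ρ' ∘ Sum.inr) (σ' ∘ Sum.inr) := by
      intro ρ' σ'
      congr 3 <;> funext f <;> simp [LFactor.eval_rename, Sum.elim_comp_map]
    simp only [e1]
    rw [sum_sum_arrow fun x y => ∑ σ' : m.N ⊕ m'.N → Fin n,
      P x (σ' ∘ Sum.inl) * Q y (σ' ∘ Sum.inr)]
    simp only [fun x y => sum_sum_arrow fun z w => P x z * Q y w, ← Finset.mul_sum,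
      ← Finset.sum_mul]
    ring

/-- Embeds the free labels in a larger set, leaving the new labels unused. This makes room for
labels that are to be contracted with other factors. -/
theorem rename {f : κ → κ'} {g : ν → ν'} (hf : Function.Injective f) (hg : Function.Injective g)
    (h : IsExpr p q r s T) :
    IsExpr p q r ⟨Function.extend f s.lowM 0, Function.extend f s.upM 0,
      Function.extend g s.lowN 0, Function.extend g s.upN 0⟩
      fun X u ρ σ => T X u (ρ ∘ f) (σ ∘ g) := by
  induction h with
  | zero => exact .zero
  | add _ _ h1 h2 => exact h1.add h2
  | congr _ h ih => exact ih.congr fun X u hu ρ σ => h X u hu _ _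
  | monomial m hs ho =>
  let M : LMonomial κ' ν' :=
    { coeff := m.coeff
      K := m.K
      N := m.N
      factors := m.factors.map (LFactor.rename (Sum.map f id) (Sum.map g id)) }
  have key : ∀ {A B C : Type} {f : A → B} (_ : Function.Injective f) (w : A → ℕ),
      Function.extend (Sum.map f id : A ⊕ C → B ⊕ C) (Sum.elim w 1) 0 =
      Sum.elim (Function.extend f w 0) 1 := by
    intro A B C f hf w
    have hi : Function.Injective (Sum.map f id : A ⊕ C → B ⊕ C) :=
      hf.sumMap Function.injective_id
    funext k
    rcases k with k | k
    · by_cases hk : ∃ x, f x = k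
      · obtain ⟨x, rfl⟩ := hk
        rw [show (Sum.inl (f x) : B ⊕ C) = Sum.map f id (Sum.inl x) from rfl, hi.extend_apply]
        simp [hf.extend_apply]
      · rw [Function.extend_apply', Sum.elim_inl, Function.extend_apply' _ _ _ hk]
        · rfl
        · rintro ⟨x | x, hx⟩
          · exact hk ⟨x, by simpa using hx⟩
          · simp at hx
    · rw [show (Sum.inr k : B ⊕ C) = Sum.map f id (Sum.inr k) from rfl, hi.extend_apply]
      rfl
  refine (IsExpr.monomial (n := n) (p := p) (q := q) (r := r) M ?_ ?_).congr
    fun X u _ ρ σ => ?_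
  · simp only [M]
    rw [LFactor.occ_rename (hf.sumMap Function.injective_id) (hg.sumMap Function.injective_id), hs]
    ext1
    · exact key hf _
    · exact key hf _
    · exact key hg _
    · exact key hg _
  · intro f hf
    obtain ⟨g, hg, rfl⟩ := List.mem_map.1 hf
    exact (LFactor.orderLE_rename _ _ _).2 (ho g hg)
  · simp only [LMonomial.eval, M, List.map_map]
    have : ∀ ρ' σ', (LFactor.eval X u (Sum.elim ρ ρ') (Sum.elim σ σ') ∘
        LFactor.rename (Sum.map f id : κ ⊕ m.K → _) (Sum.map g id : ν ⊕ m.N → _)) =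
        LFactor.eval X u (Sum.elim (ρ ∘ f) ρ') (Sum.elim (σ ∘ g) σ') := by
      intro ρ' σ'
      funext x
      simp [LFactor.eval_rename, Sum.elim_comp_map]
    simp only [this]

/-- Free labels that occur once below and once above become bound labels, by reassociating the
disjoint unions. -/
theorem contract {K N : Type} [Fintype K] [Fintype N] [DecidableEq K] [DecidableEq N]
    {T : Family n (κ ⊕ K) (ν ⊕ N)} (h : IsExpr p q r (s.adjoin K N) T) :
    IsExpr p q r s fun X u ρ σ => ∑ ρ' : K → Fin n, ∑ σ' : N → Fin n,
      T X u (Sum.elim ρ ρ') (Sum.elim σ σ') := by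
  induction h with
  | zero => exact IsExpr.zero.congr fun _ _ _ _ _ => by simp
  | add _ _ h1 h2 => exact (h1.add h2).congr fun _ _ _ _ _ => by simp [Finset.sum_add_distrib]
  | congr _ h ih => exact ih.congr fun X u hu ρ σ => by simp only [h X u hu]
  | monomial m hs ho =>
  let M : LMonomial κ ν :=
    { coeff := m.coeff
      K := K ⊕ m.K
      N := N ⊕ m.N
      factors := m.factors.map (LFactor.rename (Equiv.sumAssoc κ K m.K) (Equiv.sumAssoc ν N m.N)) }
  have key : ∀ {A B C : Type} (w : A → ℕ),
      Function.extend (Equiv.sumAssoc A B C) (Sum.elim (Sum.elim w 1) 1) 0 = Sum.elim w 1 := by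
    intro A B C w
    funext k
    obtain ⟨k, rfl⟩ := (Equiv.sumAssoc A B C).surjective k
    rw [(Equiv.sumAssoc A B C).injective.extend_apply]
    rcases k with (k | k) | k <;> rfl
  refine (IsExpr.monomial (n := n) (p := p) (q := q) (r := r) M ?_ ?_).congr
    fun X u _ ρ σ => ?_
  · simp only [M]
    rw [LFactor.occ_rename (Equiv.injective _) (Equiv.injective _), hs]
    ext1 <;> exact key _
  · intro f hf
    obtain ⟨g, hg, rfl⟩ := List.mem_map.1 hf
    exact (LFactor.orderLE_rename _ _ _).2 (ho g hg)
  · simp only [LMonomial.eval, M, List.map_map]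
    have hc : ∀ {A B C : Type} (ρ : A → Fin n) (ρ' : B ⊕ C → Fin n),
        Sum.elim ρ ρ' ∘ Equiv.sumAssoc A B C =
          Sum.elim (Sum.elim ρ (ρ' ∘ Sum.inl)) (ρ' ∘ Sum.inr) := by
      intro A B C ρ ρ'
      funext k
      rcases k with (k | k) | k <;> rfl
    have : ∀ ρ' σ', (LFactor.eval X u (Sum.elim ρ ρ') (Sum.elim σ σ') ∘
        LFactor.rename (Equiv.sumAssoc κ K m.K) (Equiv.sumAssoc ν N m.N)) =
        LFactor.eval X u (Sum.elim (Sum.elim ρ (ρ' ∘ Sum.inl)) (ρ' ∘ Sum.inr))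
          (Sum.elim (Sum.elim σ (σ' ∘ Sum.inl)) (σ' ∘ Sum.inr)) := by
      intro ρ' σ'
      funext x
      simp [LFactor.eval_rename, hc]
    simp only [this]
    rw [sum_sum_arrow fun x y => ∑ σ' : N ⊕ m.N → Fin n, (List.map (LFactor.eval X u
      (Sum.elim (Sum.elim ρ x) y) (Sum.elim (Sum.elim σ (σ' ∘ Sum.inl)) (σ' ∘ Sum.inr)))
        m.factors).prod]
    simp only [fun x y => sum_sum_arrow fun z w => (List.map (LFactor.eval X u
      (Sum.elim (Sum.elim ρ x) y) (Sum.elim (Sum.elim σ z) w)) m.factors).prod, Finset.mul_sum]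
    exact Finset.sum_congr rfl fun _ _ => Finset.sum_comm

theorem extend_id_eq {A : Type} (f : A → ℕ) : Function.extend id f 0 = f :=
  funext fun k => Function.injective_id.extend_apply f 0 k

theorem extend_inl_empty {A : Type} (f : A → ℕ) :
    Function.extend (Sum.inl : A → A ⊕ Empty) f 0 = Sum.elim f 1 := by
  funext k
  rcases k with k | k
  · exact Sum.inl_injective.extend_apply f 0 k
  · exact k.elim

/-- Contraction of a single Latin label. The empty type is adjoined on the Greek side to fit the
general form of `contract`. -/
theorem contractM {s : Occurrences (κ ⊕ Unit) ν} {T : Family n (κ ⊕ Unit) ν}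
    (h : IsExpr p q r s T) (hl : s.lowM (Sum.inr ()) = 1) (hu : s.upM (Sum.inr ()) = 1) :
    IsExpr p q r ⟨s.lowM ∘ Sum.inl, s.upM ∘ Sum.inl, s.lowN, s.upN⟩
      fun X u ρ σ => ∑ k, T X u (Sum.elim ρ fun _ => k) σ := by
  have h1 := h.rename (f := id) (g := (Sum.inl : ν → ν ⊕ Empty)) Function.injective_id
    Sum.inl_injective
  have h2 := (h1.of_eq (s' := Occurrences.adjoin
    ⟨s.lowM ∘ Sum.inl, s.upM ∘ Sum.inl, s.lowN, s.upN⟩ Unit Empty) ?_).contract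
  · refine h2.congr fun X u _ ρ σ => ?_
    simp only [Fintype.sum_unique, Sum.elim_comp_inl, Function.comp_id]
    exact Fintype.sum_equiv (Equiv.funUnique Unit (Fin n)) _ _ fun _ => rfl
  · ext1
    · rw [extend_id_eq]
      funext k
      rcases k with k | ⟨⟩ <;> simp [Occurrences.adjoin, hl]
    · rw [extend_id_eq]
      funext k
      rcases k with k | ⟨⟩ <;> simp [Occurrences.adjoin, hu]
    · exact extend_inl_empty _
    · exact extend_inl_empty _

theorem contractN {s : Occurrences κ (ν ⊕ Unit)} {T : Family n κ (ν ⊕ Unit)}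
    (h : IsExpr p q r s T) (hl : s.lowN (Sum.inr ()) = 1) (hu : s.upN (Sum.inr ()) = 1) :
    IsExpr p q r ⟨s.lowM, s.upM, s.lowN ∘ Sum.inl, s.upN ∘ Sum.inl⟩
      fun X u ρ σ => ∑ k, T X u ρ (Sum.elim σ fun _ => k) := by
  have h1 := h.rename (f := (Sum.inl : κ → κ ⊕ Empty)) (g := id) Sum.inl_injective
    Function.injective_id
  have h2 := (h1.of_eq (s' := Occurrences.adjoin
    ⟨s.lowM, s.upM, s.lowN ∘ Sum.inl, s.upN ∘ Sum.inl⟩ Empty Unit) ?_).contract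
  · refine h2.congr fun X u _ ρ σ => ?_
    simp only [Fintype.sum_unique, Sum.elim_comp_inl, Function.comp_id]
    exact Fintype.sum_equiv (Equiv.funUnique Unit (Fin n)) _ _ fun _ => rfl
  · ext1
    · exact extend_inl_empty _
    · exact extend_inl_empty _
    · rw [extend_id_eq]
      funext k
      rcases k with k | ⟨⟩ <;> simp [Occurrences.adjoin, hl]
    · rw [extend_id_eq]
      funext k
      rcases k with k | ⟨⟩ <;> simp [Occurrences.adjoin, hu]

end IsExpr

/-! ### Coordinate derivatives of contractions -/

namespace IsExpr

variable {n p q r : ℕ} {κ ν κ' ν' : Type} [DecidableEq κ] [DecidableEq ν] [DecidableEq κ']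
  [DecidableEq ν'] {s s' : Occurrences κ ν} {S T : Family n κ ν}

/-- All three bounds grow by one. Differentiating an inverse metric inserts a first derivative of
the metric between two inverses, and differentiating a function of `Φ u` creates a factor `∂Φ`; both
are allowed because the new bounds are at least one. -/
theorem pd_factor (m : κ) (f : LFactor κ ν) (ho : f.OrderLE p q r) :
    IsExpr (n := n) (p + 1) (q + 1) (r + 1)
      (LFactor.occ [f] + ⟨fun k => [m].count k, 0, 0, 0⟩)
      fun X u ρ σ => pd (ρ m) (fun v => f.eval X v ρ σ) u := by
  cases f with
  | metricM D i j =>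
    refine ((factor (.metricM (m :: D) i j) (by simpa [LFactor.OrderLE] using ho)).of_eq ?_).congr
      fun X u _ ρ σ => rfl
    ext k <;> simp [LFactor.lowerM, LFactor.upperM, LFactor.lowerN, LFactor.upperN,
      List.count_cons]
    ring
  | map D α =>
    refine ((factor (.map (m :: D) α) (by simpa [LFactor.OrderLE] using ho.2)).of_eq ?_).congr
      fun X u _ ρ σ => rfl
    ext k <;> simp [LFactor.lowerM, LFactor.upperM, LFactor.lowerN, LFactor.upperN,
      List.count_cons]
  | invMetricM i j =>
    -- `∂ a⁻¹ = -a⁻¹ (∂a) a⁻¹`, with two new bound Latin labels.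
    have h := ((((prod_factors (n := n) (p := p + 1) (q := q + 1) (r := r + 1) (ν := ν)
      [.invMetricM (Sum.inl (Sum.inl i)) (Sum.inl (Sum.inr ())),
      .metricM [Sum.inl (Sum.inl m)] (Sum.inl (Sum.inr ())) (Sum.inr ()),
      .invMetricM (Sum.inr ()) (Sum.inl (Sum.inl j)) (κ := (κ ⊕ Unit) ⊕ Unit)]
      (by simp [LFactor.OrderLE])).contractM ?_ ?_).contractM ?_ ?_).neg)
    · refine (h.of_eq ?_).congr fun X u hu ρ σ => ?_
      · ext k <;> simp [LFactor.lowerM, LFactor.upperM, LFactor.lowerN, LFactor.upperN,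
          List.count_cons]
      · simp only [LFactor.eval]
        rw [pd_inv (X.metric_a u hu)]
        simp [LFactor.eval, pdList, mul_assoc]
    all_goals simp [LFactor.lowerM, LFactor.upperM, LFactor.lowerN, LFactor.upperN,
      List.count_cons]
  | metricN D α β =>
    -- Chain rule: the new derivative index on the target is bound to the upper index of a factor
    -- `∂Φ`.
    have h := ((prod_factors (n := n) (p := p + 1) (q := q + 1) (r := r + 1)
      [.metricN (Sum.inr () :: D.map Sum.inl) (Sum.inl α) (Sum.inl β),
      .map [m] (Sum.inr ()) (κ := κ) (ν := ν ⊕ Unit)]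
      (by simpa [LFactor.OrderLE] using ho)).contractN ?_ ?_)
    · refine (h.of_eq ?_).congr fun X u hu ρ σ => ?_
      · ext k <;> simp [LFactor.lowerM, LFactor.upperM, LFactor.lowerN, LFactor.upperN,
          List.count_cons, List.count_map_of_injective _ _ Sum.inl_injective]
      · simp only [LFactor.eval]
        rw [pd_comp _ (contDiffAt_pdList ((X.metric_b u hu).contDiffAt _ _) _) (X.contDiffAt u hu)]
        simp [LFactor.eval, pdList]
    all_goals simp [LFactor.lowerM, LFactor.upperM, LFactor.lowerN, LFactor.upperN,
      List.count_cons, List.count_eq_zero]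
  | invMetricN α β =>
    -- Chain rule combined with the derivative of the inverse: one bound Greek label for the
    -- direction and two for the matrix products.
    have h := (((((prod_factors (n := n) (p := p + 1) (q := q + 1) (r := r + 1) (κ := κ)
      [.invMetricN (Sum.inl (Sum.inl (Sum.inl α))) (Sum.inl (Sum.inr ())),
      .metricN [Sum.inl (Sum.inl (Sum.inr ()))] (Sum.inl (Sum.inr ())) (Sum.inr ()),
      .invMetricN (Sum.inr ()) (Sum.inl (Sum.inl (Sum.inl β))),
      .map [m] (Sum.inl (Sum.inl (Sum.inr ()))) (ν := ((ν ⊕ Unit) ⊕ Unit) ⊕ Unit)]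
      (by simp [LFactor.OrderLE])).contractN ?_ ?_).contractN ?_ ?_).contractN ?_ ?_).neg)
    · refine (h.of_eq ?_).congr fun X u hu ρ σ => ?_
      · ext k <;> simp [LFactor.lowerM, LFactor.upperM, LFactor.lowerN, LFactor.upperN,
          List.count_cons]
      · simp only [LFactor.eval]
        rw [pd_comp _ (contDiffAt_inv (X.metric_b u hu) _ _) (X.contDiffAt u hu)]
        simp only [pd_inv (X.metric_b u hu), neg_mul, Finset.sum_mul, Finset.sum_neg_distrib]
        simp [LFactor.eval, pdList, mul_assoc]
    all_goals simp [LFactor.lowerM, LFactor.upperM, LFactor.lowerN, LFactor.upperN,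
      List.count_cons]

theorem pd_prod_factors (m : κ) (fs : List (LFactor κ ν)) (ho : ∀ f ∈ fs, f.OrderLE p q r) :
    IsExpr (n := n) (p + 1) (q + 1) (r + 1)
      (LFactor.occ fs + ⟨fun k => [m].count k, 0, 0, 0⟩)
      fun X u ρ σ => pd (ρ m) (fun v => (fs.map (LFactor.eval X v ρ σ)).prod) u := by
  induction fs with
  | nil => exact IsExpr.zero.congr fun X u _ ρ σ => by simp [pd_const]
  | cons f fs ih =>
    have h1 := (pd_factor (n := n) m f (ho f (by simp))).mul
      ((prod_factors (n := n) fs fun g hg => ho g (by simp [hg])).mono p.le_succ q.le_succ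
        r.le_succ)
    have h2 := (((factor (n := n) f (ho f (by simp))).mono p.le_succ q.le_succ r.le_succ).mul
      (ih fun g hg => ho g (by simp [hg])))
    refine ((h1.of_eq ?_).add (h2.of_eq ?_)).congr fun X u hu ρ σ => ?_
    · rw [LFactor.occ_cons f fs]
      ext k <;> simp
      ring
    · rw [LFactor.occ_cons f fs]
      ext k <;> simp
      ring
    · simp only [List.map_cons, List.prod_cons]
      rw [pd_mul _ (f.contDiffAt_eval X hu ρ σ) (LFactor.contDiffAt_prod X hu ρ σ fs)]

/-- Differentiation passes under the finite sums over bound labels, so the Leibniz rule for products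
of factors suffices. The derivative adds one lower occurrence of `m`. -/
theorem pd (m : κ) (h : IsExpr p q r s T) :
    IsExpr (p + 1) (q + 1) (r + 1) (s + ⟨fun k => [m].count k, 0, 0, 0⟩)
      fun X u ρ σ => MapCov.pd (ρ m) (fun v => T X v ρ σ) u := by
  induction h with
  | zero => exact IsExpr.zero.congr fun X u _ ρ σ => by simp [pd_const]
  | add h1 h2 ih1 ih2 => exact (ih1.add ih2).congr fun X u hu ρ σ =>
      (pd_add _ (h1.contDiffAt X hu ρ σ) (h2.contDiffAt X hu ρ σ)).symm
  | congr _ h ih =>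
    refine ih.congr fun X u hu ρ σ => pd_congr _ ?_
    filter_upwards [X.isOpen.mem_nhds hu] with v hv using h X v hv ρ σ
  | monomial M hs ho =>
    have h := pd_prod_factors (n := n) (Sum.inl m) M.factors ho
    rw [hs] at h
    refine (((h.of_eq (s' := Occurrences.adjoin (s + ⟨fun k => [m].count k, 0, 0, 0⟩) M.K M.N)
      ?_).contract).smul M.coeff).congr fun X u hu ρ σ => ?_
    · ext (k | k) <;> simp [Occurrences.adjoin, List.count_cons]
    · simp only [LMonomial.eval]
      have hd := fun ρ' σ' => LFactor.contDiffAt_prod X hu (Sum.elim ρ ρ') (Sum.elim σ σ') M.factors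
      rw [pd_const_mul _ _ (contDiffAt_sum fun _ => contDiffAt_sum fun _ => hd _ _),
        pd_sum _ _ fun _ _ => contDiffAt_sum fun _ => hd _ _]
      congr 1
      refine Finset.sum_congr rfl fun _ _ => ?_
      rw [pd_sum _ _ fun _ _ => hd _ _]
      rfl

end IsExpr

theorem extend_zero_zero {A B : Type*} (f : A → B) : Function.extend f (0 : A → ℕ) 0 = 0 := by
  classical
  funext k
  simp [Function.extend_def]

theorem extend_one_zero {A B : Type*} (f : A → B) (k : B) [Decidable (∃ x, f x = k)] :
    Function.extend f (1 : A → ℕ) 0 k = if ∃ x, f x = k then 1 else 0 := by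
  simp [Function.extend_def]

/-! ### Christoffel symbols and curvature terms as contractions -/

namespace IsExpr

variable {n p q r : ℕ} {κ ν : Type} [DecidableEq κ] [DecidableEq ν]

theorem pd_map (m : κ) (α : ν) : IsExpr (n := n) 0 0 1
    ⟨fun k => [m].count k, 0, 0, fun β => [α].count β⟩
    fun X u ρ σ => MapCov.pd (ρ m) (fun v => X.Φ v (σ α)) u := by
  refine ((factor (.map [m] α) (by simp [LFactor.OrderLE])).of_eq ?_).congr
    fun X u _ ρ σ => by simp [LFactor.eval, pdList]
  ext k <;> simp [LFactor.lowerM, LFactor.upperM, LFactor.lowerN, LFactor.upperN]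

theorem christoffelM (k i j : κ) : IsExpr (n := n) 1 0 0
    ⟨fun l => [i, j].count l, fun l => [k].count l, 0, (0 : ν → ℕ)⟩
    fun X u ρ _ => localChristoffel X.a (ρ k) (ρ i) (ρ j) u := by
  -- The three summands of a Christoffel symbol differ only by a permutation of `i, j` and the bound
  -- label, so one argument with a permutation hypothesis treats them all.
  have h : ∀ x y z : κ ⊕ Unit, ([y, z, x] : List (κ ⊕ Unit)).Perm
      [Sum.inl i, Sum.inl j, Sum.inr ()] → IsExpr (n := n) 1 0 0
    ⟨fun l => [i, j].count l, fun l => [k].count l, 0, (0 : ν → ℕ)⟩ fun X u ρ _ =>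
      ∑ l, (Matrix.of fun i j => X.a i j u)⁻¹ (ρ k) l *
        MapCov.pd (Sum.elim ρ (fun _ => l) x)
          (X.a (Sum.elim ρ (fun _ => l) y) (Sum.elim ρ (fun _ => l) z)) u := by
    intro x y z hxyz
    have := ((prod_factors (n := n) (p := 1) (q := 0) (r := 0) (ν := ν)
      [.invMetricM (Sum.inl k) (Sum.inr ()), .metricM [x] y z]
      (by simp [LFactor.OrderLE])).contractM ?_ ?_)
    · refine (this.of_eq ?_).congr fun X u _ ρ σ => ?_
      · ext l
        · have := @List.Perm.count_eq _ instBEqOfDecidableEq _ _ hxyz (Sum.inl l)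
          simp only [List.count_cons, List.count_nil, beq_iff_eq, Sum.inl.injEq, reduceCtorEq, if_false,
            if_true] at this
          simp [LFactor.lowerM, List.count_cons]
          omega
        all_goals simp [LFactor.lowerM, LFactor.upperM, LFactor.lowerN, LFactor.upperN,
          List.count_cons]
      · simp [LFactor.eval, pdList]
    · have := @List.Perm.count_eq _ instBEqOfDecidableEq _ _ hxyz (Sum.inr ())
      simp only [List.count_cons, List.count_nil, beq_iff_eq, Sum.inl.injEq, reduceCtorEq, if_false,
            if_true] at this
      simp [LFactor.lowerM, List.count_cons]
      omega
    · simp [LFactor.upperM, List.count_cons]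
  refine ((((h (Sum.inl i) (Sum.inl j) (Sum.inr ()) ?_).add
    (h (Sum.inl j) (Sum.inl i) (Sum.inr ()) ?_)).sub
    (h (Sum.inr ()) (Sum.inl i) (Sum.inl j) ?_)).smul (1 / 2)).congr fun X u _ ρ σ => ?_
  · exact List.perm_append_comm (l₁ := [Sum.inl j, Sum.inr ()]) (l₂ := [Sum.inl i])
  · exact .cons _ (.swap _ _ _)
  · exact .refl _
  · simp only [localChristoffel, Sum.elim_inl, Sum.elim_inr, mul_add, mul_sub,
      Finset.sum_add_distrib, Finset.sum_sub_distrib]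

theorem christoffelN (k i j : ν) : IsExpr (n := n) 0 1 0
    ⟨(0 : κ → ℕ), 0, fun l => [i, j].count l, fun l => [k].count l⟩
    fun X u _ σ => localChristoffel X.b (σ k) (σ i) (σ j) (X.Φ u) := by
  have h : ∀ x y z : ν ⊕ Unit, ([y, z, x] : List (ν ⊕ Unit)).Perm
      [Sum.inl i, Sum.inl j, Sum.inr ()] → IsExpr (n := n) 0 1 0
    ⟨(0 : κ → ℕ), 0, fun l => [i, j].count l, fun l => [k].count l⟩ fun X u _ σ =>
      ∑ l, (Matrix.of fun i j => X.b i j (X.Φ u))⁻¹ (σ k) l *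
        MapCov.pd (Sum.elim σ (fun _ => l) x)
          (X.b (Sum.elim σ (fun _ => l) y) (Sum.elim σ (fun _ => l) z)) (X.Φ u) := by
    intro x y z hxyz
    have := ((prod_factors (n := n) (p := 0) (q := 1) (r := 0) (κ := κ)
      [.invMetricN (Sum.inl k) (Sum.inr ()), .metricN [x] y z]
      (by simp [LFactor.OrderLE])).contractN ?_ ?_)
    · refine (this.of_eq ?_).congr fun X u _ ρ σ => ?_
      · ext l
        rotate_left 2
        · have := @List.Perm.count_eq _ instBEqOfDecidableEq _ _ hxyz (Sum.inl l)
          simp only [List.count_cons, List.count_nil, beq_iff_eq, Sum.inl.injEq, reduceCtorEq, if_false,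
            if_true] at this
          simp [LFactor.lowerN, List.count_cons]
          omega
        all_goals simp [LFactor.lowerM, LFactor.upperM, LFactor.lowerN, LFactor.upperN,
          List.count_cons]
      · simp [LFactor.eval, pdList]
    · have := @List.Perm.count_eq _ instBEqOfDecidableEq _ _ hxyz (Sum.inr ())
      simp only [List.count_cons, List.count_nil, beq_iff_eq, Sum.inl.injEq, reduceCtorEq, if_false,
            if_true] at this
      simp [LFactor.lowerN, List.count_cons]
      omega
    · simp [LFactor.upperN, List.count_cons]
  refine ((((h (Sum.inl i) (Sum.inl j) (Sum.inr ()) ?_).add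
    (h (Sum.inl j) (Sum.inl i) (Sum.inr ()) ?_)).sub
    (h (Sum.inr ()) (Sum.inl i) (Sum.inl j) ?_)).smul (1 / 2)).congr fun X u _ ρ σ => ?_
  · exact List.perm_append_comm (l₁ := [Sum.inl j, Sum.inr ()]) (l₂ := [Sum.inl i])
  · exact .cons _ (.swap _ _ _)
  · exact .refl _
  · simp only [localChristoffel, Sum.elim_inl, Sum.elim_inr, mul_add, mul_sub,
      Finset.sum_add_distrib, Finset.sum_sub_distrib]

theorem connectionForm (m : κ) (α γ : ν) : IsExpr (n := n) 0 1 1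
    ⟨fun k => [m].count k, 0, fun β => [γ].count β, fun β => [α].count β⟩
    fun X u ρ σ => MapCov.connectionForm X.b X.Φ (ρ m) (σ α) (σ γ) u := by
  have h := ((((pd_map (n := n) m (Sum.inr () : ν ⊕ Unit)).mono le_rfl zero_le_one le_rfl).mul
    ((christoffelN (n := n) (κ := κ) (Sum.inl α) (Sum.inl γ) (Sum.inr () : ν ⊕ Unit)).mono
      le_rfl le_rfl zero_le_one)).contractN ?_ ?_)
  · refine (h.of_eq ?_).congr fun X u _ ρ σ => ?_
    · ext k <;> simp [List.count_cons]
    · simp [MapCov.connectionForm]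
  all_goals simp [List.count_cons]

/-- A differentiated Christoffel symbol has second derivatives of a metric. The map enters only
through first derivatives, also after the chain rule for the symbols of the target metric. -/
theorem curvatureTerm (i j m : κ) (α : ν) : IsExpr (n := n) 2 2 1
    ⟨fun k => [i, j, m].count k, 0, 0, fun β => [α].count β⟩
    fun X u ρ σ => MapCov.curvatureTerm X.a X.b X.Φ (ρ i) (ρ j) (ρ m) (σ α) u := by
  have h1 := (((((christoffelM (n := n) (ν := ν) (Sum.inr ()) (Sum.inl j) (Sum.inl i)).pd
    (Sum.inl m : κ ⊕ Unit)).mono le_rfl one_le_two le_rfl).mul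
    ((pd_map (n := n) (Sum.inr () : κ ⊕ Unit) α).mono zero_le_two zero_le_two le_rfl)).contractM
    ?_ ?_).neg
  · have h2 := ((((((pd_map (n := n) i (Sum.inl (Sum.inr ()) : (ν ⊕ Unit) ⊕ Unit)).mul
      (pd_map (n := n) j (Sum.inr () : (ν ⊕ Unit) ⊕ Unit))).mono zero_le_two zero_le_two
        le_rfl).mul (((christoffelN (n := n) (Sum.inl (Sum.inl α)) (Sum.inl (Sum.inr ()))
        (Sum.inr () : (ν ⊕ Unit) ⊕ Unit)).pd m).mono one_le_two le_rfl le_rfl)).contractN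
        ?_ ?_).contractN ?_ ?_)
    · have h3 := (((((christoffelM (n := n) (ν := ν) (Sum.inl (Sum.inr ())) (Sum.inl (Sum.inl m))
        (Sum.inl (Sum.inl i))).mul (christoffelM (Sum.inr () : (κ ⊕ Unit) ⊕ Unit)
        (Sum.inl (Sum.inl j)) (Sum.inl (Sum.inr ())))).mono (p' := 2) (q' := 2) (r' := 1)
        one_le_two zero_le_two zero_le_one).mul
        ((pd_map (n := n) (Sum.inr () : (κ ⊕ Unit) ⊕ Unit) α).mono zero_le_two zero_le_two
          le_rfl)).contractM ?_ ?_).contractM ?_ ?_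
      · have h4 := (((((connectionForm (n := n) m (Sum.inl (Sum.inl α)) (Sum.inr ())).mul
          (connectionForm j (Sum.inr ()) (Sum.inl (Sum.inr ()) : (ν ⊕ Unit) ⊕ Unit))).mono
          (p' := 2) (q' := 2) (r' := 1) zero_le_two one_le_two le_rfl).mul
          ((pd_map (n := n) i (Sum.inl (Sum.inr ()) : (ν ⊕ Unit) ⊕ Unit)).mono zero_le_two
          zero_le_two le_rfl)).contractN ?_ ?_).contractN ?_ ?_
        · refine ((((h1.of_eq ?_).add (h2.of_eq ?_)).add (h3.of_eq ?_)).add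
            (h4.of_eq ?_)).congr fun X u _ ρ σ => ?_
          all_goals try
            ext k <;> simp [List.count_cons]
            try ring
          simp [MapCov.curvatureTerm]
        all_goals simp [List.count_cons]
      all_goals simp [List.count_cons]
    all_goals simp [List.count_cons]
  all_goals simp [List.count_cons]

end IsExpr

/-! ### Contractions with lower Latin indices and one upper Greek index -/

/-- Families of fields with `P` lower Latin indices and one upper Greek index. -/
abbrev TensorFamily (n P : ℕ) : Type :=
  LocalData n → (Fin P → Fin n) → Fin n → Model n → ℝ

/-- Fields along a map whose components are contractions. -/
def IsTensorExpr {n : ℕ} (p q r : ℕ) {P : ℕ} (c : TensorFamily n P) : Prop :=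
  IsExpr p q r ⟨1, 0, 0, 1⟩ fun X u ρ (σ : Unit → Fin n) => c X ρ (σ ()) u

namespace IsTensorExpr

variable {n p q r P : ℕ} {c : TensorFamily n P}

/-- Each of the three parts of the covariant derivative uses the old slots and the new one once each
below, and the free Greek index once above, so the parts may be added. -/
theorem localCov (h : IsTensorExpr p q r c) :
    IsTensorExpr (p + 1) (q + 1) (r + 1) fun X => localCov X.a X.b X.Φ (c X) := by
  have hcs : Function.Injective (Fin.castSucc : Fin P → Fin (P + 1)) := Fin.castSucc_injective P
  have h1 := ((IsExpr.rename hcs (Function.injective_id (α := Unit)) h).pd (Fin.last P))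
  have h2 : ∀ l : Fin P, IsExpr (p + 1) (q + 1) (r + 1) ⟨1, 0, 0, 1⟩
      fun X u (ρ : Fin (P + 1) → Fin n) (σ : Unit → Fin n) =>
        ∑ k, c X (Function.update (Fin.init ρ) l k) (σ ()) u *
          localChristoffel X.a k (ρ (Fin.last P)) (Fin.init ρ l) u := by
    intro l
    -- In the correction for slot `l`, that slot of `c` receives a new bound label, while the label
    -- `l` itself moves to the Christoffel symbol.
    let f : Fin P → Fin (P + 1) ⊕ Unit := fun j => if j = l then Sum.inr () else Sum.inl j.castSucc
    have hf : Function.Injective f := by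
      intro j j' hj
      simp only [f] at hj
      split_ifs at hj with h h' <;> simp_all
    have hr : (∃ x, f x = Sum.inr ()) := ⟨l, by simp [f]⟩
    have := (((IsExpr.rename hf (Function.injective_id (α := Unit)) h).mono p.le_succ q.le_succ
      r.le_succ).mul ((IsExpr.christoffelM (n := n) (ν := Unit) (Sum.inr ())
      (Sum.inl (Fin.last P)) (Sum.inl l.castSucc)).mono (by omega) (Nat.zero_le _)
      (Nat.zero_le _))).contractM ?_ ?_
    · refine (this.of_eq ?_).congr fun X u _ ρ σ => ?_
      · classical
        ext k
        · have he : ∀ k : Fin (P + 1), (∃ x, f x = Sum.inl k) ↔ k ≠ Fin.last P ∧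
              k ≠ l.castSucc := by
            intro k
            constructor
            · rintro ⟨x, hx⟩
              simp only [f] at hx
              split_ifs at hx with h
              obtain rfl := Sum.inl_injective hx
              exact ⟨Fin.castSucc_ne_last x, fun h' => h (hcs h')⟩
            · rintro ⟨h1, h2⟩
              obtain ⟨x, rfl⟩ := Fin.exists_castSucc_eq.2 h1
              exact ⟨x, by simp [f, show x ≠ l from fun h => h2 (h ▸ rfl)]⟩
          have hl : Fin.last P ≠ l.castSucc := (Fin.castSucc_ne_last l).symm
          simp only [Function.comp_apply, Occurrences.add_lowM, Pi.add_apply, extend_one_zero, he,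
            List.count_cons, List.count_nil]
          by_cases hk1 : k = Fin.last P
          · subst hk1; simp [hl.symm]
          · by_cases hk2 : k = l.castSucc
            · subst hk2; simp [hl]
            · simp [hk1, hk2, Ne.symm hk1, Ne.symm hk2]
        · simp [extend_zero_zero, List.count_cons]
        · simp [extend_zero_zero]
        · simp [extend_one_zero]
      · simp only [Sum.elim_inl, Sum.elim_inr, Function.comp_id]
        refine Finset.sum_congr rfl fun k _ => ?_
        congr 2
        funext j
        by_cases hj : j = l
        · subst hj; simp [f]
        · simp [f, hj, Fin.init]
    · classical
      simp [extend_one_zero, hr, List.count_cons]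
    · simp [extend_zero_zero]
  -- The upper index of `c` becomes a bound Greek label. The free one is now the upper index of the
  -- target Christoffel symbol, and the second bound label joins that symbol to `∂Φ`.
  have h3 := (((((IsExpr.rename (g := fun _ => Sum.inl (Sum.inr ())) hcs
    (Function.injective_of_subsingleton (α := Unit) (β := (Unit ⊕ Unit) ⊕ Unit) _) h).mono
    p.le_succ q.le_succ r.le_succ).mul ((IsExpr.pd_map (n := n) (Fin.last P) (Sum.inr ())).mono
    (Nat.zero_le _) (Nat.zero_le _) (by omega))).mul ((IsExpr.christoffelN (n := n)
    (Sum.inl (Sum.inl ())) (Sum.inl (Sum.inr ())) (Sum.inr ())).mono (Nat.zero_le _) (by omega)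
    (Nat.zero_le _))).contractN ?_ ?_).contractN ?_ ?_
  · have hc : ∀ k : Fin (P + 1), Function.extend Fin.castSucc (1 : Fin P → ℕ) 0 k +
        [Fin.last P].count k = 1 := by
      intro k
      classical
      simp only [extend_one_zero, Fin.exists_castSucc_eq]
      by_cases hk : k = Fin.last P
      · simp [hk]
      · simp [hk, List.count_cons, Ne.symm hk]
    refine (((h1.of_eq ?_).sub (IsExpr.sum Finset.univ h2)).add (h3.of_eq ?_)).congr
      fun X u _ ρ σ => ?_
    · ext k
      · exact hc k
      · simp [extend_zero_zero]
      · simp [extend_zero_zero]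
      · simp [extend_one_zero]
    · ext k
      · simpa using hc k
      · simp [extend_zero_zero]
      · simp [extend_zero_zero, List.count_cons]
      · simp [extend_one_zero, List.count_cons]
    · simp only [MapCov.localCov]
      rfl
  all_goals simp [extend_one_zero, extend_zero_zero, List.count_cons]

theorem localTrace {c : TensorFamily n 2} (h : IsTensorExpr p q r c) :
    IsTensorExpr p q r fun X => localTrace (p := 0) X.a (c X) := by
  let f : Fin 2 → (Fin 0 ⊕ Unit) ⊕ Unit := ![Sum.inl (Sum.inr ()), Sum.inr ()]
  have hf : Function.Injective f := by decide
  have := (((IsExpr.factor (n := n) (p := p) (q := q) (r := r) (ν := Unit)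
    (.invMetricM (Sum.inl (Sum.inr ())) (Sum.inr ())) trivial).mul
    (IsExpr.rename hf (Function.injective_id (α := Unit)) h)).contractM ?_ ?_).contractM ?_ ?_
  · refine (this.of_eq ?_).congr fun X u _ ρ σ => ?_
    · ext k
      · exact k.elim0
      · exact k.elim0
      · simp [extend_zero_zero, LFactor.lowerN]
      · simp [extend_one_zero, LFactor.upperN]
    · simp only [LFactor.eval, MapCov.localTrace, Sum.elim_inl, Sum.elim_inr, Function.comp_id]
      refine Finset.sum_congr rfl fun i _ => Finset.sum_congr rfl fun j _ => ?_
      congr 2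
      funext l
      fin_cases l <;> rfl
  all_goals simp [extend_one_zero, extend_zero_zero, LFactor.lowerM, LFactor.upperM,
    List.count_cons, f]

end IsTensorExpr

/-! ### The difference of the two fourth order traces of the differential -/

section Commutator

variable {n : ℕ}

/-- The commutator of covariant derivatives applied to the differential. -/
def commutator (X : LocalData n) (I : Fin 3 → Fin n) (α : Fin n) (u : Model n) : ℝ :=
  curvatureTerm X.a X.b X.Φ (I 1) (I 2) (I 0) α u - curvatureTerm X.a X.b X.Φ (I 1) (I 0) (I 2) α u

/-- The contraction of the first and fourth and of the second and third indices. -/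
def crossTrace (a : Fin n → Fin n → Model n → ℝ) (c : (Fin 4 → Fin n) → Fin n → Model n → ℝ)
    (_ : Fin 0 → Fin n) (α : Fin n) (u : Model n) : ℝ :=
  ∑ μ, ∑ k, ∑ ν, ∑ l, ((Matrix.of fun i j => a i j u)⁻¹ μ k *
    (Matrix.of fun i j => a i j u)⁻¹ ν l) * c ![k, l, ν, μ] α u

/-- The source of the gain in order: an exchange of slots in a third order derivative of the map has
only first derivatives of the map. -/
theorem isTensorExpr_commutator : IsTensorExpr (n := n) 2 2 1 commutator := by
  refine ((((IsExpr.curvatureTerm (n := n) (1 : Fin 3) 2 0 ()).of_eq ?_).sub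
    ((IsExpr.curvatureTerm (n := n) (1 : Fin 3) 0 2 ()).of_eq ?_))).congr fun X u _ ρ σ => rfl
  all_goals
    ext k
    · fin_cases k <;> rfl
    · rfl
    · rfl
    · rfl

theorem IsTensorExpr.crossTrace {p q r : ℕ} {c : TensorFamily n 4} (h : IsTensorExpr p q r c) :
    IsTensorExpr p q r fun X => crossTrace X.a (c X) := by
  -- The nesting depth of the four labels fixes the order of summation in `crossTrace`: `contractM`
  -- removes the outermost summand of the label type first, which becomes the innermost sum.
  let m : (((Fin 0 ⊕ Unit) ⊕ Unit) ⊕ Unit) ⊕ Unit := Sum.inl (Sum.inl (Sum.inl (Sum.inr ())))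
  let k : (((Fin 0 ⊕ Unit) ⊕ Unit) ⊕ Unit) ⊕ Unit := Sum.inl (Sum.inl (Sum.inr ()))
  let j : (((Fin 0 ⊕ Unit) ⊕ Unit) ⊕ Unit) ⊕ Unit := Sum.inl (Sum.inr ())
  let l : (((Fin 0 ⊕ Unit) ⊕ Unit) ⊕ Unit) ⊕ Unit := Sum.inr ()
  have hf : Function.Injective ![k, l, j, m] := by decide
  have := (((((((IsExpr.factor (n := n) (p := p) (q := q) (r := r) (ν := Unit)
    (.invMetricM m k) trivial).mul (IsExpr.factor (.invMetricM j l) trivial)).mul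
    (IsExpr.rename hf (Function.injective_id (α := Unit)) h)).contractM ?_ ?_).contractM ?_
      ?_).contractM ?_ ?_).contractM ?_ ?_)
  · refine (this.of_eq ?_).congr fun X u _ ρ σ => ?_
    · ext k
      · exact k.elim0
      · exact k.elim0
      · simp [extend_zero_zero, LFactor.lowerN]
      · simp [extend_one_zero, LFactor.upperN]
    · simp only [LFactor.eval, MapCov.crossTrace, Function.comp_id]
      refine Finset.sum_congr rfl fun _ _ => Finset.sum_congr rfl fun _ _ =>
        Finset.sum_congr rfl fun _ _ => Finset.sum_congr rfl fun _ _ => ?_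
      congr 2
      funext i
      fin_cases i <;> rfl
  all_goals simp [extend_one_zero, extend_zero_zero, LFactor.lowerM, LFactor.upperM,
    List.count_cons, m, k, j, l, Fin.exists_fin_succ]

/-- The Laplacian of a field without lower indices. -/
def localLaplacian (X : LocalData n) (c : (Fin 0 → Fin n) → Fin n → Model n → ℝ) :
    (Fin 0 → Fin n) → Fin n → Model n → ℝ :=
  localTrace X.a (localCov X.a X.b X.Φ (localCov X.a X.b X.Φ c))

/-- Each Laplacian consists of two covariant derivatives, and the trace adds no derivatives. -/
theorem IsTensorExpr.iterate_localLaplacian {p q r : ℕ} {c : TensorFamily n 0}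
    (h : IsTensorExpr p q r c) (j : ℕ) : IsTensorExpr (p + 2 * j) (q + 2 * j) (r + 2 * j)
      fun X => (localLaplacian X)^[j] (c X) := by
  induction j with
  | zero => exact h
  | succ j ih =>
    simp only [Function.iterate_succ_apply']
    exact ih.localCov.localCov.localTrace

/-- The Hessian is symmetric on all of the open domain, and the covariant derivative commutes with
permutations of the old slots. -/
theorem localCov_three_swap (X : LocalData n) {u : Model n} (hu : u ∈ X.U) (i j m α : Fin n) :
    localCov X.a X.b X.Φ (localCov X.a X.b X.Φ (localDifferential X.Φ)) ![i, j, m] α u =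
      localCov X.a X.b X.Φ (localCov X.a X.b X.Φ (localDifferential X.Φ)) ![j, i, m] α u := by
  have hs : ∀ k l m : Fin n, ![k, l, m] = Fin.snoc (α := fun _ => Fin n) ![k, l] m := by
    intro k l m
    funext x
    fin_cases x <;> rfl
  have hp : ![i, j] ∘ Equiv.swap (0 : Fin 2) 1 = ![j, i] := by
    funext x
    fin_cases x <;> rfl
  rw [hs j i, ← hp, ← localCov_perm, ← hs]
  refine localCov_congr (fun I α => ?_) _ _
  filter_upwards [X.isOpen.mem_nhds hu] with v hv
  have h1 : I = ![I 0, I 1] := by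
    funext x
    fin_cases x <;> rfl
  have h2 : I ∘ Equiv.swap (0 : Fin 2) 1 = ![I 1, I 0] := by
    funext x
    fin_cases x <;> rfl
  rw [h2]
  conv_lhs => rw [h1]
  exact localCov_localDifferential_symm (X.metric_a v hv).symm (X.metric_b v hv).symm
    (X.contDiffAt v hv) _ _ _

/-- For `I = (i, j, k)` symmetry of the Hessian turns `[k, j, i] - [i, j, k]` into `[j, k, i] - [j,
i, k]`, where only the two derivative slots are exchanged. The Ricci identity then applies. -/
theorem commutator_eq (X : LocalData n) {u : Model n} (hu : u ∈ X.U) (I : Fin 3 → Fin n)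
    (α : Fin n) : commutator X I α u =
      localCov X.a X.b X.Φ (localCov X.a X.b X.Φ (localDifferential X.Φ))
        (I ∘ Equiv.swap (0 : Fin 3) 2) α u -
      localCov X.a X.b X.Φ (localCov X.a X.b X.Φ (localDifferential X.Φ)) I α u := by
  have h1 : I = ![I 0, I 1, I 2] := by
    funext x
    fin_cases x <;> rfl
  have h2 : I ∘ Equiv.swap (0 : Fin 3) 2 = ![I 2, I 1, I 0] := by
    funext x
    fin_cases x <;> rfl
  rw [h2]
  conv_rhs => rw [h1]
  simp only [Matrix.cons_val]
  rw [localCov_three_swap X hu (I 2), localCov_three_swap X hu (I 0),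
    localCov_localCov_sub (X.metric_a u hu) (X.metric_b u hu) (X.contDiffAt u hu)]
  rfl

/-- The identity `commutator_eq` holds on an open set, so it may be differentiated. -/
theorem localCov_commutator (X : LocalData n) {u : Model n} (hu : u ∈ X.U) (i j k l α : Fin n) :
    localCov X.a X.b X.Φ (commutator X) ![i, j, k, l] α u =
      localCov X.a X.b X.Φ (localCov X.a X.b X.Φ (localCov X.a X.b X.Φ (localDifferential X.Φ)))
        ![k, j, i, l] α u -
      localCov X.a X.b X.Φ (localCov X.a X.b X.Φ (localCov X.a X.b X.Φ (localDifferential X.Φ)))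
        ![i, j, k, l] α u := by
  have hs : ∀ k l m r : Fin n, ![k, l, m, r] = Fin.snoc (α := fun _ => Fin n) ![k, l, m] r := by
    intro k l m r
    funext x
    fin_cases x <;> rfl
  have hp : ![i, j, k] ∘ Equiv.swap (0 : Fin 3) 2 = ![k, j, i] := by
    funext x
    fin_cases x <;> rfl
  have hd : ∀ I α, ContDiffAt ℝ ∞
      (localCov X.a X.b X.Φ (localCov X.a X.b X.Φ (localDifferential X.Φ)) I α) u := fun I α =>
    contDiffAt_localCov (X.metric_a u hu) (X.metric_b u hu) (X.contDiffAt u hu)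
      (fun I α => contDiffAt_localCov (X.metric_a u hu) (X.metric_b u hu) (X.contDiffAt u hu)
        (fun I α => contDiffAt_localDifferential (X.contDiffAt u hu) I α) I α) I α
  rw [localCov_congr (c' := fun I α v =>
    localCov X.a X.b X.Φ (localCov X.a X.b X.Φ (localDifferential X.Φ))
      (I ∘ Equiv.swap (0 : Fin 3) 2) α v -
    localCov X.a X.b X.Φ (localCov X.a X.b X.Φ (localDifferential X.Φ)) I α v),
    localCov_sub (fun I α => hd _ _) hd]
  · rw [hs k j i l, ← hp, ← localCov_perm, ← hs]
  · intro I α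
    filter_upwards [X.isOpen.mem_nhds hu] with v hv using commutator_eq X hv I α

/-- The bi-Laplacian of the map and the contraction corresponding to `Z` differ by a contraction of
the covariant derivative of the curvature terms. -/
theorem localLaplacian_localTrace_sub (X : LocalData n) {u : Model n} (hu : u ∈ X.U)
    (I : Fin 0 → Fin n) (α : Fin n) :
    localLaplacian X (localTrace X.a (localCov X.a X.b X.Φ (localDifferential X.Φ))) I α u -
      crossTrace X.a (localCov X.a X.b X.Φ (localCov X.a X.b X.Φ (localCov X.a X.b X.Φ
        (localDifferential X.Φ)))) I α u =
    crossTrace X.a (localCov X.a X.b X.Φ (commutator X)) I α u := by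
  have hd1 : ∀ v ∈ X.U, ∀ I α, ContDiffAt ℝ ∞
      (localCov X.a X.b X.Φ (localDifferential X.Φ) I α) v := fun v hv I α =>
    contDiffAt_localCov (X.metric_a v hv) (X.metric_b v hv) (X.contDiffAt v hv)
        (fun I α => contDiffAt_localDifferential (X.contDiffAt v hv) I α) I α
  have hd2 : ∀ v ∈ X.U, ∀ I α, ContDiffAt ℝ ∞
      (localCov X.a X.b X.Φ (localCov X.a X.b X.Φ (localDifferential X.Φ)) I α) v := fun v hv I α =>
    contDiffAt_localCov (X.metric_a v hv) (X.metric_b v hv) (X.contDiffAt v hv) (hd1 v hv) I α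
  -- The inner trace is moved out through both derivatives of the Laplacian; the first passage has
  -- to hold near `u`.
  have h1 : ∀ J β, localCov X.a X.b X.Φ (localCov X.a X.b X.Φ
      (localTrace X.a (localCov X.a X.b X.Φ (localDifferential X.Φ)))) J β u =
      localTrace X.a (localCov X.a X.b X.Φ (localCov X.a X.b X.Φ (localCov X.a X.b X.Φ
        (localDifferential X.Φ)))) J β u := by
    intro J β
    rw [localCov_congr (c' := localTrace X.a (localCov X.a X.b X.Φ (localCov X.a X.b X.Φ
      (localDifferential X.Φ)))), localCov_localTrace (X.metric_a u hu) (hd2 u hu)]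
    intro I α
    filter_upwards [X.isOpen.mem_nhds hu] with v hv using
      localCov_localTrace (X.metric_a v hv) (hd1 v hv) I α
  -- The bi-Laplacian with the coefficients of `crossTrace`, so that only the order of the slots
  -- differs: `[ν, l, k, μ]` in place of `[k, l, ν, μ]`.
  have h2 : localLaplacian X (localTrace X.a (localCov X.a X.b X.Φ (localDifferential X.Φ))) I α u =
      ∑ μ, ∑ k, ∑ ν, ∑ l, ((Matrix.of fun i j => X.a i j u)⁻¹ μ k *
        (Matrix.of fun i j => X.a i j u)⁻¹ ν l) * localCov X.a X.b X.Φ (localCov X.a X.b X.Φ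
          (localCov X.a X.b X.Φ (localDifferential X.Φ))) ![ν, l, k, μ] α u := by
    rw [localLaplacian, localTrace, Finset.sum_comm]
    refine Finset.sum_congr rfl fun μ _ => Finset.sum_congr rfl fun k _ => ?_
    rw [h1, localTrace, Finset.mul_sum]
    refine Finset.sum_congr rfl fun ν _ => ?_
    rw [Finset.mul_sum]
    refine Finset.sum_congr rfl fun l _ => ?_
    rw [inv_symm (X.metric_a u hu).symm k μ, ← mul_assoc]
    congr 3
    funext x
    fin_cases x <;> rfl
  rw [h2]
  simp only [crossTrace, localCov_commutator X hu, mul_sub, Finset.sum_sub_distrib]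

end Commutator

/-! ### From contractions to lower order expressions -/

namespace Factor

variable {L G : ℕ}

/-- The same factor with labels in the types `Fin L` and `Fin (G + 1)`. -/
def toLabelled : Factor L G → LFactor (Fin L) (Fin (G + 1))
  | metricM D i j => .metricM D i j
  | invMetricM i j => .invMetricM i j
  | metricN D α β => .metricN D α β
  | invMetricN α β => .invMetricN α β
  | map D α => .map D α

/-- The inverse of `Factor.toLabelled`. -/
def ofLabelled : LFactor (Fin L) (Fin (G + 1)) → Factor L G
  | .metricM D i j => metricM D i j
  | .invMetricM i j => invMetricM i j
  | .metricN D α β => metricN D α β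
  | .invMetricN α β => invMetricN α β
  | .map D α => map D α

theorem toLabelled_ofLabelled (f : LFactor (Fin L) (Fin (G + 1))) :
    (ofLabelled f).toLabelled = f := by
  cases f <;> rfl

theorem orderLE_ofLabelled {p q r : ℕ} (f : LFactor (Fin L) (Fin (G + 1))) :
    (ofLabelled f).OrderLE p q r ↔ f.OrderLE p q r := by
  cases f <;> rfl

theorem flatMap_ofLabelled (fs : List (LFactor (Fin L) (Fin (G + 1)))) :
    (fs.map ofLabelled).flatMap lowerM = fs.flatMap LFactor.lowerM ∧
    (fs.map ofLabelled).flatMap upperM = fs.flatMap LFactor.upperM ∧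
    (fs.map ofLabelled).flatMap lowerN = fs.flatMap LFactor.lowerN ∧
    (fs.map ofLabelled).flatMap upperN = fs.flatMap LFactor.upperN := by
  induction fs with
  | nil => simp
  | cons f fs ih =>
    obtain ⟨h1, h2, h3, h4⟩ := ih
    simp only [List.map_cons, List.flatMap_cons, h1, h2, h3, h4]
    cases f <;> simp [ofLabelled, lowerM, upperM, lowerN, upperN, LFactor.lowerM, LFactor.upperM,
      LFactor.lowerN, LFactor.upperN]

end Factor

/-- The value of a monomial on local data. -/
def Monomial.localEval {n : ℕ} (m : Monomial) (X : LocalData n) (γ : Fin n) (u : Model n) : ℝ :=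
  m.coeff * ∑ ρ : Fin m.numM → Fin n, ∑ σ : Fin m.numN → Fin n,
    (m.factors.map fun f => f.toLabelled.eval X u ρ (Fin.cons γ σ)).prod

/-- Enumerates the abstract bound labels. There are no free Latin labels, and the only free Greek
label becomes `0`. -/
theorem exists_monomial {n p q r : ℕ} (m : LMonomial (Fin 0) Unit)
    (hs : LFactor.occ m.factors = Occurrences.adjoin ⟨1, 0, 0, 1⟩ m.K m.N)
    (ho : ∀ f ∈ m.factors, f.OrderLE p q r) :
    ∃ M : Monomial, (M.IsContraction ∧ ∀ f ∈ M.factors, f.OrderLE p q r) ∧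
      ∀ (X : LocalData n) u ρ γ, m.eval X u ρ (fun _ => γ) = M.localEval X γ u := by
  let eK : Fin 0 ⊕ m.K ≃ Fin (Fintype.card m.K) :=
    (Equiv.emptySum (Fin 0) m.K).trans (Fintype.equivFin m.K)
  -- Bound Greek labels are shifted by one, since `0` is reserved for the free index.
  let t : Unit ⊕ m.N → Fin (Fintype.card m.N + 1) :=
    Sum.elim (fun _ => 0) fun x => (Fintype.equivFin m.N x).succ
  have ht : Function.Injective t := by
    rintro (x | x) (y | y) h
    · rfl
    · exact absurd h (Fin.succ_ne_zero _).symm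
    · exact absurd h (Fin.succ_ne_zero _)
    · exact congrArg _ ((Fintype.equivFin m.N).injective (Fin.succ_injective _ h))
  have h := LFactor.occ_rename eK.injective ht m.factors
  rw [hs] at h
  have hK : ∀ w : m.K → ℕ, ∀ v : Fin 0 → ℕ, ∀ i, Function.extend eK (Sum.elim v w) 0 i =
      w ((Fintype.equivFin m.K).symm i) := by
    intro w v i
    obtain ⟨x, rfl⟩ := eK.surjective i
    rw [eK.injective.extend_apply]
    rcases x with x | x
    · exact x.elim0
    · simp [eK]
  have hN0 : ∀ w : m.N → ℕ, ∀ v : Unit → ℕ, Function.extend t (Sum.elim v w) 0 0 = v () := by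
    intro w v
    exact ht.extend_apply _ _ (Sum.inl ())
  have hN : ∀ w : m.N → ℕ, ∀ v : Unit → ℕ, ∀ i, Function.extend t (Sum.elim v w) 0 (Fin.succ i) =
      w ((Fintype.equivFin m.N).symm i) := by
    intro w v i
    obtain ⟨x, rfl⟩ := (Fintype.equivFin m.N).surjective i
    rw [Equiv.symm_apply_apply]
    exact ht.extend_apply _ _ (Sum.inr x)
  obtain ⟨f1, f2, f3, f4⟩ := Factor.flatMap_ofLabelled (m.factors.map (LFactor.rename eK t))
  refine ⟨⟨m.coeff, Fintype.card m.K, Fintype.card m.N,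
    (m.factors.map (LFactor.rename eK t)).map Factor.ofLabelled⟩, ⟨⟨?_, ?_, ?_, ?_⟩, ?_⟩, ?_⟩
  · intro i
    have := congrFun (congrArg Occurrences.lowM h) i
    simp only [LFactor.occ_lowM, Occurrences.adjoin, hK] at this
    rw [f1, this]
    rfl
  · intro i
    have := congrFun (congrArg Occurrences.upM h) i
    simp only [LFactor.occ_upM, Occurrences.adjoin, hK] at this
    rw [f2, this]
    rfl
  · intro i
    have := congrFun (congrArg Occurrences.lowN h) i
    simp only [LFactor.occ_lowN, Occurrences.adjoin] at this
    rw [f3, this]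
    refine Fin.cases ?_ (fun i => ?_) i
    · rw [hN0]; rfl
    · rw [hN, if_neg (Fin.succ_ne_zero i)]; rfl
  · intro i
    have := congrFun (congrArg Occurrences.upN h) i
    simp only [LFactor.occ_upN, Occurrences.adjoin] at this
    rw [f4, this]
    refine Fin.cases ?_ (fun i => ?_) i
    · rw [hN0]; rfl
    · rw [hN]; rfl
  · intro f hf
    simp only [List.mem_map] at hf
    obtain ⟨_, ⟨g, hg, rfl⟩, rfl⟩ := hf
    exact (Factor.orderLE_ofLabelled _).2 ((LFactor.orderLE_rename _ _ _).2 (ho g hg))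
  · intro X u ρ γ
    simp only [LMonomial.eval, Monomial.localEval, List.map_map]
    congr 1
    refine Fintype.sum_equiv ((Fintype.equivFin m.K).arrowCongr (Equiv.refl _)) _ _ fun ρ' =>
      Fintype.sum_equiv ((Fintype.equivFin m.N).arrowCongr (Equiv.refl _)) _ _ fun σ' => ?_
    congr 2
    funext f
    simp only [Function.comp_apply, Factor.toLabelled_ofLabelled, LFactor.eval_rename]
    congr 1
    · funext x
      rcases x with x | x
      · exact x.elim0
      · simp [eK]
    · funext x
      rcases x with x | x <;> simp [t]

/-- The expression is read off from the derivation of `IsExpr`, which concerns the whole family over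
all local data. Hence `P` is chosen before the data. -/
theorem IsTensorExpr.exists_lowerOrder {n p q r : ℕ} {c : TensorFamily n 0}
    (h : IsTensorExpr p q r c) : ∃ P : LowerOrder p q r, ∀ X, ∀ u ∈ X.U, ∀ I γ,
      c X I γ u = (P.1.map fun m => m.localEval X γ u).sum := by
  have key : ∀ T : Family n (Fin 0) Unit, IsExpr p q r ⟨1, 0, 0, 1⟩ T → ∃ P : LowerOrder p q r,
      ∀ X, ∀ u ∈ X.U, ∀ ρ γ, T X u ρ (fun _ => γ) = (P.1.map fun m => m.localEval X γ u).sum := by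
    intro T hT
    induction hT with
    | zero => exact ⟨⟨[], by simp⟩, by simp⟩
    | monomial m hs ho =>
      obtain ⟨M, hM, hM'⟩ := exists_monomial (n := n) m hs ho
      exact ⟨⟨[M], by simpa using hM⟩, fun X u _ ρ γ => by simp [hM']⟩
    | add _ _ h1 h2 =>
      obtain ⟨P, hP⟩ := h1
      obtain ⟨Q, hQ⟩ := h2
      refine ⟨⟨P.1 ++ Q.1, fun m hm => ?_⟩, fun X u hu ρ γ => ?_⟩
      · rcases List.mem_append.1 hm with hm | hm
        exacts [P.2 m hm, Q.2 m hm]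
      · simp [hP X u hu ρ γ, hQ X u hu ρ γ]
    | congr _ h ih =>
      obtain ⟨P, hP⟩ := ih
      exact ⟨P, fun X u hu ρ γ => by rw [← h X u hu, hP X u hu]⟩
  obtain ⟨P, hP⟩ := key _ h
  exact ⟨P, fun X u hu I γ => hP X u hu I γ⟩

open IsManifold

/-! ### Coordinate frames -/

section Frames

variable {n : ℕ} {M N : Type*} [TopologicalSpace M] [ChartedSpace (Model n) M]
  [TopologicalSpace N] [ChartedSpace (Model n) N] [IsManifold (𝓡 n) ∞ M] [IsManifold (𝓡 n) ∞ N]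
  {e e₀ : OpenPartialHomeomorph M (Model n)} {e' : OpenPartialHomeomorph N (Model n)}

theorem mdifferentiable_of_mem_maximalAtlas (he : e ∈ maximalAtlas (𝓡 n) ∞ M) :
    e.MDifferentiable (𝓡 n) (𝓡 n) :=
  ⟨(contMDiffOn_of_mem_maximalAtlas he).mdifferentiableOn (by simp),
    (contMDiffOn_symm_of_mem_maximalAtlas he).mdifferentiableOn (by simp)⟩

theorem chartAt_mem (x : M) : chartAt (Model n) x ∈ maximalAtlas (𝓡 n) ∞ M :=
  chart_mem_maximalAtlas x

theorem frame_eq (he : e ∈ maximalAtlas (𝓡 n) ∞ M) {x : M} (hx : x ∈ e.source) (i : Fin n) :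
    frame e x i = ((mdifferentiable_of_mem_maximalAtlas he).mfderiv hx).symm
      (show Model n from EuclideanSpace.single i 1) := by
  unfold frame
  have : mfderiv (𝓡 n) (𝓡 n) e x = ((mdifferentiable_of_mem_maximalAtlas he).mfderiv hx :
    TangentSpace (𝓡 n) x →L[ℝ] TangentSpace (𝓡 n) (e x)) := rfl
  rw [this, ContinuousLinearMap.inverse_equiv]
  rfl

theorem mfderiv_frame (he : e ∈ maximalAtlas (𝓡 n) ∞ M) {x : M} (hx : x ∈ e.source) (i : Fin n) :
    mfderiv (𝓡 n) (𝓡 n) e x (frame e x i) = (show Model n from EuclideanSpace.single i 1) := by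
  rw [frame_eq he hx]
  exact ((mdifferentiable_of_mem_maximalAtlas he).mfderiv hx).apply_symm_apply _

theorem coord_frame (he : e ∈ maximalAtlas (𝓡 n) ∞ M) {x : M} (hx : x ∈ e.source) (i j : Fin n) :
    coord e x i (frame e x j) = if i = j then 1 else 0 := by
  have : coord e x i (frame e x j) =
    (show Model n from mfderiv (𝓡 n) (𝓡 n) e x (frame e x j)) i := rfl
  rw [this, mfderiv_frame he hx]
  simp

theorem sum_coord_smul_frame (he : e ∈ maximalAtlas (𝓡 n) ∞ M) {x : M} (hx : x ∈ e.source)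
    (v : TangentSpace (𝓡 n) x) : ∑ i, coord e x i v • frame e x i = v := by
  set E := (mdifferentiable_of_mem_maximalAtlas he).mfderiv hx
  apply E.injective
  rw [map_sum]
  have h : ∀ i, E (coord e x i v • frame e x i) =
      (show Model n from E v) i • (EuclideanSpace.single i 1 : Model n) := by
    intro i
    rw [map_smul, frame_eq he hx]
    exact congrArg _ (E.apply_symm_apply _)
  simp only [h]
  have : ∀ w : Model n, (∑ i, w i • (EuclideanSpace.single i 1 : Model n)) = w := by
    intro w
    ext j
    simp [Pi.single_apply]
  exact this (E v)

theorem frame_symm (he : e ∈ maximalAtlas (𝓡 n) ∞ M) {u : Model n} (hu : u ∈ e.target)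
    (i : Fin n) : frame e (e.symm u) i = mfderiv (𝓡 n) (𝓡 n) e.symm u
      (show Model n from EuclideanSpace.single i 1) := by
  have hx := e.map_target hu
  set E := (mdifferentiable_of_mem_maximalAtlas he).mfderiv hx
  apply E.injective
  rw [frame_eq he hx]
  refine (E.apply_symm_apply _).trans ?_
  have := (mdifferentiable_of_mem_maximalAtlas he).comp_symm_deriv hu
  exact (congrArg (fun f => f (show Model n from EuclideanSpace.single i 1)) this).symm

/-- The coordinate expression of a map. -/
def localMap (φ : M → N) (e : OpenPartialHomeomorph M (Model n))
    (e' : OpenPartialHomeomorph N (Model n)) (u : Model n) : Model n :=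
  e' (φ (e.symm u))

/-- The domain of the coordinate expression of a map. -/
def localDomain (φ : M → N) (e : OpenPartialHomeomorph M (Model n))
    (e' : OpenPartialHomeomorph N (Model n)) : Set (Model n) :=
  e.target ∩ e.symm ⁻¹' (φ ⁻¹' e'.source)

theorem isOpen_localDomain {φ : M → N} (hφ : Continuous φ) :
    IsOpen (localDomain φ e e') :=
  e.isOpen_inter_preimage_symm (e'.open_source.preimage hφ)

theorem contDiffAt_localMap {φ : M → N} (hφ : ContMDiff (𝓡 n) (𝓡 n) ∞ φ)
    (he : e ∈ maximalAtlas (𝓡 n) ∞ M) (he' : e' ∈ maximalAtlas (𝓡 n) ∞ N) {u : Model n}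
    (hu : u ∈ localDomain φ e e') : ContDiffAt ℝ ∞ (localMap φ e e') u := by
  rw [← contMDiffAt_iff_contDiffAt]
  exact (contMDiffAt_of_mem_maximalAtlas he' hu.2).comp u
    ((hφ _).comp u (contMDiffAt_symm_of_mem_maximalAtlas he hu.1))

/-- Chain rule for `e' ∘ φ ∘ e.symm`. With `φ = id` this is the change of frame between two charts.
-/
theorem mfderiv_apply_frame {φ : M → N} (hφ : ContMDiff (𝓡 n) (𝓡 n) ∞ φ)
    (he : e ∈ maximalAtlas (𝓡 n) ∞ M) (he' : e' ∈ maximalAtlas (𝓡 n) ∞ N) {u : Model n}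
    (hu : u ∈ localDomain φ e e') (i : Fin n) :
    mfderiv (𝓡 n) (𝓡 n) φ (e.symm u) (frame e (e.symm u) i) =
      ∑ β, pd i (fun v => localMap φ e e' v β) u • frame e' (φ (e.symm u)) β := by
  rw [← sum_coord_smul_frame he' hu.2 (mfderiv (𝓡 n) (𝓡 n) φ (e.symm u) (frame e (e.symm u) i))]
  refine Finset.sum_congr rfl fun β _ => ?_
  congr 1
  have h1 : MDifferentiableAt (𝓡 n) (𝓡 n) e.symm u :=
    (mdifferentiable_of_mem_maximalAtlas he).mdifferentiableAt_symm hu.1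
  have h2 : MDifferentiableAt (𝓡 n) (𝓡 n) φ (e.symm u) := (hφ _).mdifferentiableAt (by simp)
  have h3 : MDifferentiableAt (𝓡 n) (𝓡 n) e' (φ (e.symm u)) :=
    (mdifferentiable_of_mem_maximalAtlas he').mdifferentiableAt hu.2
  have hd : mfderiv (𝓡 n) (𝓡 n) (localMap φ e e') u =
      (mfderiv (𝓡 n) (𝓡 n) e' (φ (e.symm u))).comp
        ((mfderiv (𝓡 n) (𝓡 n) φ (e.symm u)).comp (mfderiv (𝓡 n) (𝓡 n) e.symm u)) := by
    rw [← mfderiv_comp u h2 h1]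
    exact mfderiv_comp u h3 (h2.comp u h1)
  have hp : pd i (fun v => localMap φ e e' v β) u =
      fderiv ℝ (localMap φ e e') u (EuclideanSpace.single i 1) β := by
    have hc := (contDiffAt_localMap hφ he he' hu).diffAt.hasFDerivAt
    have := (EuclideanSpace.proj (𝕜 := ℝ) β).hasFDerivAt.comp u hc
    unfold pd
    rw [show (fun v => localMap φ e e' v β) = (EuclideanSpace.proj (𝕜 := ℝ) β) ∘ localMap φ e e'
      from rfl, this.fderiv]
    rfl
  rw [hp, ← mfderiv_eq_fderiv, hd, frame_symm he hu.1]
  rfl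

theorem frame_change (he : e ∈ maximalAtlas (𝓡 n) ∞ M) (he₀ : e₀ ∈ maximalAtlas (𝓡 n) ∞ M)
    {u : Model n} (hu : u ∈ localDomain (id : M → M) e e₀) (i : Fin n) :
    frame e (e.symm u) i =
      ∑ β, pd i (fun v => localMap id e e₀ v β) u • frame e₀ (e.symm u) β := by
  rw [← id_eq (e.symm u), ← mfderiv_apply_frame contMDiff_id he he₀ hu, mfderiv_id]
  rfl

/-- The coordinate frame is the tangent map of `e.symm` applied to a constant field, hence a smooth
field along `e.symm`; the metric, a smooth section of bilinear forms, is paired with two such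
fields. -/
theorem contDiffAt_metricComp (g : Metric n M) (he : e ∈ maximalAtlas (𝓡 n) ∞ M) {u : Model n}
    (hu : u ∈ e.target) (i j : Fin n) : ContDiffAt ℝ ∞ (metricComp g e i j) u := by
  have hsec : ∀ i : Fin n, ContMDiffOn (𝓡 n) (𝓡 n).tangent ∞ (fun v : Model n =>
      (Bundle.TotalSpace.mk' (Model n) (e.symm v) (frame e (e.symm v) i) : TangentBundle (𝓡 n) M))
      e.target := by
    intro i
    have h1 := (contMDiffOn_symm_of_mem_maximalAtlas he).contMDiffOn_tangentMapWithin (m := ∞)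
      (by simp) e.open_target.uniqueMDiffOn
    have h2 : ContMDiff (𝓡 n) (𝓡 n).tangent ∞ (fun v : Model n =>
        (Bundle.TotalSpace.mk' (Model n) v (EuclideanSpace.single i 1 : Model n) :
          TangentBundle (𝓡 n) (Model n))) :=
      contMDiff_vectorSpace_iff_contDiff.2 contDiff_const
    refine (h1.comp h2.contMDiffOn fun v hv => hv).congr fun v hv => ?_
    simp only [Function.comp_apply, tangentMapWithin]
    rw [mfderivWithin_of_isOpen e.open_target hv, ← frame_symm he hv]
  have hmem := e.open_target.mem_nhds hu
  have hg : ContMDiffAt (𝓡 n) ((𝓡 n).prod 𝓘(ℝ, Model n →L[ℝ] Model n →L[ℝ] ℝ)) ∞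
      (fun v : Model n => Bundle.TotalSpace.mk' (Model n →L[ℝ] Model n →L[ℝ] ℝ)
        (E := fun x : M => TangentSpace (𝓡 n) x →L[ℝ] TangentSpace (𝓡 n) x →L[ℝ] ℝ)
        (e.symm v) (g.inner (e.symm v))) u :=
    (g.contMDiff _).comp u (contMDiffAt_symm_of_mem_maximalAtlas he hu)
  have := ContMDiffAt.clm_bundle_apply₂ (E₃ := Bundle.Trivial M ℝ) (F₁ := Model n) (F₂ := Model n)
    (F₃ := ℝ) hg ((hsec i).contMDiffAt hmem) ((hsec j).contMDiffAt hmem)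
  rw [Bundle.contMDiffAt_totalSpace] at this
  exact contMDiffAt_iff_contDiffAt.1 this.2

theorem metricComp_symm (g : Metric n M) (i j : Fin n) :
    metricComp g e i j = metricComp g e j i :=
  funext fun _ => g.symm _ _ _

/-- A null vector of the Gram matrix would give a nonzero tangent vector of length zero. -/
theorem gram_posDef (g : Metric n M) (he : e ∈ maximalAtlas (𝓡 n) ∞ M) {x : M}
    (hx : x ∈ e.source) : IsUnit (gram g e x).det := by
  rw [isUnit_iff_ne_zero]
  intro h0
  obtain ⟨v, hv, hv0⟩ := Matrix.exists_mulVec_eq_zero_iff.2 h0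
  have hw : ∑ j, v j • frame e x j ≠ 0 := by
    intro h
    apply hv
    funext i
    have := congrArg (coord e x i) h
    simpa [coord_frame he hx] using this
  refine (g.pos x _ hw).ne' ?_
  have h1 : g.inner x (∑ j, v j • frame e x j) (∑ j, v j • frame e x j) =
      ∑ i, v i * (gram g e x).mulVec v i := by
    simp only [gram, Matrix.mulVec, dotProduct, Finset.mul_sum, map_sum, map_smul, sum_apply,
      smul_apply, smul_eq_mul, Matrix.of_apply]
    refine Finset.sum_congr rfl fun _ _ => Finset.sum_congr rfl fun _ _ => ?_
    rw [g.symm]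
    ring
  rw [h1, hv0]
  simp

theorem isMetricAt_metricComp (g : Metric n M) (he : e ∈ maximalAtlas (𝓡 n) ∞ M) {u : Model n}
    (hu : u ∈ e.target) : IsMetricAt (metricComp g e) u where
  contDiffAt := contDiffAt_metricComp g he hu
  symm := metricComp_symm g
  isUnit_det := gram_posDef g he (e.map_target hu)

theorem isPullbackAt_metricComp {φ : M → N} (hφ : ContMDiff (𝓡 n) (𝓡 n) ∞ φ) {gbar : Metric n M}
    {g : Metric n N} (hg : ∀ (x : M) (v w : TangentSpace (𝓡 n) x), gbar.inner x v w =
      g.inner (φ x) (mfderiv (𝓡 n) (𝓡 n) φ x v) (mfderiv (𝓡 n) (𝓡 n) φ x w))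
    (he : e ∈ maximalAtlas (𝓡 n) ∞ M) (he' : e' ∈ maximalAtlas (𝓡 n) ∞ N) {u : Model n}
    (hu : u ∈ localDomain φ e e') :
    IsPullbackAt (metricComp gbar e) (metricComp g e') (localMap φ e e') u := by
  intro i j
  filter_upwards [(isOpen_localDomain hφ.continuous).mem_nhds hu] with v hv
  have h1 : metricComp gbar e i j v = g.inner (φ (e.symm v))
      (mfderiv (𝓡 n) (𝓡 n) φ (e.symm v) (frame e (e.symm v) i))
      (mfderiv (𝓡 n) (𝓡 n) φ (e.symm v) (frame e (e.symm v) j)) := hg _ _ _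
  have h2 : e'.symm (localMap φ e e' v) = φ (e.symm v) := e'.left_inv hv.2
  have h3 : ∀ α β, metricComp g e' α β (localMap φ e e' v) =
      g.inner (φ (e.symm v)) (frame e' (φ (e.symm v)) α) (frame e' (φ (e.symm v)) β) := by
    intro α β
    unfold metricComp gram
    rw [h2]
    rfl
  rw [h1, mfderiv_apply_frame hφ he he' hv, mfderiv_apply_frame hφ he he' hv]
  simp only [h3, map_sum, map_smul, sum_apply, smul_apply, smul_eq_mul, Finset.mul_sum]
  rw [Finset.sum_comm]
  refine Finset.sum_congr rfl fun _ _ => Finset.sum_congr rfl fun _ _ => ?_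
  ring

/-- The transformation law of the Christoffel symbols under local isometries. -/
theorem christoffel_pullback {φ : M → N} (hφ : ContMDiff (𝓡 n) (𝓡 n) ∞ φ) {gbar : Metric n M}
    {g : Metric n N} (hg : ∀ (x : M) (v w : TangentSpace (𝓡 n) x), gbar.inner x v w =
      g.inner (φ x) (mfderiv (𝓡 n) (𝓡 n) φ x v) (mfderiv (𝓡 n) (𝓡 n) φ x w))
    (he : e ∈ maximalAtlas (𝓡 n) ∞ M) (he' : e' ∈ maximalAtlas (𝓡 n) ∞ N) {u : Model n}
    (hu : u ∈ localDomain φ e e') (i j k : Fin n) :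
    ∑ m, localChristoffel (metricComp gbar e) m i j u * pd m (fun v => localMap φ e e' v k) u =
      pd i (pd j fun v => localMap φ e e' v k) u + ∑ β, ∑ γ,
        localChristoffel (metricComp g e') k β γ (localMap φ e e' u) *
        pd i (fun v => localMap φ e e' v β) u * pd j (fun v => localMap φ e e' v γ) u :=
  localChristoffel_pullback (isMetricAt_metricComp gbar he hu.1)
    (isMetricAt_metricComp g he' (e'.map_source hu.2)) (contDiffAt_localMap hφ he he' hu)
    (isPullbackAt_metricComp hφ hg he he' hu) i j k

end Frames

/-! ### Components of tensors along maps -/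

theorem sum_cons {n p : ℕ} {A : Type*} [AddCommMonoid A] (f : (Fin (p + 1) → Fin n) → A) :
    ∑ J, f J = ∑ i, ∑ J : Fin p → Fin n, f (Fin.cons i J) := by
  rw [← (Fin.consEquiv fun _ => Fin n).sum_comp, Fintype.sum_prod_type]
  rfl

theorem multilinearMap_apply_sum {n p : ℕ} {V W : Type*} [AddCommGroup V] [Module ℝ V]
    [AddCommGroup W] [Module ℝ W] (f : MultilinearMap ℝ (fun _ : Fin p => V) W)
    (A : Fin p → Fin n → ℝ) (w : Fin n → V) :
    f (fun l => ∑ j, A l j • w j) = ∑ J : Fin p → Fin n, (∏ l, A l (J l)) • f fun l => w (J l) := by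
  rw [f.map_sum]
  exact Finset.sum_congr rfl fun J _ => f.map_smul_univ _ _

section Components

variable {n p : ℕ} {M M' N : Type*} [TopologicalSpace M] [ChartedSpace (Model n) M]
  [TopologicalSpace M'] [ChartedSpace (Model n) M'] [IsManifold (𝓡 n) ∞ M']
  [TopologicalSpace N] [ChartedSpace (Model n) N] [IsManifold (𝓡 n) ∞ M] [IsManifold (𝓡 n) ∞ N]
  {e : OpenPartialHomeomorph M (Model n)} {e₀ : OpenPartialHomeomorph M' (Model n)}
  {e' e'' : OpenPartialHomeomorph N (Model n)}

theorem comp_apply {φ : M → N} (F : TensorAlong (n := n) φ p) {x : M} (hx : x ∈ e.source)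
    (I : Fin p → Fin n) (α : Fin n) :
    comp F e e' I α (e x) = coord e' (φ x) α (F x fun l => frame e x (I l)) := by
  unfold comp
  rw [e.left_inv hx]

/-- Multilinear expansion of the pushed forward frame vectors. The case `ψ = id` is the change of
source chart and the case `ψ = φ` is the pullback. -/
theorem coord_apply_mfderiv_frame {ψ : M → M'} (hψ : ContMDiff (𝓡 n) (𝓡 n) ∞ ψ) {φ : M' → N}
    (F : TensorAlong (n := n) φ p) (he : e ∈ maximalAtlas (𝓡 n) ∞ M)
    (he₀ : e₀ ∈ maximalAtlas (𝓡 n) ∞ M') {u : Model n} (hu : u ∈ localDomain ψ e e₀)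
    (I : Fin p → Fin n) (α : Fin n) :
    coord e' (φ (ψ (e.symm u))) α (F (ψ (e.symm u)) fun l =>
      mfderiv (𝓡 n) (𝓡 n) ψ (e.symm u) (frame e (e.symm u) (I l))) =
    ∑ J, comp F e₀ e' J α (localMap ψ e e₀ u) *
      ∏ l, pd (I l) (fun w => localMap ψ e e₀ w (J l)) u := by
  simp only [mfderiv_apply_frame hψ he he₀ hu]
  rw [multilinearMap_apply_sum (F (ψ (e.symm u))), map_sum]
  refine Finset.sum_congr rfl fun J _ => ?_
  rw [map_smul, smul_eq_mul, mul_comm]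
  congr 1
  exact (comp_apply F hu.2 J α).symm

theorem comp_source_change {e₀ : OpenPartialHomeomorph M (Model n)} {φ : M → N}
    (F : TensorAlong (n := n) φ p) (he : e ∈ maximalAtlas (𝓡 n) ∞ M)
    (he₀ : e₀ ∈ maximalAtlas (𝓡 n) ∞ M) {u : Model n} (hu : u ∈ localDomain id e e₀)
    (I : Fin p → Fin n) (α : Fin n) :
    comp F e e' I α u = ∑ J, comp F e₀ e' J α (localMap id e e₀ u) *
      ∏ l, pd (I l) (fun w => localMap id e e₀ w (J l)) u := by
  rw [← coord_apply_mfderiv_frame contMDiff_id F he he₀ hu, mfderiv_id]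
  rfl

theorem comp_pullback {φ : M → N} (hφ : ContMDiff (𝓡 n) (𝓡 n) ∞ φ)
    (F : TensorAlong (n := n) (id : N → N) p) (he : e ∈ maximalAtlas (𝓡 n) ∞ M)
    (he'' : e'' ∈ maximalAtlas (𝓡 n) ∞ N) {u : Model n} (hu : u ∈ localDomain φ e e'')
    (I : Fin p → Fin n) (α : Fin n) :
    comp (pullback φ F) e e' I α u = ∑ J, comp F e'' e' J α (localMap φ e e'' u) *
      ∏ l, pd (I l) (fun w => localMap φ e e'' w (J l)) u := by
  rw [← coord_apply_mfderiv_frame hφ F he he'' hu]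
  rfl

theorem coord_change (he' : e' ∈ maximalAtlas (𝓡 n) ∞ N) (he'' : e'' ∈ maximalAtlas (𝓡 n) ∞ N)
    {y : N} (hy' : y ∈ e'.source) (hy'' : y ∈ e''.source) (w : TangentSpace (𝓡 n) y) (α : Fin n) :
    coord e' y α w = ∑ β, coord e'' y β w * pd β (fun v => localMap id e'' e' v α) (e'' y) := by
  conv_lhs => rw [← sum_coord_smul_frame he'' hy'' w]
  rw [map_sum]
  refine Finset.sum_congr rfl fun β _ => ?_
  rw [map_smul, smul_eq_mul]
  congr 1
  have h := frame_change he'' he' (u := e'' y) ⟨e''.map_source hy'', by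
    simpa [e''.left_inv hy''] using hy'⟩ β
  rw [e''.left_inv hy''] at h
  rw [h, map_sum]
  simp [coord_frame he' hy']

theorem comp_target_change {φ : M → N} (F : TensorAlong (n := n) φ p)
    (he' : e' ∈ maximalAtlas (𝓡 n) ∞ N) (he'' : e'' ∈ maximalAtlas (𝓡 n) ∞ N) {u : Model n}
    (hu' : u ∈ localDomain φ e e') (hu'' : u ∈ localDomain φ e e'') (I : Fin p → Fin n)
    (α : Fin n) :
    comp F e e' I α u = ∑ β, comp F e e'' I β u *
      pd β (fun w => localMap id e'' e' w α) (localMap φ e e'' u) :=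
  coord_change he' he'' hu'.2 hu''.2 _ α

theorem coord_ofComp {φ : M → N} (he : e ∈ maximalAtlas (𝓡 n) ∞ M)
    (he' : e' ∈ maximalAtlas (𝓡 n) ∞ N) {x : M} (hx : x ∈ e.source) (hx' : φ x ∈ e'.source)
    (c : (Fin p → Fin n) → Fin n → ℝ) (I : Fin p → Fin n) (α : Fin n) :
    coord e' (φ x) α (ofComp φ x e e' c fun l => frame e x (I l)) = c I α := by
  have hprod : ∀ J : Fin p → Fin n, (∏ l, if J l = I l then (1 : ℝ) else 0) =
      if J = I then 1 else 0 := by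
    intro J
    rw [Finset.prod_ite_zero]
    simp [funext_iff]
  simp only [ofComp, sum_apply, map_sum, smul_apply,
    MultilinearMap.smulRight_apply, MultilinearMap.compLinearMap_apply,
    MultilinearMap.mkPiAlgebra_apply, coord_frame he hx, map_smul, coord_frame he' hx', hprod]
  simp

theorem ext_of_comp_eq {φ : M → N} {F G : TensorAlong (n := n) φ p}
    (h : ∀ e ∈ maximalAtlas (𝓡 n) ∞ M, ∀ e' ∈ maximalAtlas (𝓡 n) ∞ N, ∀ u ∈ localDomain φ e e',
      ∀ I α, comp F e e' I α u = comp G e e' I α u) : F = G := by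
  funext x
  have he := chartAt_mem (n := n) x
  have he' := chartAt_mem (n := n) (φ x)
  have hx := mem_chart_source (Model n) x
  have hx' := mem_chart_source (Model n) (φ x)
  set e := chartAt (Model n) x
  set e' := chartAt (Model n) (φ x)
  refine MultilinearMap.ext fun v => ?_
  rw [show v = fun l => ∑ j, coord e x j (v l) • frame e x j from
    funext fun l => (sum_coord_smul_frame he hx (v l)).symm]
  rw [multilinearMap_apply_sum (F x) (fun l j => coord e x j (v l)),
    multilinearMap_apply_sum (G x) (fun l j => coord e x j (v l))]
  refine Finset.sum_congr rfl fun J _ => ?_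
  congr 1
  rw [← sum_coord_smul_frame he' hx' (F x _), ← sum_coord_smul_frame he' hx' (G x _)]
  refine Finset.sum_congr rfl fun α _ => ?_
  congr 1
  rw [← comp_apply F hx, ← comp_apply G hx]
  have hu : e x ∈ localDomain φ e e' := ⟨e.map_source hx, by simpa [e.left_inv hx] using hx'⟩
  exact h e he e' he' _ hu J α

/-- A tensor along a map is smooth if its components in all charts are. -/
def Smooth {φ : M → N} (F : TensorAlong (n := n) φ p) : Prop :=
  ∀ e ∈ maximalAtlas (𝓡 n) ∞ M, ∀ e' ∈ maximalAtlas (𝓡 n) ∞ N, ∀ u ∈ localDomain φ e e',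
    ∀ I α, ContDiffAt ℝ ∞ (comp F e e' I α) u

theorem covComp_eq_localCov (a : Metric n M) (b : Metric n N) {φ : M → N}
    (F : TensorAlong (n := n) φ p) (I : Fin (p + 1) → Fin n) (α : Fin n) (u : Model n) :
    covComp a b F e e' I α u =
      localCov (metricComp a e) (metricComp b e') (localMap φ e e') (comp F e e') I α u := by
  rfl

/-- The identity is an isometry, so the results on local isometries apply to transition maps. -/
theorem mfderiv_id_isometry (g : Metric n M) (x : M) (v w : TangentSpace (𝓡 n) x) :
    g.inner x v w = g.inner (id x) (mfderiv (𝓡 n) (𝓡 n) (id : M → M) x v)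
      (mfderiv (𝓡 n) (𝓡 n) (id : M → M) x w) := by
  rw [mfderiv_id]
  rfl

/-- The components of the map covariant derivative in arbitrary charts. -/
theorem comp_mapCov (a : Metric n M) (b : Metric n N) {φ : M → N}
    (hφ : ContMDiff (𝓡 n) (𝓡 n) ∞ φ) {F : TensorAlong (n := n) φ p} (hF : Smooth F)
    (he : e ∈ maximalAtlas (𝓡 n) ∞ M) (he' : e' ∈ maximalAtlas (𝓡 n) ∞ N) {u : Model n}
    (hu : u ∈ localDomain φ e e') (I : Fin (p + 1) → Fin n) (α : Fin n) :
    comp (mapCov a b F) e e' I α u =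
      localCov (metricComp a e) (metricComp b e') (localMap φ e e') (comp F e e') I α u := by
  set x := e.symm u with hxu
  have he₀ := chartAt_mem (n := n) x
  have he₀' := chartAt_mem (n := n) (φ x)
  have hx := mem_chart_source (Model n) x
  have hx' := mem_chart_source (Model n) (φ x)
  -- By definition the formula holds at this one point in the preferred charts. It is carried over
  -- to `e` and `e'` by changing first the source chart and then the target chart.
  have hdef : ∀ J β, comp (mapCov a b F) (chartAt (Model n) x) (chartAt (Model n) (φ x)) J β
      (chartAt (Model n) x x) = covComp a b F (chartAt (Model n) x) (chartAt (Model n) (φ x)) J β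
        (chartAt (Model n) x x) := by
    intro J β
    rw [comp_apply _ hx]
    exact coord_ofComp he₀ he₀' hx hx' _ J β
  set e₀ := chartAt (Model n) x
  set e₀' := chartAt (Model n) (φ x)
  have hu₀ : u ∈ localDomain id e e₀ := ⟨hu.1, hx⟩
  have hu₀' : u ∈ localDomain φ e e₀' := ⟨hu.1, hx'⟩
  have hτu : localMap id e e₀ u = e₀ x := rfl
  have hu₁ : e₀ x ∈ localDomain φ e₀ e₀' := ⟨e₀.map_source hx, by
    simpa [e₀.left_inv hx] using hx'⟩
  have hu₂ : localMap φ e e₀' u ∈ localDomain id e₀' e' := ⟨e₀'.map_source hx', by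
    change e₀'.symm (e₀' (φ x)) ∈ e'.source
    rw [e₀'.left_inv hx']
    exact hu.2⟩
  have hmem₀ := (isOpen_localDomain (e := e) (e' := e₀) continuous_id).mem_nhds hu₀
  have hmem₀' := (isOpen_localDomain (e := e) (e' := e₀') hφ.continuous).mem_nhds hu₀'
  have hmem := (isOpen_localDomain (e := e) (e' := e') hφ.continuous).mem_nhds hu
  -- Change of the source chart, with the transition map in the role of `τ`.
  have key : ∀ I β, localCov (metricComp a e) (metricComp b e₀') (localMap φ e e₀')
      (comp F e e₀') I β u = comp (mapCov a b F) e e₀' I β u := by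
    intro I β
    rw [comp_source_change _ he he₀ hu₀]
    simp only [hτu, hdef, covComp_eq_localCov]
    refine localCov_pullback (τ := localMap id e e₀) ?_ (fun I α => hF e₀ he₀ e₀' he₀' _ hu₁ I α)
      (contDiffAt_localMap contMDiff_id he he₀ hu₀) (contDiffAt_localMap hφ he₀ he₀' hu₁) ?_
      (fun i j k => christoffel_pullback contMDiff_id (mfderiv_id_isometry a) he he₀ hu₀ i j k) I β
    · intro I α
      filter_upwards [hmem₀] with v hv using comp_source_change F he he₀ hv I α
    · filter_upwards [hmem₀] with v hv
      exact congrArg (fun y => e₀' (φ y)) (e₀.left_inv hv.2).symm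
  rw [comp_target_change _ he' he₀' hu hu₀']
  simp only [← key]
  -- Change of the target chart, with the transition map in the role of `θ`.
  refine (localCov_target (θ := localMap id e₀' e') ?_ (fun I α => hF e he e₀' he₀' u hu₀' I α)
    (contDiffAt_localMap contMDiff_id he₀' he' hu₂) (contDiffAt_localMap hφ he he₀' hu₀') ?_
    (fun i j k => christoffel_pullback contMDiff_id (mfderiv_id_isometry b) he₀' he' hu₂ i j k)
    I α).symm
  · intro I α
    filter_upwards [hmem, hmem₀'] with v hv hv' using comp_target_change F he' he₀' hv hv' I α
  · filter_upwards [hmem₀'] with v hv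
    simp only [localMap, id_eq]
    rw [e₀'.left_inv hv.2]

theorem Smooth.mapCov {a : Metric n M} {b : Metric n N} {φ : M → N}
    (hφ : ContMDiff (𝓡 n) (𝓡 n) ∞ φ) {F : TensorAlong (n := n) φ p} (hF : Smooth F) :
    Smooth (mapCov a b F) := by
  intro e he e' he' u hu I α
  refine (contDiffAt_localCov (isMetricAt_metricComp a he hu.1)
    (isMetricAt_metricComp b he' (e'.map_source hu.2)) (contDiffAt_localMap hφ he he' hu)
    (hF e he e' he' u hu) I α).congr_of_eventuallyEq ?_
  filter_upwards [(isOpen_localDomain hφ.continuous).mem_nhds hu] with v hv using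
    comp_mapCov a b hφ hF he he' hv I α

theorem Smooth.neg {φ : M → N} {F : TensorAlong (n := n) φ p} (hF : Smooth F) : Smooth (-F) := by
  intro e he e' he' u hu I α
  refine (hF e he e' he' u hu I α).neg.congr_of_eventuallyEq (.of_forall fun v => ?_)
  exact map_neg (coord e' (φ (e.symm v)) α) _

theorem comp_neg {φ : M → N} (F : TensorAlong (n := n) φ p) :
    comp (-F) e e' = fun I α u => -comp F e e' I α u := by
  funext I α u
  exact map_neg (coord e' (φ (e.symm u)) α) _

theorem Smooth.pullback {φ : M → N} (hφ : ContMDiff (𝓡 n) (𝓡 n) ∞ φ)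
    {F : TensorAlong (n := n) (id : N → N) p} (hF : Smooth F) : Smooth (pullback φ F) := by
  intro e he e' he' u hu I α
  have hu' : localMap φ e e' u ∈ localDomain id e' e' := ⟨e'.map_source hu.2, by
    simpa [localMap, e'.left_inv hu.2] using hu.2⟩
  have hτ := contDiffAt_localMap hφ he he' hu
  refine ContDiffAt.congr_of_eventuallyEq (f := fun v => ∑ J, comp F e' e' J α (localMap φ e e' v) *
      ∏ l, pd (I l) (fun w => localMap φ e e' w (J l)) v) ?_ ?_
  · exact contDiffAt_sum fun J => ((hF e' he' e' he' _ hu' J α).comp u hτ).mul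
      (contDiffAt_prod fun l _ => contDiffAt_pd _ (contDiffAt_apply hτ _))
  · filter_upwards [(isOpen_localDomain hφ.continuous).mem_nhds hu] with v hv using
      comp_pullback hφ F he he' hv I α

/-- The map covariant derivative commutes with pullbacks under local isometries. -/
theorem pullback_mapCov {φ : M → N} (hφ : ContMDiff (𝓡 n) (𝓡 n) ∞ φ) {gbar : Metric n M}
    {g h : Metric n N} (hg : ∀ (x : M) (v w : TangentSpace (𝓡 n) x), gbar.inner x v w =
      g.inner (φ x) (mfderiv (𝓡 n) (𝓡 n) φ x v) (mfderiv (𝓡 n) (𝓡 n) φ x w))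
    {F : TensorAlong (n := n) (id : N → N) p} (hF : Smooth F) :
    pullback φ (mapCov g h F) = mapCov gbar h (pullback φ F) := by
  refine ext_of_comp_eq fun e he e' he' u hu I α => ?_
  have hu' : localMap φ e e' u ∈ localDomain id e' e' := ⟨e'.map_source hu.2, by
    simpa [localMap, e'.left_inv hu.2] using hu.2⟩
  have hmem := (isOpen_localDomain (e := e) (e' := e') hφ.continuous).mem_nhds hu
  rw [comp_pullback hφ _ he he' hu, comp_mapCov gbar h hφ (hF.pullback hφ) he he' hu]
  simp only [comp_mapCov g h contMDiff_id hF he' he' hu']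
  -- Now `τ` is the coordinate expression of `φ` itself, and the required transformation law holds
  -- because `φ` is a local isometry.
  refine (localCov_pullback (τ := localMap φ e e') ?_ (fun I α => hF e' he' e' he' _ hu' I α)
    (contDiffAt_localMap hφ he he' hu) (contDiffAt_localMap contMDiff_id he' he' hu') ?_
    (fun i j k => christoffel_pullback hφ hg he he' hu i j k) I α).symm
  · intro I α
    filter_upwards [hmem] with v hv using comp_pullback hφ F he he' hv I α
  · filter_upwards [hmem] with v hv
    simp only [localMap, id_eq]
    rw [e'.left_inv hv.2]

theorem comp_differential {φ : M → N} (hφ : ContMDiff (𝓡 n) (𝓡 n) ∞ φ)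
    (he : e ∈ maximalAtlas (𝓡 n) ∞ M) (he' : e' ∈ maximalAtlas (𝓡 n) ∞ N) {u : Model n}
    (hu : u ∈ localDomain φ e e') (I : Fin 1 → Fin n) (α : Fin n) :
    comp (differential φ) e e' I α u = localDifferential (localMap φ e e') I α u := by
  have : comp (differential φ) e e' I α u = coord e' (φ (e.symm u)) α
    (mfderiv (𝓡 n) (𝓡 n) φ (e.symm u) (frame e (e.symm u) (I 0))) := rfl
  rw [this, mfderiv_apply_frame hφ he he' hu, map_sum]
  simp [coord_frame he' hu.2, localDifferential]

theorem smooth_differential {φ : M → N} (hφ : ContMDiff (𝓡 n) (𝓡 n) ∞ φ) :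
    Smooth (differential (n := n) φ) := by
  intro e he e' he' u hu I α
  refine (contDiffAt_localDifferential (contDiffAt_localMap hφ he he' hu) I α).congr_of_eventuallyEq
    ?_
  filter_upwards [(isOpen_localDomain hφ.continuous).mem_nhds hu] with v hv using
    comp_differential hφ he he' hv I α

theorem pullback_differential_id (φ : M → N) :
    pullback (n := n) φ (differential id) = differential φ := by
  funext x
  refine MultilinearMap.ext fun v => ?_
  have : pullback (n := n) φ (differential id) x v =
    mfderiv (𝓡 n) (𝓡 n) (id : N → N) (φ x) (mfderiv (𝓡 n) (𝓡 n) φ x (v 0)) := rfl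
  rw [this, mfderiv_id]
  rfl

theorem pullback_neg (φ : M → N) (F : TensorAlong (n := n) (id : N → N) p) :
    pullback φ (-F) = -pullback φ F :=
  rfl

/-- The difference of the Levi-Civita connections is minus the Hessian of the identity. -/
theorem differenceTensor_eq (g h : Metric n N) :
    differenceTensor g h = -mapCov g h (differential id) := by
  have hc : ∀ y : N, ∀ I : Fin 2 → Fin n, ∀ γ, covComp g h (differential id) (chartAt (Model n) y)
      (chartAt (Model n) y) I γ (chartAt (Model n) y y) =
      -(christoffel g (chartAt (Model n) y) γ (I 0) (I 1) (chartAt (Model n) y y) -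
        christoffel h (chartAt (Model n) y) γ (I 0) (I 1) (chartAt (Model n) y y)) := by
    intro y I γ
    have he := chartAt_mem (n := n) y
    have hy := mem_chart_source (Model n) y
    set e := chartAt (Model n) y
    have hu : e y ∈ e.target := e.map_source hy
    have hid : ∀ v ∈ e.target, localMap id e e v = v := fun v hv => e.right_inv hv
    have hdom : ∀ v ∈ e.target, v ∈ localDomain (id : N → N) e e :=
      fun v hv => ⟨hv, e.map_target hv⟩
    have hpd : ∀ v ∈ e.target, ∀ i k, pd i (fun w => localMap id e e w k) v =
        if k = i then 1 else 0 := by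
      intro v hv i k
      rw [← pd_coord (u := v)]
      refine pd_congr i ?_
      filter_upwards [e.open_target.mem_nhds hv] with w hw
      rw [hid w hw]
    -- The differential of the identity has the constant components `δ`, so in its covariant
    -- derivative only the two Christoffel terms survive.
    have hcomp : ∀ J α, comp (differential (n := n) (id : N → N)) e e J α =ᶠ[𝓝 (e y)] fun _ =>
        (Pi.single (J 0) 1 : Fin n → ℝ) α := by
      intro J α
      filter_upwards [e.open_target.mem_nhds hu] with v hv
      rw [comp_differential contMDiff_id he he (hdom v hv), localDifferential, hpd v hv, Pi.single_apply]
    rw [covComp_eq_localCov, localCov_congr hcomp]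
    obtain ⟨i, j, rfl⟩ : ∃ i j, I = ![i, j] := ⟨I 0, I 1, by ext l; fin_cases l <;> rfl⟩
    rw [localCov_one_apply, pd_const]
    simp only [hpd _ hu, hid _ hu]
    simp only [Matrix.cons_val_zero, Matrix.cons_val_one, Pi.single_apply, ite_mul, one_mul,
      zero_mul, mul_ite, mul_one, mul_zero, Finset.sum_ite_eq, Finset.sum_ite_eq', Finset.mem_univ, if_true]
    -- The covariant derivative yields the symbol of `g` with its lower indices in the opposite
    -- order.
    rw [localChristoffel_symm (metricComp_symm g)]
    change 0 - christoffel g e γ i j (e y) + christoffel h e γ i j (e y) = _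
    ring
  funext y
  change ofComp id y _ _ _ = -ofComp id y _ _ _
  simp only [hc, id_eq]
  simp only [ofComp, neg_smul, Finset.sum_neg_distrib, neg_neg]

end Components

/-! ### Traces -/

section LocalTraces

variable {n : ℕ} {a a' : Fin n → Fin n → Model n → ℝ} {τ : Model n → Model n} {u : Model n}

/-- From `A' = J A Jᵀ` with `A'` invertible, `J` is invertible and `Jᵀ A'⁻¹ J = A⁻¹`. -/
theorem inv_pullback (ha' : IsMetricAt a' u) (hab : IsPullbackAt a' a τ u) (k l : Fin n) :
    ∑ i, ∑ j, (Matrix.of fun i j => a' i j u)⁻¹ i j * (pd i (fun w => τ w k) u *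
      pd j (fun w => τ w l) u) = (Matrix.of fun i j => a i j (τ u))⁻¹ k l := by
  set A' : Matrix (Fin n) (Fin n) ℝ := Matrix.of fun i j => a' i j u
  set A : Matrix (Fin n) (Fin n) ℝ := Matrix.of fun i j => a i j (τ u)
  set J : Matrix (Fin n) (Fin n) ℝ := Matrix.of fun i k => pd i (fun w => τ w k) u with hJ
  have hA : A' = J * A * J.transpose := by
    ext i j
    simp only [Matrix.mul_apply, Matrix.transpose_apply, Finset.sum_mul]
    rw [Finset.sum_comm]
    refine (hab i j).self_of_nhds.trans (Finset.sum_congr rfl fun α _ => Finset.sum_congr rfl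
      fun β _ => ?_)
    simp only [hJ, A, Matrix.of_apply]
    ring
  have hdet : IsUnit (J * A * J.transpose).det := hA ▸ ha'.isUnit_det
  have hJu : IsUnit J.det := by
    rw [Matrix.det_mul, Matrix.det_mul, IsUnit.mul_iff, IsUnit.mul_iff] at hdet
    exact hdet.1.1
  have hinv : J.transpose * A'⁻¹ * J = A⁻¹ := by
    rw [hA, Matrix.mul_inv_rev, Matrix.mul_inv_rev, ← mul_assoc, ← mul_assoc,
      Matrix.mul_nonsing_inv _ (by rwa [Matrix.det_transpose]), one_mul, mul_assoc,
      Matrix.nonsing_inv_mul _ hJu, mul_one]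
  have := congrFun (congrFun hinv k) l
  rw [← this]
  simp only [Matrix.mul_apply, Matrix.transpose_apply, Finset.sum_mul]
  rw [Finset.sum_comm]
  refine Finset.sum_congr rfl fun j _ => Finset.sum_congr rfl fun i _ => ?_
  simp only [hJ, Matrix.of_apply]
  ring

theorem localTrace_eq_sum (c : (Fin 2 → Fin n) → Fin n → Model n → ℝ) (I : Fin 0 → Fin n)
    (α : Fin n) : localTrace a c I α u =
      ∑ J : Fin 2 → Fin n, (Matrix.of fun i j => a i j u)⁻¹ (J 0) (J 1) * c J α u := by
  rw [sum_cons]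
  refine Finset.sum_congr rfl fun i _ => ?_
  rw [sum_cons]
  refine Finset.sum_congr rfl fun j _ => ?_
  rw [Fintype.sum_unique, Subsingleton.elim default I]
  rfl

/-- Written as a single sum over multi-indices, the trace can be compared term by term with the
expansion of a pulled back tensor. -/
theorem crossTrace_eq_sum (c : (Fin 4 → Fin n) → Fin n → Model n → ℝ) (I : Fin 0 → Fin n)
    (α : Fin n) : crossTrace a c I α u =
      ∑ J : Fin 4 → Fin n, ((Matrix.of fun i j => a i j u)⁻¹ (J 3) (J 0) *
        (Matrix.of fun i j => a i j u)⁻¹ (J 2) (J 1)) * c J α u := by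
  have h3 : ∀ G : Fin n → Fin n → Fin n → ℝ, ∑ l, ∑ ν, ∑ μ, G l ν μ = ∑ μ, ∑ ν, ∑ l, G l ν μ :=
    fun G => Finset.sum_comm.trans
      ((Finset.sum_congr rfl fun _ _ => Finset.sum_comm).trans Finset.sum_comm)
  have h : ∀ f : (Fin 4 → Fin n) → ℝ, ∑ J, f J = ∑ μ, ∑ k, ∑ ν, ∑ l, f ![k, l, ν, μ] := by
    intro f
    have h1 : ∑ J, f J = ∑ k, ∑ l, ∑ ν, ∑ μ, f ![k, l, ν, μ] := by
      rw [sum_cons]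
      refine Finset.sum_congr rfl fun k _ => ?_
      rw [sum_cons]
      refine Finset.sum_congr rfl fun l _ => ?_
      rw [sum_cons]
      refine Finset.sum_congr rfl fun ν _ => ?_
      rw [sum_cons]
      refine Finset.sum_congr rfl fun μ _ => ?_
      rw [Fintype.sum_unique, Subsingleton.elim default ![]]
      rfl
    exact h1.trans ((Finset.sum_congr rfl fun k _ => h3 _).trans Finset.sum_comm)
  rw [h]
  simp only [crossTrace, Matrix.cons_val]

theorem localTrace_pullback (ha' : IsMetricAt a' u) (hab : IsPullbackAt a' a τ u)
    {c c' : (Fin 2 → Fin n) → Fin n → Model n → ℝ} {α : Fin n}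
    (hc : ∀ I, c' I α u = ∑ J, c J α (τ u) * ∏ l, pd (I l) (fun w => τ w (J l)) u)
    (I : Fin 0 → Fin n) : localTrace a' c' I α u = localTrace a c I α (τ u) := by
  -- Moves the sum over multi-indices outward. The two summation variables have different types, so
  -- `swap` does not undo itself as a rewriting rule.
  have swap : ∀ f : Fin n → (Fin 2 → Fin n) → ℝ, ∑ i, ∑ J, f i J = ∑ J, ∑ i, f i J :=
    fun f => Finset.sum_comm
  rw [localTrace_eq_sum (a := a)]
  unfold localTrace
  simp only [hc, ← inv_pullback ha' hab, Finset.mul_sum, Finset.sum_mul, swap]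
  refine Finset.sum_congr rfl fun J _ => Finset.sum_congr rfl fun i _ =>
    Finset.sum_congr rfl fun j _ => ?_
  simp only [Fin.prod_univ_two, Fin.cons_zero, Fin.cons_one]
  ring

theorem crossTrace_pullback (ha' : IsMetricAt a' u) (hab : IsPullbackAt a' a τ u)
    {c c' : (Fin 4 → Fin n) → Fin n → Model n → ℝ} {α : Fin n}
    (hc : ∀ I, c' I α u = ∑ J, c J α (τ u) * ∏ l, pd (I l) (fun w => τ w (J l)) u)
    (I : Fin 0 → Fin n) : crossTrace a' c' I α u = crossTrace a c I α (τ u) := by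
  have swap : ∀ f : Fin n → (Fin 4 → Fin n) → ℝ, ∑ i, ∑ J, f i J = ∑ J, ∑ i, f i J :=
    fun f => Finset.sum_comm
  rw [crossTrace_eq_sum (a := a)]
  unfold crossTrace
  simp only [hc, Finset.mul_sum, swap]
  refine Finset.sum_congr rfl fun J _ => ?_
  rw [← inv_pullback ha' hab, ← inv_pullback ha' hab]
  simp only [Finset.sum_mul]
  simp only [Finset.mul_sum, Finset.sum_mul]
  refine Finset.sum_congr rfl fun μ _ => Finset.sum_congr rfl fun k _ =>
    Finset.sum_congr rfl fun ν _ => Finset.sum_congr rfl fun l _ => ?_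
  simp only [Fin.prod_univ_four, Matrix.cons_val]
  ring

end LocalTraces

section Traces

variable {n : ℕ} {M N : Type*} [TopologicalSpace M] [ChartedSpace (Model n) M]
  [TopologicalSpace N] [ChartedSpace (Model n) N] [IsManifold (𝓡 n) ∞ M] [IsManifold (𝓡 n) ∞ N]
  {e : OpenPartialHomeomorph M (Model n)} {e' : OpenPartialHomeomorph N (Model n)}

/-- The trace is defined in the preferred chart at each point; invariance under the transition map
gives the same formula in every chart. -/
theorem comp_trace (a : Metric n M) {φ : M → N} (F : TensorAlong (n := n) φ 2)
    (he : e ∈ maximalAtlas (𝓡 n) ∞ M) {u : Model n} (hu : u ∈ e.target) (I : Fin 0 → Fin n)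
    (α : Fin n) :
    comp (trace a F) e e' I α u = localTrace (metricComp a e) (comp F e e') I α u := by
  set x := e.symm u with hxu
  have he₀ := chartAt_mem (n := n) x
  have hx := mem_chart_source (Model n) x
  have hdef : comp (trace a F) e e' I α u = coord e' (φ x) α (∑ i, ∑ j,
      (gram a (chartAt (Model n) x) x)⁻¹ i j • F x ![frame (chartAt (Model n) x) x i,
        frame (chartAt (Model n) x) x j]) := rfl
  set e₀ := chartAt (Model n) x
  have hu₀ : u ∈ localDomain id e e₀ := ⟨hu, hx⟩
  have hx' : localMap id e e₀ u = e₀ x := rfl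
  rw [localTrace_pullback (isMetricAt_metricComp a he hu) (isPullbackAt_metricComp contMDiff_id
    (mfderiv_id_isometry a) he he₀ hu₀) (fun I => comp_source_change F he he₀ hu₀ I α), hdef]
  simp only [map_sum, map_smul, smul_eq_mul, localTrace, hx', comp_apply F hx]
  refine Finset.sum_congr rfl fun i _ => Finset.sum_congr rfl fun j _ => ?_
  congr 1
  · simp only [metricComp, e₀.left_inv hx]
    rfl
  · congr 2
    ext l
    fin_cases l <;> rfl

theorem Smooth.trace {a : Metric n M} {φ : M → N} {F : TensorAlong (n := n) φ 2}
    (hφ : ContMDiff (𝓡 n) (𝓡 n) ∞ φ) (hF : Smooth F) : Smooth (trace a F) := by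
  intro e he e' he' u hu I α
  refine (contDiffAt_localTrace (isMetricAt_metricComp a he hu.1) (hF e he e' he' u hu) I
    α).congr_of_eventuallyEq ?_
  filter_upwards [(isOpen_localDomain hφ.continuous).mem_nhds hu] with v hv using
    comp_trace a F he hv.1 I α

theorem pullback_trace {φ : M → N} (hφ : ContMDiff (𝓡 n) (𝓡 n) ∞ φ) {gbar : Metric n M}
    {g : Metric n N} (hg : ∀ (x : M) (v w : TangentSpace (𝓡 n) x), gbar.inner x v w =
      g.inner (φ x) (mfderiv (𝓡 n) (𝓡 n) φ x v) (mfderiv (𝓡 n) (𝓡 n) φ x w))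
    (F : TensorAlong (n := n) (id : N → N) 2) :
    pullback φ (trace g F) = trace gbar (pullback φ F) := by
  refine ext_of_comp_eq fun e he e' he' u hu I α => ?_
  rw [comp_pullback hφ _ he he' hu, comp_trace _ _ he hu.1, localTrace_pullback
    (isMetricAt_metricComp gbar he hu.1) (isPullbackAt_metricComp hφ hg he he' hu)
    fun I => comp_pullback hφ F he he' hu I α]
  simp only [Finset.univ_unique, Finset.sum_singleton, Finset.univ_eq_empty, Finset.prod_empty,
    mul_one, Subsingleton.elim default I]
  exact comp_trace g F he' (e'.map_source hu.2) I α

theorem comp_fieldZ (g h : Metric n N) {e e' : OpenPartialHomeomorph N (Model n)}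
    (he : e ∈ maximalAtlas (𝓡 n) ∞ N) {u : Model n} (hu : u ∈ e.target) (I : Fin 0 → Fin n)
    (α : Fin n) :
    comp (fieldZ g h) e e' I α u = crossTrace (metricComp g e) (comp (mapCov g h (mapCov g h
      (differenceTensor g h))) e e') I α u := by
  set y := e.symm u with hyu
  have he₀ := chartAt_mem (n := n) y
  have hy := mem_chart_source (Model n) y
  have hdef : comp (fieldZ g h) e e' I α u = coord e' y α (∑ μ, ∑ α, ∑ ν, ∑ β,
      ((gram g (chartAt (Model n) y) y)⁻¹ μ α * (gram g (chartAt (Model n) y) y)⁻¹ ν β) •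
      mapCov g h (mapCov g h (differenceTensor g h)) y ![frame (chartAt (Model n) y) y α,
        frame (chartAt (Model n) y) y β, frame (chartAt (Model n) y) y ν,
        frame (chartAt (Model n) y) y μ]) := rfl
  set e₀ := chartAt (Model n) y
  have hu₀ : u ∈ localDomain id e e₀ := ⟨hu, hy⟩
  have hx' : localMap id e e₀ u = e₀ y := rfl
  rw [crossTrace_pullback (isMetricAt_metricComp g he hu) (isPullbackAt_metricComp contMDiff_id
    (mfderiv_id_isometry g) he he₀ hu₀) (fun I => comp_source_change _ he he₀ hu₀ I α), hdef]
  simp only [map_sum, map_smul, smul_eq_mul, crossTrace, hx', comp_apply _ hy]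
  refine Finset.sum_congr rfl fun i _ => Finset.sum_congr rfl fun j _ =>
    Finset.sum_congr rfl fun k _ => Finset.sum_congr rfl fun l _ => ?_
  congr 1
  · simp only [metricComp, e₀.left_inv hy]
    rfl
  · refine congrArg (coord e' y α) (congrArg _ ?_)
    ext l
    fin_cases l <;> rfl

/-- The components of the pullback of `Z` in arbitrary charts. -/
theorem comp_pullback_fieldZ {φ : M → N} (hφ : ContMDiff (𝓡 n) (𝓡 n) ∞ φ) {gbar : Metric n M}
    {g h : Metric n N} (hg : ∀ (x : M) (v w : TangentSpace (𝓡 n) x), gbar.inner x v w =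
      g.inner (φ x) (mfderiv (𝓡 n) (𝓡 n) φ x v) (mfderiv (𝓡 n) (𝓡 n) φ x w))
    (he : e ∈ maximalAtlas (𝓡 n) ∞ M) (he' : e' ∈ maximalAtlas (𝓡 n) ∞ N) {u : Model n}
    (hu : u ∈ localDomain φ e e') (I : Fin 0 → Fin n) (α : Fin n) :
    comp (pullback φ (fieldZ g h)) e e' I α u =
      crossTrace (metricComp gbar e) (comp (pullback φ (mapCov g h (mapCov g h
        (differenceTensor g h)))) e e') I α u := by
  rw [comp_pullback hφ _ he he' hu, crossTrace_pullback (isMetricAt_metricComp gbar he hu.1)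
    (isPullbackAt_metricComp hφ hg he he' hu) fun I => comp_pullback hφ _ he he' hu I α]
  simp only [Finset.univ_unique, Finset.sum_singleton, Finset.univ_eq_empty, Finset.prod_empty,
    mul_one, Subsingleton.elim default I]
  exact comp_fieldZ g h he' (e'.map_source hu.2) I α

/-! ### Powers of the map Laplacian -/

variable {a gbar : Metric n M} {b : Metric n N} {g h : Metric n N} {φ : M → N}

theorem Smooth.mapLaplacian (hφ : ContMDiff (𝓡 n) (𝓡 n) ∞ φ) {X : TensorAlong (n := n) φ 0}
    (hX : Smooth X) : Smooth (mapLaplacian a b X) :=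
  ((hX.mapCov hφ).mapCov hφ).trace hφ

theorem Smooth.iterate_mapLaplacian (hφ : ContMDiff (𝓡 n) (𝓡 n) ∞ φ)
    {X : TensorAlong (n := n) φ 0} (hX : Smooth X) (j : ℕ) :
    Smooth ((MapCov.mapLaplacian a b)^[j] X) := by
  induction j with
  | zero => exact hX
  | succ j ih => rw [Function.iterate_succ_apply']; exact ih.mapLaplacian hφ

theorem pullback_iterate_mapLaplacian (hφ : ContMDiff (𝓡 n) (𝓡 n) ∞ φ)
    (hg : ∀ (x : M) (v w : TangentSpace (𝓡 n) x), gbar.inner x v w =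
      g.inner (φ x) (mfderiv (𝓡 n) (𝓡 n) φ x v) (mfderiv (𝓡 n) (𝓡 n) φ x w))
    {X : TensorAlong (n := n) (id : N → N) 0} (hX : Smooth X) (j : ℕ) :
    pullback φ ((mapLaplacian g h)^[j] X) = (mapLaplacian gbar h)^[j] (pullback φ X) := by
  induction j with
  | zero => rfl
  | succ j ih =>
    have hj := hX.iterate_mapLaplacian (a := g) (b := h) contMDiff_id j
    rw [Function.iterate_succ_apply', Function.iterate_succ_apply', ← ih]
    generalize (mapLaplacian g h)^[j] X = Y at hj
    unfold mapLaplacian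
    rw [pullback_trace hφ hg, pullback_mapCov hφ hg (hj.mapCov contMDiff_id),
      pullback_mapCov hφ hg hj]

theorem trace_neg (a : Metric n M) (F : TensorAlong (n := n) φ 2) : trace a (-F) = -trace a F := by
  refine ext_of_comp_eq fun e he e' he' u hu I α => ?_
  simp only [comp_neg, comp_trace a _ he hu.1, localTrace, mul_neg, Finset.sum_neg_distrib]

theorem mapCov_neg {p : ℕ} (hφ : ContMDiff (𝓡 n) (𝓡 n) ∞ φ) (a : Metric n M) (b : Metric n N)
    {F : TensorAlong (n := n) φ p} (hF : Smooth F) : mapCov a b (-F) = -mapCov a b F := by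
  refine ext_of_comp_eq fun e he e' he' u hu I α => ?_
  rw [comp_mapCov a b hφ hF.neg he he' hu]
  simp only [comp_neg, comp_mapCov a b hφ hF he he' hu]
  exact localCov_neg _ I α

theorem iterate_mapLaplacian_neg (hφ : ContMDiff (𝓡 n) (𝓡 n) ∞ φ) {X : TensorAlong (n := n) φ 0}
    (hX : Smooth X) (j : ℕ) : (mapLaplacian a b)^[j] (-X) = -(mapLaplacian a b)^[j] X := by
  induction j with
  | zero => rfl
  | succ j ih =>
    have hj := hX.iterate_mapLaplacian (a := a) (b := b) hφ j
    rw [Function.iterate_succ_apply', Function.iterate_succ_apply', ih]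
    generalize (mapLaplacian a b)^[j] X = Y at hj
    unfold mapLaplacian
    rw [mapCov_neg hφ a b hj, mapCov_neg hφ a b (hj.mapCov hφ), trace_neg]

/-- The definition uses a chart that varies with the point; smoothness follows from the description
as minus the Hessian of the identity. -/
theorem smooth_differenceTensor (g h : Metric n N) : Smooth (differenceTensor g h) := by
  rw [differenceTensor_eq]
  exact ((smooth_differential contMDiff_id).mapCov contMDiff_id).neg

theorem smooth_fieldZ (g h : Metric n N) : Smooth (fieldZ g h) := by
  intro e he e' he' u hu I α
  have ha := isMetricAt_metricComp g he hu.1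
  have hc := ((smooth_differenceTensor g h).mapCov (a := g) (b := h) contMDiff_id).mapCov
    (a := g) (b := h) contMDiff_id e he e' he' u hu
  refine ContDiffAt.congr_of_eventuallyEq (f := crossTrace (metricComp g e) (comp (mapCov g h
    (mapCov g h (differenceTensor g h))) e e') I α) ?_ ?_
  · exact contDiffAt_sum fun _ => contDiffAt_sum fun _ => contDiffAt_sum fun _ =>
      contDiffAt_sum fun _ => ((contDiffAt_inv ha _ _).mul (contDiffAt_inv ha _ _)).mul (hc _ α)
  · filter_upwards [e.open_target.mem_nhds hu.1] with v hv using comp_fieldZ g h he hv I α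

theorem pullback_differenceTensor (hφ : ContMDiff (𝓡 n) (𝓡 n) ∞ φ)
    (hg : ∀ (x : M) (v w : TangentSpace (𝓡 n) x), gbar.inner x v w =
      g.inner (φ x) (mfderiv (𝓡 n) (𝓡 n) φ x v) (mfderiv (𝓡 n) (𝓡 n) φ x w)) :
    pullback φ (differenceTensor g h) = -mapCov gbar h (differential φ) := by
  rw [differenceTensor_eq, pullback_neg, pullback_mapCov hφ hg (smooth_differential contMDiff_id),
    pullback_differential_id]

/-- `V` is the trace of `A`, so naturality of traces and Laplacians reduces the claim to the
pullback of `A`; the sign passes through by linearity. -/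
theorem pullback_iterate_fieldV (hφ : ContMDiff (𝓡 n) (𝓡 n) ∞ φ)
    (hg : ∀ (x : M) (v w : TangentSpace (𝓡 n) x), gbar.inner x v w =
      g.inner (φ x) (mfderiv (𝓡 n) (𝓡 n) φ x v) (mfderiv (𝓡 n) (𝓡 n) φ x w)) (k : ℕ) :
    pullback φ ((mapLaplacian g h)^[k] (fieldV g h)) = -mapLaplacianPowSucc gbar h φ k := by
  rw [fieldV, pullback_iterate_mapLaplacian hφ hg
    ((smooth_differenceTensor g h).trace contMDiff_id), pullback_trace hφ hg, pullback_differenceTensor hφ hg, trace_neg,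
    iterate_mapLaplacian_neg hφ (((smooth_differential hφ).mapCov hφ).trace hφ)]
  rfl

end Traces

/-! ### Powers of the local Laplacian -/

section LocalLaplacian

variable {n : ℕ} (X : LocalData n) {c c' : (Fin 0 → Fin n) → Fin n → Model n → ℝ}

theorem contDiffAt_localLaplacian (hc : ∀ u ∈ X.U, ∀ I α, ContDiffAt ℝ ∞ (c I α) u) :
    ∀ u ∈ X.U, ∀ I α, ContDiffAt ℝ ∞ (localLaplacian X c I α) u := fun u hu =>
  contDiffAt_localTrace (X.metric_a u hu) (contDiffAt_localCov (X.metric_a u hu) (X.metric_b u hu)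
    (X.contDiffAt u hu) (contDiffAt_localCov (X.metric_a u hu) (X.metric_b u hu)
    (X.contDiffAt u hu) (hc u hu)))

theorem contDiffAt_iterate_localLaplacian (hc : ∀ u ∈ X.U, ∀ I α, ContDiffAt ℝ ∞ (c I α) u)
    (j : ℕ) : ∀ u ∈ X.U, ∀ I α, ContDiffAt ℝ ∞ ((localLaplacian X)^[j] c I α) u := by
  induction j with
  | zero => exact hc
  | succ j ih =>
    rw [Function.iterate_succ_apply']
    exact contDiffAt_localLaplacian X ih

theorem localLaplacian_congr (h : ∀ u ∈ X.U, ∀ I α, c I α u = c' I α u) :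
    ∀ u ∈ X.U, ∀ I α, localLaplacian X c I α u = localLaplacian X c' I α u := fun u hu I α =>
  (localTrace_congr (eventually_localCov_congr (eventually_localCov_congr fun I α => by
    filter_upwards [X.isOpen.mem_nhds hu] with v hv using h v hv I α)) I α).self_of_nhds

theorem iterate_localLaplacian_congr (h : ∀ u ∈ X.U, ∀ I α, c I α u = c' I α u) (j : ℕ) :
    ∀ u ∈ X.U, ∀ I α, (localLaplacian X)^[j] c I α u = (localLaplacian X)^[j] c' I α u := by
  induction j with
  | zero => exact h
  | succ j ih =>
    rw [Function.iterate_succ_apply', Function.iterate_succ_apply']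
    exact localLaplacian_congr X ih

theorem localLaplacian_sub (hc : ∀ u ∈ X.U, ∀ I α, ContDiffAt ℝ ∞ (c I α) u)
    (hc' : ∀ u ∈ X.U, ∀ I α, ContDiffAt ℝ ∞ (c' I α) u) :
    ∀ u ∈ X.U, ∀ I α, localLaplacian X (fun I α v => c I α v - c' I α v) I α u =
      localLaplacian X c I α u - localLaplacian X c' I α u := by
  intro u hu I α
  have hcov : ∀ {c : (Fin 0 → Fin n) → Fin n → Model n → ℝ},
      (∀ u ∈ X.U, ∀ I α, ContDiffAt ℝ ∞ (c I α) u) → ∀ I α,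
      ContDiffAt ℝ ∞ (localCov X.a X.b X.Φ c I α) u := fun hc =>
    contDiffAt_localCov (X.metric_a u hu) (X.metric_b u hu) (X.contDiffAt u hu) (hc u hu)
  have h1 : ∀ I α, localCov X.a X.b X.Φ (fun I α v => c I α v - c' I α v) I α =ᶠ[𝓝 u]
      fun v => localCov X.a X.b X.Φ c I α v - localCov X.a X.b X.Φ c' I α v := fun I α => by
    filter_upwards [X.isOpen.mem_nhds hu] with v hv using localCov_sub (hc v hv) (hc' v hv) I α
  have h2 : ∀ I α, localCov X.a X.b X.Φ (localCov X.a X.b X.Φ fun I α v => c I α v - c' I α v)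
      I α u = localCov X.a X.b X.Φ (localCov X.a X.b X.Φ c) I α u -
        localCov X.a X.b X.Φ (localCov X.a X.b X.Φ c') I α u := fun I α => by
    rw [localCov_congr h1, localCov_sub (hcov hc) (hcov hc')]
  simp only [localLaplacian, localTrace, h2, mul_sub, Finset.sum_sub_distrib]

theorem iterate_localLaplacian_sub (hc : ∀ u ∈ X.U, ∀ I α, ContDiffAt ℝ ∞ (c I α) u)
    (hc' : ∀ u ∈ X.U, ∀ I α, ContDiffAt ℝ ∞ (c' I α) u) (j : ℕ) :
    ∀ u ∈ X.U, ∀ I α, (localLaplacian X)^[j] (fun I α v => c I α v - c' I α v) I α u =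
      (localLaplacian X)^[j] c I α u - (localLaplacian X)^[j] c' I α u := by
  induction j with
  | zero => exact fun _ _ _ _ => rfl
  | succ j ih =>
    intro u hu I α
    simp only [Function.iterate_succ_apply']
    rw [localLaplacian_congr X ih u hu, localLaplacian_sub X
      (contDiffAt_iterate_localLaplacian X hc j) (contDiffAt_iterate_localLaplacian X hc' j) u hu]

end LocalLaplacian

/-! ### The third identity in a pair of charts -/

section ChartData

variable {n : ℕ} {M N : Type*} [TopologicalSpace M] [ChartedSpace (Model n) M]
  [TopologicalSpace N] [ChartedSpace (Model n) N] [IsManifold (𝓡 n) ∞ M] [IsManifold (𝓡 n) ∞ N]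
  {e : OpenPartialHomeomorph M (Model n)} {e' : OpenPartialHomeomorph N (Model n)} {φ : M → N}

/-- The local data of a map between Riemannian manifolds in a pair of charts. -/
def chartData (a : Metric n M) (b : Metric n N) (hφ : ContMDiff (𝓡 n) (𝓡 n) ∞ φ)
    (he : e ∈ maximalAtlas (𝓡 n) ∞ M) (he' : e' ∈ maximalAtlas (𝓡 n) ∞ N) : LocalData n where
  a := metricComp a e
  b := metricComp b e'
  Φ := localMap φ e e'
  U := localDomain φ e e'
  isOpen := isOpen_localDomain hφ.continuous
  metric_a _ hu := isMetricAt_metricComp a he hu.1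
  metric_b _ hu := isMetricAt_metricComp b he' (e'.map_source hu.2)
  contDiffAt _ hu := contDiffAt_localMap hφ he he' hu

theorem coord_eq_comp (F : TensorAlong (n := n) φ 0) {x : M} (hx : x ∈ e.source) (γ : Fin n) :
    coord e' (φ x) γ (F x ![]) = comp F e e' ![] γ (e x) := by
  rw [comp_apply F hx]
  exact congrArg (fun v => coord e' (φ x) γ (F x v)) (Subsingleton.elim _ _)

theorem mapLaplacianPowSucc_succ (a : Metric n M) (b : Metric n N) (j : ℕ) :
    mapLaplacianPowSucc a b φ (j + 1) = (mapLaplacian a b)^[j]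
      (mapLaplacian a b (trace a (mapCov a b (differential φ)))) :=
  Function.iterate_succ_apply _ _ _

theorem comp_mapCov_mapCov (a : Metric n M) (b : Metric n N)
    (hφ : ContMDiff (𝓡 n) (𝓡 n) ∞ φ) (he : e ∈ maximalAtlas (𝓡 n) ∞ M)
    (he' : e' ∈ maximalAtlas (𝓡 n) ∞ N) {p : ℕ} {F : TensorAlong (n := n) φ p} (hF : Smooth F) {u : Model n}
    (hu : u ∈ localDomain φ e e') (I : Fin (p + 2) → Fin n) (α : Fin n) :
    comp (mapCov a b (mapCov a b F)) e e' I α u = localCov (metricComp a e) (metricComp b e')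
      (localMap φ e e') (localCov (metricComp a e) (metricComp b e') (localMap φ e e')
        (comp F e e')) I α u := by
  rw [comp_mapCov a b hφ (hF.mapCov hφ) he he' hu]
  refine localCov_congr (fun I α => ?_) I α
  filter_upwards [(isOpen_localDomain hφ.continuous).mem_nhds hu] with v hv using
    comp_mapCov a b hφ hF he he' hv I α

variable (a : Metric n M) (b : Metric n N) (hφ : ContMDiff (𝓡 n) (𝓡 n) ∞ φ)
  (he : e ∈ maximalAtlas (𝓡 n) ∞ M) (he' : e' ∈ maximalAtlas (𝓡 n) ∞ N)

theorem comp_mapLaplacian {F : TensorAlong (n := n) φ 0} (hF : Smooth F) {u : Model n}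
    (hu : u ∈ localDomain φ e e') (I : Fin 0 → Fin n) (α : Fin n) :
    comp (mapLaplacian a b F) e e' I α u =
      localLaplacian (chartData a b hφ he he') (comp F e e') I α u := by
  unfold mapLaplacian localLaplacian
  rw [comp_trace _ _ he hu.1]
  simp only [localTrace, comp_mapCov_mapCov a b hφ he he' hF hu, chartData]

theorem comp_iterate_mapLaplacian {F : TensorAlong (n := n) φ 0} (hF : Smooth F) (j : ℕ) :
    ∀ u ∈ localDomain φ e e', ∀ I α, comp ((mapLaplacian a b)^[j] F) e e' I α u =
      (localLaplacian (chartData a b hφ he he'))^[j] (comp F e e') I α u := by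
  induction j with
  | zero => exact fun _ _ _ _ => rfl
  | succ j ih =>
    intro u hu I α
    rw [Function.iterate_succ_apply', Function.iterate_succ_apply',
      comp_mapLaplacian a b hφ he he' (hF.iterate_mapLaplacian hφ j) hu]
    exact localLaplacian_congr (chartData a b hφ he he') ih u hu I α

theorem eval_toLabelled {L G : ℕ} (f : Factor L G) {x : M} (hx : x ∈ e.source)
    (hx' : φ x ∈ e'.source) (ρ : Fin L → Fin n)
    (σ : Fin (G + 1) → Fin n) :
    f.toLabelled.eval (chartData a b hφ he he') (e x) ρ σ = f.eval a b φ e e' x ρ σ := by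
  have hΦ : localMap φ e e' (e x) = e' (φ x) := by rw [localMap, e.left_inv hx]
  cases f
  · rfl
  · simp only [Factor.toLabelled, LFactor.eval, Factor.eval, chartData, metricComp, e.left_inv hx]
    rfl
  · simp only [Factor.toLabelled, LFactor.eval, Factor.eval, chartData, hΦ]
  · simp only [Factor.toLabelled, LFactor.eval, Factor.eval, chartData, hΦ, metricComp,
      e'.left_inv hx']
    rfl
  · rfl

theorem LowerOrder.eval_eq {p q r : ℕ} (P : LowerOrder p q r) {x : M} (hx : x ∈ e.source)
    (hx' : φ x ∈ e'.source) (γ : Fin n) : P.eval a b φ e e' γ x =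
      (P.1.map fun m => m.localEval (chartData a b hφ he he') γ (e x)).sum := by
  simp only [LowerOrder.eval, Monomial.eval, Monomial.localEval,
    eval_toLabelled a b hφ he he' _ hx hx']

variable {gbar : Metric n M} {g h : Metric n N}

/-- The second power of the Laplacian of a local isometry and the pullback of `Z` differ by a
curvature expression. -/
theorem comp_mapLaplacian_add_pullback_fieldZ
    (hg : ∀ (x : M) (v w : TangentSpace (𝓡 n) x), gbar.inner x v w =
      g.inner (φ x) (mfderiv (𝓡 n) (𝓡 n) φ x v) (mfderiv (𝓡 n) (𝓡 n) φ x w))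
    {u : Model n} (hu : u ∈ localDomain φ e e')
    (I : Fin 0 → Fin n) (α : Fin n) :
    comp (mapLaplacian gbar h (trace gbar (mapCov gbar h (differential φ)))) e e' I α u -
      comp (-pullback φ (fieldZ g h)) e e' I α u =
    crossTrace (metricComp gbar e) (localCov (metricComp gbar e) (metricComp h e')
      (localMap φ e e') (commutator (chartData gbar h hφ he he'))) I α u := by
  have hd := smooth_differential (n := n) hφ
  have hnhds : ∀ {v}, v ∈ localDomain φ e e' → localDomain φ e e' ∈ 𝓝 v := fun hv =>
    (isOpen_localDomain hφ.continuous).mem_nhds hv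
  have hdloc : ∀ v ∈ localDomain φ e e', ∀ I α, comp (differential φ) e e' I α =ᶠ[𝓝 v]
      localDifferential (localMap φ e e') I α := fun v hv I α => by
    filter_upwards [hnhds hv] with w hw using comp_differential hφ he he' hw I α
  have h1 : ∀ v ∈ localDomain φ e e', ∀ I α, comp (mapCov gbar h (differential φ)) e e' I α v =
      localCov (metricComp gbar e) (metricComp h e') (localMap φ e e')
        (localDifferential (localMap φ e e')) I α v := fun v hv I α => by
    rw [comp_mapCov gbar h hφ hd he he' hv, localCov_congr (hdloc v hv)]
  have hL : comp (mapLaplacian gbar h (trace gbar (mapCov gbar h (differential φ)))) e e' I α u =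
      localLaplacian (chartData gbar h hφ he he') (localTrace (metricComp gbar e)
        (localCov (metricComp gbar e) (metricComp h e') (localMap φ e e')
          (localDifferential (localMap φ e e')))) I α u := by
    rw [comp_mapLaplacian gbar h hφ he he' ((hd.mapCov hφ).trace hφ) hu]
    refine localLaplacian_congr _ (fun v hv I α => ?_) u hu I α
    rw [comp_trace _ _ he hv.1]
    simp only [localTrace, h1 v hv]
  -- By naturality `∇∇A` pulls back to minus the third covariant derivative of `dφ`; the two signs
  -- cancel.
  have hZ : comp (-pullback φ (fieldZ g h)) e e' I α u =
      crossTrace (metricComp gbar e) (localCov (metricComp gbar e) (metricComp h e')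
        (localMap φ e e') (localCov (metricComp gbar e) (metricComp h e') (localMap φ e e')
        (localCov (metricComp gbar e) (metricComp h e') (localMap φ e e')
          (localDifferential (localMap φ e e'))))) I α u := by
    have hA := smooth_differenceTensor g h
    have h2 : ∀ I α, comp (mapCov gbar h (mapCov gbar h (mapCov gbar h (differential φ)))) e e'
        I α u = localCov (metricComp gbar e) (metricComp h e')
        (localMap φ e e') (localCov (metricComp gbar e) (metricComp h e') (localMap φ e e')
        (localCov (metricComp gbar e) (metricComp h e') (localMap φ e e')
          (localDifferential (localMap φ e e')))) I α u := fun I α => by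
      rw [comp_mapCov_mapCov gbar h hφ he he' (hd.mapCov hφ) hu]
      refine localCov_congr (eventually_localCov_congr fun I α => ?_) I α
      filter_upwards [hnhds hu] with w hw using h1 w hw I α
    rw [comp_neg]
    simp only [comp_pullback_fieldZ hφ hg he he' hu]
    rw [pullback_mapCov hφ hg (hA.mapCov contMDiff_id), pullback_mapCov hφ hg hA,
      pullback_differenceTensor hφ hg, mapCov_neg hφ _ _ (hd.mapCov hφ),
      mapCov_neg hφ _ _ ((hd.mapCov hφ).mapCov hφ), comp_neg]
    simp only [crossTrace, h2, mul_neg, Finset.sum_neg_distrib, neg_neg]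
  rw [hL, hZ]
  exact localLaplacian_localTrace_sub (chartData gbar h hφ he he') hu I α

/-- Applies the remaining Laplacians to the case of `Z` itself. They are linear on smooth fields and
depend only on values in the open chart domain, so the error term becomes the iterated local
Laplacian of the curvature expression. -/
theorem coord_pullback_iterate_fieldZ
    (hg : ∀ (x : M) (v w : TangentSpace (𝓡 n) x), gbar.inner x v w =
      g.inner (φ x) (mfderiv (𝓡 n) (𝓡 n) φ x v) (mfderiv (𝓡 n) (𝓡 n) φ x w))
    (j : ℕ) {x : M} (hx : x ∈ e.source) (hx' : φ x ∈ e'.source)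
    (γ : Fin n) :
    coord e' (φ x) γ (pullback φ ((mapLaplacian g h)^[j] (fieldZ g h)) x ![]) =
      -coord e' (φ x) γ (mapLaplacianPowSucc gbar h φ (j + 1) x ![]) +
      (localLaplacian (chartData gbar h hφ he he'))^[j] (crossTrace (metricComp gbar e)
        (localCov (metricComp gbar e) (metricComp h e') (localMap φ e e')
          (commutator (chartData gbar h hφ he he')))) ![] γ (e x) := by
  have hu : e x ∈ localDomain φ e e' := ⟨e.map_source hx, by
    simpa [e.left_inv hx] using hx'⟩
  have hW : Smooth (trace gbar (mapCov gbar h (differential φ))) :=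
    ((smooth_differential hφ).mapCov hφ).trace hφ
  have hZ : Smooth (pullback φ (fieldZ g h)) := (smooth_fieldZ g h).pullback hφ
  rw [coord_eq_comp _ hx, coord_eq_comp _ hx, mapLaplacianPowSucc_succ,
    pullback_iterate_mapLaplacian hφ hg (smooth_fieldZ g h),
    ← iterate_localLaplacian_congr (chartData gbar h hφ he he')
      (fun u hu => comp_mapLaplacian_add_pullback_fieldZ hφ he he' hg hu) j _ hu,
    iterate_localLaplacian_sub (chartData gbar h hφ he he')
      (fun u hu => hW.mapLaplacian hφ e he e' he' u hu) (fun u hu => hZ.neg e he e' he' u hu) j _ hu,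
    ← comp_iterate_mapLaplacian gbar h hφ he he' (hW.mapLaplacian hφ) j _ hu,
    ← comp_iterate_mapLaplacian gbar h hφ he he' hZ.neg j _ hu,
    iterate_mapLaplacian_neg hφ hZ, comp_neg]
  ring

end ChartData

end MapCov

end

/-! ### The main theorem -/

theorem mainTheorem5 (n k : ℕ) :
    ∃ P : MapCov.LowerOrder (2 * k + 1) (2 * k + 1) (2 * k),
    ∀ (M : Type*) [TopologicalSpace M] [ChartedSpace (MapCov.Model n) M] [IsManifold (𝓡 n) ∞ M]
      (N : Type*) [TopologicalSpace N] [ChartedSpace (MapCov.Model n) N] [IsManifold (𝓡 n) ∞ N]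
      (gbar : MapCov.Metric n M) (g h : MapCov.Metric n N)
      (φ : M → N) (_hφ : ContMDiff (𝓡 n) (𝓡 n) ∞ φ)
      (_hgbar : ∀ (x : M) (v w : TangentSpace (𝓡 n) x), gbar.inner x v w =
        g.inner (φ x) (mfderiv (𝓡 n) (𝓡 n) φ x v) (mfderiv (𝓡 n) (𝓡 n) φ x w)),
      MapCov.pullback φ (MapCov.differenceTensor g h) =
        -MapCov.mapCov gbar h (MapCov.differential φ) ∧
      MapCov.pullback φ ((MapCov.mapLaplacian g h)^[k] (MapCov.fieldV g h)) =
        -MapCov.mapLaplacianPowSucc gbar h φ k ∧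
      (1 ≤ k →
        ∀ e ∈ IsManifold.maximalAtlas (𝓡 n) ∞ M, ∀ e' ∈ IsManifold.maximalAtlas (𝓡 n) ∞ N,
        ∀ x ∈ e.source, φ x ∈ e'.source → ∀ γ : Fin n,
          MapCov.coord e' (φ x) γ
              (MapCov.pullback φ ((MapCov.mapLaplacian g h)^[k - 1] (MapCov.fieldZ g h)) x ![]) =
            -MapCov.coord e' (φ x) γ (MapCov.mapLaplacianPowSucc gbar h φ k x ![]) +
              P.eval gbar h φ e e' γ x) := by
  obtain rfl | ⟨j, rfl⟩ : k = 0 ∨ ∃ j, k = j + 1 := by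
    cases k with
    | zero => exact Or.inl rfl
    | succ j => exact Or.inr ⟨j, rfl⟩
  -- For `k = 0` the third identity is not claimed, so the empty expression will do.
  · refine ⟨⟨[], by simp⟩, ?_⟩
    intro M _ _ _ N _ _ _ gbar g h φ hφ hg
    exact ⟨MapCov.pullback_differenceTensor hφ hg, MapCov.pullback_iterate_fieldV hφ hg 0,
      fun hk => absurd hk (by simp)⟩
  -- Orders: `(2, 2, 1)` for the commutator, `(3, 3, 2)` after one covariant derivative, and `2 * j`
  -- more after `j` Laplacians. With `k = j + 1` these are `2k + 1`, `2k + 1` and `2k`.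
  · have hexpr := (MapCov.isTensorExpr_commutator (n := n)).localCov.crossTrace
    have hpow := hexpr.iterate_localLaplacian j
    obtain ⟨P, hP⟩ := (show MapCov.IsTensorExpr (2 * (j + 1) + 1) (2 * (j + 1) + 1) (2 * (j + 1)) _
      by convert hpow using 1 <;> ring).exists_lowerOrder
    refine ⟨P, ?_⟩
    intro M _ _ _ N _ _ _ gbar g h φ hφ hg
    refine ⟨MapCov.pullback_differenceTensor hφ hg, MapCov.pullback_iterate_fieldV hφ hg _, ?_⟩
    intro _ e he e' he' x hx hx' γ
    have hu : e x ∈ MapCov.localDomain φ e e' :=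
      ⟨e.map_source hx, by simpa [e.left_inv hx] using hx'⟩
    rw [MapCov.LowerOrder.eval_eq gbar h hφ he he' P hx hx',
      ← hP (MapCov.chartData gbar h hφ he he') _ hu ![]]
    exact MapCov.coord_pullback_iterate_fieldZ hφ he he' hg j hx hx' γ
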